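/- Conventions. Partitions are identified with Young diagrams; the residue of the node in row $r$ and column $c$ is $c-r$ modulo $2$, and the content of a partition is the multiset of residues of its nodes. For a partition $\lambda$ of $n$, let $[\lambda]$ be the character of the Specht module of $S_n$ in characteristic $0$. For $\varepsilon\in\{0,1\}$ let $e_\varepsilon$ and $f_\varepsilon$ be Robinson's $\varepsilon$-restriction and $\varepsilon$-induction maps on generalised characters of symmetric groups: linearly extended, $e_\varepsilon[\lambda]$ is the component of $[\lambda]{\downarrow}_{S_{n-1}}$ in the $2$-block whose content is obtained from that of $\lambda$ by deleting one $\varepsilon$, and $f_\varepsilon[\lambda]$ is the component of $[\lambda]{\uparrow}^{S_{n+1}}$ in the $2$-block whose content is obtained from that of $\lambda$ by adding one $\varepsilon$ (in both cases $0$ if there is no such block); here the content of a $2$-block is the common content of the partitions labelling the characters in it. Write $e_\varepsilon^{(k)}=e_\varepsilon^k/k!$, $f_\varepsilon^{(k)}=f_\varepsilon^k/k!$, and for $c\in\mathbb Z$ define the runner-swapping function $$S_\varepsilon^{(c)}=\sum_{k\ge\max\{0,-c\}}(-1)^{k+c}f_\varepsilon^{(k+c)}e_\varepsilon^{(k)}.$$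 The $2$-core of $\lambda$ is obtained by successively removing $2$-rim-hooks until none remain. For $r$ at least the length of $\lambda$, the $r$-bead abacus display of $\lambda$ has beads at the positions $\lambda_i+r-i$ ($1\le i\le r$), with the even positions on runner $0$ and the odd positions on runner $1$. The $2$-quotient $(\lambda^{(0)},\lambda^{(1)})$ is read off a display in which runner $1$ has at least as many beads as runner $0$: $\lambda^{(\eta)}_i$ is the number of empty positions above the $i$th lowest bead on runner $\eta$. Theorem. Let $\lambda$ be any partition. Its $2$-core is $(a,a-1,\dots,1)$ for some $a\ge 0$; let $\boldsymbol\lambda$ be its $2$-quotient. (i) Let $\varepsilon$ be the residue of $a$ modulo $2$. There is exactly one partition $\mu$ with $2$-core $(a+1,a,\dots,1)$ and $2$-quotient $\boldsymbol\lambda$, and $S_\varepsilon^{(a+1)}[\lambda]=\pm[\mu]$. (ii) Suppose $a\ge1$ and let $\varepsilon$ be the residue of $a+1$ modulo $2$. There is exactly one partition $\mu$ with $2$-core $(a-1,a-2,\dots,1)$ and $2$-quotient $\boldsymbol\lambda$, and $S_\varepsilon^{(-a)}[\lambda]=\pm[\mu]$. (iii) In terms of the abacus: take any $r$-bead abacus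 display of $\lambda$, suppose that it has $d\in\mathbb Z$ more beads on runner $0$ than on runner $1$, let $\varepsilon$ be the residue of $d+1$ modulo $2$, and let $\mu$ be the partition displayed after swapping the two runners. Then $S_\varepsilon^{(d)}[\lambda]=\pm[\mu]$ and $S_\varepsilon^{(-d)}[\mu]=\pm[\lambda]$. -/

import Mathlib

noncomputable section

open Equiv Finset

namespace RunnerSwap

/-! ### Partitions, residues, cores

A partition is identified with its Young diagram. Rows and columns are numbered from `0`, which
does not change the residue of a node (column minus row, modulo `2`). -/

/-- The residue of a node. -/
def residue (c : ℕ × ℕ) : ZMod 2 := (c.2 : ZMod 2) - (c.1 : ZMod 2)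

/-- The content of a partition: the multiset of residues of its nodes. -/
def content (μ : YoungDiagram) : Multiset (ZMod 2) := μ.cells.val.map residue

theorem finite_card_eq (n : ℕ) : {μ : YoungDiagram | μ.card = n}.Finite := by
  have h : Set.InjOn YoungDiagram.cells {μ : YoungDiagram | μ.card = n} :=
    fun μ _ ν _ h => YoungDiagram.ext h
  refine Set.Finite.of_finite_image ?_ h
  refine ((range n ×ˢ range n).powerset.finite_toSet).subset ?_
  rintro _ ⟨μ, hμ, rfl⟩
  simp only [Set.mem_ofPred_eq] at hμ
  simp only [coe_powerset, Set.mem_preimage, Set.mem_powerset_iff, coe_subset]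
  rintro ⟨i, j⟩ hij
  rw [mem_product, mem_range, mem_range]
  have hrow : (range (i + 1)).image (fun k => (k, 0)) ⊆ μ.cells := by
    intro c hc
    obtain ⟨k, hk, rfl⟩ := mem_image.1 hc
    exact μ.up_left_mem (Nat.lt_succ_iff.1 (mem_range.1 hk)) (Nat.zero_le j) hij
  have hcol : (range (j + 1)).image (fun k => (0, k)) ⊆ μ.cells := by
    intro c hc
    obtain ⟨k, hk, rfl⟩ := mem_image.1 hc
    exact μ.up_left_mem (Nat.zero_le i) (Nat.lt_succ_iff.1 (mem_range.1 hk)) hij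
  have h1 := card_le_card hrow
  have h2 := card_le_card hcol
  rw [card_image_of_injective _ (fun a b h => (Prod.ext_iff.1 h).1), card_range] at h1
  rw [card_image_of_injective _ (fun a b h => (Prod.ext_iff.1 h).2), card_range] at h2
  change #μ.cells = n at hμ
  constructor <;> (simp only; omega)

/-- The finite set of partitions of `n`. -/
def partitionsOf (n : ℕ) : Finset YoungDiagram := (finite_card_eq n).toFinset

/-- `(a, a - 1, …, 1)`. -/
def staircase (a : ℕ) : YoungDiagram where
  cells := (range a ×ˢ range a).filter fun c => c.1 + c.2 < a
  isLowerSet := by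
    rintro ⟨i, j⟩ ⟨i', j'⟩ ⟨hi, hj⟩ h
    simp only [coe_filter, mem_product, mem_range, Set.mem_ofPred_eq] at h ⊢
    simp only at hi hj
    omega

/-- `ν` is obtained from `μ` by removing a `2`-rim-hook, i.e. two adjacent nodes whose removal
leaves a Young diagram (such nodes automatically lie in the rim). -/
def RemovesDomino (μ ν : YoungDiagram) : Prop :=
  ∃ x y : ℕ × ℕ, (y = (x.1, x.2 + 1) ∨ y = (x.1 + 1, x.2)) ∧
    x ∉ ν.cells ∧ y ∉ ν.cells ∧ μ.cells = ν.cells ∪ {x, y}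

/-- `κ` is a `2`-core of `μ`: it is reached from `μ` by successively removing `2`-rim-hooks until
no more remain. -/
def IsTwoCore (μ κ : YoungDiagram) : Prop :=
  Relation.ReflTransGen RemovesDomino μ κ ∧ ∀ ν, ¬ RemovesDomino κ ν

/-! ### Abacus displays and quotients -/

/-- The set of occupied positions in the `r`-bead abacus display of `μ` (for `r` at least the
length `μ.colLen 0` of `μ`). -/
def betaSet (μ : YoungDiagram) (r : ℕ) : Finset ℕ :=
  (range r).image fun i => μ.rowLen i + (r - 1 - i)

/-- The rows occupied by beads on runner `i` (`i = 0, 1`) of a two-runner abacus whose set of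
occupied positions is `B`: position `2 * k + i` is in row `k` of runner `i`. -/
def runner (i : ℕ) (B : Finset ℕ) : Finset ℕ := (B.filter fun b => b % 2 = i).image (· / 2)

/-- The number of empty positions above position `b` on a one-runner abacus. -/
def emptyAbove (B : Finset ℕ) (b : ℕ) : ℕ := #((range b).filter (· ∉ B))

theorem emptyAbove_mono (B : Finset ℕ) : Monotone (emptyAbove B) := fun _ _ h =>
  card_le_card (filter_subset_filter _ (range_subset_range.2 h))

/-- The partition displayed on a one-runner abacus with set of occupied positions `B`: its `i`th
part is the number of empty positions above the `i`th lowest bead (position `0` being the top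
one, the lowest bead is the one at the largest position). -/
def partitionOfBeads (B : Finset ℕ) : YoungDiagram :=
  YoungDiagram.ofRowLens ((B.sort (· ≥ ·)).map (emptyAbove B))
    (List.Pairwise.sortedGE
      (List.pairwise_map.2 ((B.pairwise_sort (· ≥ ·)).imp fun h => emptyAbove_mono B h)))

/-- The number of beads used to read off the `2`-quotient: at least the length of `μ`, and such
that runner `1` has at least as many beads as runner `0`. -/
def quotientBeads (μ : YoungDiagram) : ℕ :=
  if #(runner 0 (betaSet μ (μ.colLen 0))) ≤ #(runner 1 (betaSet μ (μ.colLen 0)))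
  then μ.colLen 0 else μ.colLen 0 + 1

/-- The `2`-quotient of `μ`. -/
def twoQuotient (μ : YoungDiagram) : YoungDiagram × YoungDiagram :=
  (partitionOfBeads (runner 0 (betaSet μ (quotientBeads μ))),
   partitionOfBeads (runner 1 (betaSet μ (quotientBeads μ))))

/-- The positions obtained by swapping the two runners. -/
def swapRunners (B : Finset ℕ) : Finset ℕ :=
  B.image fun b => if b % 2 = 0 then b + 1 else b - 1

/-- The number of beads on runner `0` minus the number of beads on runner `1`. -/
def runnerDiff (B : Finset ℕ) : ℤ := (#(runner 0 B) : ℤ) - #(runner 1 B)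

/-! ### Specht modules and their characters -/

/-- Tableaux of shape `μ`, given by the position of each of the numbers in `Fin n`. There are none
unless `μ` has `n` nodes. -/
abbrev Tableau (n : ℕ) (μ : YoungDiagram) : Type := Fin n ≃ {c : ℕ × ℕ // c ∈ μ.cells}

/-- The tabloid of a tableau, recorded as the function sending each number to its row. -/
def tabloid {n : ℕ} {μ : YoungDiagram} (t : Tableau n μ) : Fin n → ℕ := fun k => (t k).1.1

/-- The tableau `π t`, with every entry `k` of `t` replaced by `π k`. -/
def act {n : ℕ} {μ : YoungDiagram} (π : Perm (Fin n)) (t : Tableau n μ) : Tableau n μ :=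
  π.symm.trans t

/-- The permutations preserving each column of `t`. -/
def colStab {n : ℕ} {μ : YoungDiagram} (t : Tableau n μ) : Finset (Perm (Fin n)) :=
  univ.filter fun π => ∀ k, (t (π k)).1.2 = (t k).1.2

/-- The permutation representation of the symmetric group on formal combinations of functions
`Fin n → ℕ`; the tabloids of a given shape span a subrepresentation. -/
def tabloidRep (n : ℕ) : Representation ℂ (Perm (Fin n)) ((Fin n → ℕ) →₀ ℂ) where
  toFun σ := Finsupp.lmapDomain ℂ ℂ fun r k => r (σ⁻¹ k)
  map_one' := by
    refine Finsupp.lhom_ext fun r c => ?_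
    simp
  map_mul' σ τ := by
    refine Finsupp.lhom_ext fun r c => ?_
    simp [Finsupp.mapDomain_single]

/-- The polytabloid `∑ sgn(π) {π t}`, the sum being over the column stabiliser of `t`. -/
def polytabloid {n : ℕ} {μ : YoungDiagram} (t : Tableau n μ) : (Fin n → ℕ) →₀ ℂ :=
  ∑ π ∈ colStab t, ((Perm.sign π : ℤ) : ℂ) • Finsupp.single (tabloid (act π t)) 1

theorem tabloidRep_polytabloid {n : ℕ} {μ : YoungDiagram} (σ : Perm (Fin n)) (t : Tableau n μ) :
    tabloidRep n σ (polytabloid t) = polytabloid (act σ t) := by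
  unfold polytabloid
  rw [map_sum]
  refine Finset.sum_bij (fun π _ => σ * π * σ⁻¹) ?_ ?_ ?_ ?_
  · intro π hπ
    refine mem_filter.2 ⟨mem_univ _, fun k => ?_⟩
    have := (mem_filter.1 hπ).2 (σ.symm k)
    simpa [act] using this
  · intro π _ π' _ h
    simpa using h
  · intro π hπ
    refine ⟨σ⁻¹ * π * σ, mem_filter.2 ⟨mem_univ _, fun k => ?_⟩, by group⟩
    have := (mem_filter.1 hπ).2 (σ k)
    simpa [act] using this
  · intro π _
    have hs : Perm.sign (σ * π * σ⁻¹) = Perm.sign π := by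
      rw [Perm.sign_mul, Perm.sign_mul, Perm.sign_inv, mul_right_comm, Int.units_mul_self, one_mul]
    rw [hs, map_smul]
    congr 1
    simp only [tabloidRep, MonoidHom.coe_mk, OneHom.coe_mk, Finsupp.lmapDomain_apply,
      Finsupp.mapDomain_single]
    congr 1
    funext k
    have hk : (σ * π * σ⁻¹).symm k = σ (π.symm (σ.symm k)) := rfl
    simp [tabloid, act, hk]

/-- The Specht module: the span of the polytabloids of shape `μ`. -/
def specht (n : ℕ) (μ : YoungDiagram) : Subrepresentation (tabloidRep n) where
  toSubmodule := Submodule.span ℂ (Set.range (polytabloid : Tableau n μ → _))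
  apply_mem_toSubmodule σ v hv := by
    refine Submodule.span_induction ?_ ?_ ?_ ?_ hv
    · rintro _ ⟨t, rfl⟩
      rw [tabloidRep_polytabloid]
      exact Submodule.subset_span ⟨_, rfl⟩
    · simp
    · intro x y _ _ hx hy
      rw [map_add]
      exact Submodule.add_mem _ hx hy
    · intro c x _ hx
      rw [map_smul]
      exact Submodule.smul_mem _ c hx

instance (n : ℕ) (μ : YoungDiagram) : FiniteDimensional ℂ (specht n μ).toSubmodule :=
  FiniteDimensional.span_of_finite ℂ (Set.finite_range _)

/-- The character of the Specht module labelled by a partition `μ` of `n`. -/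
def spechtChar (n : ℕ) (μ : YoungDiagram) : Perm (Fin n) → ℂ :=
  Representation.character (V := (specht n μ).toSubmodule) (specht n μ).toRepresentation

/-! ### Inner product, restriction, induction, blocks -/

/-- The inner product `⟨χ, ψ⟩ = |G|⁻¹ ∑ χ(g) ψ(g⁻¹)` of characters. -/
def charInner {G : Type*} [Group G] [Fintype G] (χ ψ : G → ℂ) : ℂ :=
  (Fintype.card G : ℂ)⁻¹ * ∑ g, χ g * ψ g⁻¹

/-- The embedding of `S_n` into `S_{n+1}` as the stabiliser of the last point. -/
def embed (n : ℕ) : Perm (Fin n) →* Perm (Fin (n + 1)) :=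
  Perm.viaEmbeddingHom (Fin.castSuccEmb (n := n))

/-- Restriction of characters from `S_{n+1}` to `S_n`. -/
def res {n : ℕ} (χ : Perm (Fin (n + 1)) → ℂ) : Perm (Fin n) → ℂ := fun h => χ (embed n h)

open Classical in
/-- Induction of characters from `S_n` to `S_{n+1}`: the value at `g` is `|S_n|⁻¹` times the sum of
`χ(x⁻¹ g x)` over those `x` in `S_{n+1}` for which `x⁻¹ g x` lies in `S_n`. -/
def ind {n : ℕ} (χ : Perm (Fin n) → ℂ) : Perm (Fin (n + 1)) → ℂ := fun g =>
  (Fintype.card (Perm (Fin n)) : ℂ)⁻¹ *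
    ∑ x : Perm (Fin (n + 1)), ∑ h : Perm (Fin n), if embed n h = x⁻¹ * g * x then χ h else 0

/-- The value `|K| χ(g) / χ(1)` of the central character of `χ` on the class sum of the conjugacy
class `K` of `g`. -/
def centralChar {G : Type*} [Group G] (χ : G → ℂ) (g : G) : ℂ :=
  (Nat.card {h : G // IsConj g h} : ℂ) * χ g / χ 1

/-- Two irreducible characters lie in the same `2`-block: their central characters are congruent
modulo the maximal ideals above `2` of the ring of algebraic integers. -/
def SameTwoBlock {G : Type*} [Group G] (χ ψ : G → ℂ) : Prop :=
  ∀ M : Ideal (integralClosure ℤ ℂ), M.IsMaximal → (2 : integralClosure ℤ ℂ) ∈ M →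
    ∀ g : G, ∃ x ∈ M, (x : ℂ) = centralChar χ g - centralChar ψ g

/-- The character labelled by the partition `μ` of `n` lies in the `2`-block with content `C`,
i.e. in the block of the characters labelled by partitions of `n` with content `C`. -/
def InBlock (n : ℕ) (C : Multiset (ZMod 2)) (μ : YoungDiagram) : Prop :=
  ∃ ν : YoungDiagram, ν.card = n ∧ content ν = C ∧ SameTwoBlock (spechtChar n μ) (spechtChar n ν)

open Classical in
/-- The component of `χ` lying in the `2`-block of `S_n` with content `C` (and `0` if there is no
such block). -/
def blockComponent (n : ℕ) (C : Multiset (ZMod 2)) (χ : Perm (Fin n) → ℂ) : Perm (Fin n) → ℂ :=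
  ∑ μ ∈ partitionsOf n with InBlock n C μ, charInner χ (spechtChar n μ) • spechtChar n μ

/-! ### The functors `e_ε`, `f_ε` and the runner-swapping functions -/

/-- The space in which generalised characters of all the symmetric groups live. -/
abbrev CharSpace : Type := DirectSum ℕ fun n => Perm (Fin n) → ℂ

theorem charInner_add {G : Type*} [Group G] [Fintype G] (χ χ' ψ : G → ℂ) :
    charInner (χ + χ') ψ = charInner χ ψ + charInner χ' ψ := by
  simp [charInner, add_mul, sum_add_distrib, mul_add]

theorem charInner_smul {G : Type*} [Group G] [Fintype G] (c : ℂ) (χ ψ : G → ℂ) :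
    charInner (c • χ) ψ = c * charInner χ ψ := by
  simp only [charInner, Pi.smul_apply, smul_eq_mul, mul_sum]
  exact sum_congr rfl fun _ _ => by ring

/-- The linear map defined on generalised characters of `S_n` by its values on the irreducible
characters. -/
def extendLinearly (n : ℕ) {V : Type*} [AddCommGroup V] [Module ℂ V] (v : YoungDiagram → V) :
    (Perm (Fin n) → ℂ) →ₗ[ℂ] V where
  toFun χ := ∑ μ ∈ partitionsOf n, charInner χ (spechtChar n μ) • v μ
  map_add' χ χ' := by simp [charInner_add, add_smul, sum_add_distrib]
  map_smul' c χ := by simp [charInner_smul, mul_smul, smul_sum]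

open Classical in
/-- `e_ε` from `S_{n+1}` to `S_n`: the character labelled by `μ` is sent to the component of its
restriction in the block whose content is that of `μ` with one `ε` removed (to `0` if `ε` does not
occur in the content of `μ`). -/
def eStep (ε : ZMod 2) (n : ℕ) : (Perm (Fin (n + 1)) → ℂ) →ₗ[ℂ] (Perm (Fin n) → ℂ) :=
  extendLinearly (n + 1) fun μ =>
    if ε ∈ content μ then
      blockComponent n ((content μ).erase ε) (res (spechtChar (n + 1) μ))
    else 0

/-- `f_ε` from `S_n` to `S_{n+1}`: the character labelled by `μ` is sent to the component of the
induced character in the block whose content is that of `μ` with one `ε` added. -/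
def fStep (ε : ZMod 2) (n : ℕ) : (Perm (Fin n) → ℂ) →ₗ[ℂ] (Perm (Fin (n + 1)) → ℂ) :=
  extendLinearly n fun μ => blockComponent (n + 1) (ε ::ₘ content μ) (ind (spechtChar n μ))

/-- The part of `e_ε` that is defined on characters of `S_n`. -/
def eComponent (ε : ZMod 2) : (n : ℕ) → (Perm (Fin n) → ℂ) →ₗ[ℂ] CharSpace
  | 0 => 0
  | n + 1 => DirectSum.lof ℂ ℕ (fun n => Perm (Fin n) → ℂ) n ∘ₗ eStep ε n

/-- The restriction functor `e_ε`. -/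
def eRes (ε : ZMod 2) : Module.End ℂ CharSpace :=
  DirectSum.toModule ℂ ℕ CharSpace (eComponent ε)

/-- The induction functor `f_ε`. -/
def fInd (ε : ZMod 2) : Module.End ℂ CharSpace :=
  DirectSum.toModule ℂ ℕ CharSpace fun n =>
    DirectSum.lof ℂ ℕ (fun n => Perm (Fin n) → ℂ) (n + 1) ∘ₗ fStep ε n

/-- The divided power `T^(k) = T^k / k!`. -/
def divPow (T : Module.End ℂ CharSpace) (k : ℕ) : Module.End ℂ CharSpace :=
  (k.factorial : ℂ)⁻¹ • T ^ k

/-- The runner-swapping function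
`S_ε^(c) = ∑_{a ≥ max(0, -c)} (-1)^(a+c) f_ε^(a+c) e_ε^(a)`. On every element of `CharSpace` only
finitely many terms are non-zero, since `e_ε` lowers degrees. -/
def runnerSwap (ε : ZMod 2) (c : ℤ) (F : CharSpace) : CharSpace :=
  ∑ᶠ (a : ℕ) (_ : 0 ≤ (a : ℤ) + c),
    (-1 : ℂ) ^ ((a : ℤ) + c).toNat •
      divPow (fInd ε) ((a : ℤ) + c).toNat (divPow (eRes ε) a F)

/-- The Specht character labelled by `μ`, as an element of `CharSpace`. -/
def spe (μ : YoungDiagram) : CharSpace :=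
  DirectSum.lof ℂ ℕ (fun n => Perm (Fin n) → ℂ) μ.card (spechtChar μ.card μ)

end RunnerSwap

end

open RunnerSwap

noncomputable section

open Equiv Finset

namespace RunnerSwap

section

/-! ### Column antisymmetrisers -/

variable {n : ℕ} {μ ν : YoungDiagram}

/-! The proof turns $e_\varepsilon$ and $f_\varepsilon$ into removal and addition of nodes of
residue $\varepsilon$, reads these as bead moves on the abacus, and evaluates the runner-swapping
function by inclusion–exclusion.

Representation theory. Column antisymmetrisers show that Specht modules have only scalar
endomorphisms and that there are no maps between different ones in one direction, which suffices for
orthonormality of the characters. Partitions are at least as numerous as conjugacy classes, so the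
characters span the class functions (`IsClassFun.eq_sum`). For the branching rule, an explicit
pairing shows that $[\nu]$ occurs in the restriction of $[\lambda]$ whenever $\nu\subset\lambda$
differ by one node. That nothing else occurs follows by counting: the numbers of saturated chains
and the degrees both have squares summing to $n!$ (`sum_chainCount_sq`, `sum_spechtDim_sq`). For
blocks, the class of transpositions is enough: its central character is the sum of column minus row,
so a block determines the sum of the residues modulo $2$ (`content_sum_eq_of_sameTwoBlock`). Among
diagrams differing from a given one by a single node, that sum fixes the residue of the node, so the
full classification of blocks is not needed. The results are `eRes_spe` and `fInd_spe`.

Abacus. With $r$ beads, adding a node of residue $r+1$ moves a bead from runner $0$ to runner $1$ in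
its row. Only rows with exactly one bead matter. Let $O$ be the set of these rows and $Q\subseteq O$
those with the bead on runner $1$; then $f_\varepsilon^{(k)}$ adds $k$ elements to $Q$ and
$e_\varepsilon^{(k)}$ removes $k$ elements, in all ways. With $c=|O\setminus Q|-|Q|$, the
coefficient of $Q'$ in the runner-swapping function is, up to sign, the alternating sum over subsets
$R$ of $Q\cap Q'$. It vanishes unless $Q'=O\setminus Q$, the configuration with the runners swapped
(`sum_powerset_alternating`, `runnerSwap_family`). As $d$ and $r$ have the same parity, this is
(iii).

Cores and quotients. Removing a domino preserves the difference $d$ between the runners, and an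
extra bead replaces $d$ by $1-d$ and interchanges the components of the quotient. Core $(a,\dots,1)$
therefore means $d\in\{-a,a+1\}$, and (i) and (ii) are (iii) for $d=a+1$ and $d=-a$. -/

theorem tabloidRep_single (σ : Perm (Fin n)) (s : Fin n → ℕ) (c : ℂ) :
    tabloidRep n σ (Finsupp.single s c) = Finsupp.single (fun k => s (σ⁻¹ k)) c := by
  simp [tabloidRep, Finsupp.mapDomain_single]

theorem mem_colStab {t : Tableau n μ} {π : Perm (Fin n)} :
    π ∈ colStab t ↔ ∀ k, (t (π k)).1.2 = (t k).1.2 := by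
  simp [colStab]

theorem one_mem_colStab (t : Tableau n μ) : (1 : Perm (Fin n)) ∈ colStab t := by
  simp [mem_colStab]

theorem mul_mem_colStab {t : Tableau n μ} {π τ : Perm (Fin n)} (hπ : π ∈ colStab t)
    (hτ : τ ∈ colStab t) : π * τ ∈ colStab t := by
  rw [mem_colStab] at *
  intro k
  rw [Perm.mul_apply, hπ, hτ]

theorem inv_mem_colStab {t : Tableau n μ} {π : Perm (Fin n)} (hπ : π ∈ colStab t) :
    π⁻¹ ∈ colStab t := by
  rw [mem_colStab] at *
  intro k
  rw [← hπ (π⁻¹ k), ← Perm.mul_apply, mul_inv_cancel, Perm.one_apply]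

theorem swap_mem_colStab {t : Tableau n μ} {a b : Fin n} (h : (t a).1.2 = (t b).1.2) :
    swap a b ∈ colStab t := by
  rw [mem_colStab]
  intro k
  rcases eq_or_ne k a with rfl | ha
  · rw [swap_apply_left, h]
  · rcases eq_or_ne k b with rfl | hb
    · rw [swap_apply_right, h]
    · rw [swap_apply_of_ne_of_ne ha hb]

/-- The sign of a permutation as a complex number. -/
def csign (π : Perm (Fin n)) : ℂ := ((Perm.sign π : ℤ) : ℂ)

theorem csign_mul (π τ : Perm (Fin n)) : csign (π * τ) = csign π * csign τ := by
  simp [csign]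

theorem csign_mul_self (π : Perm (Fin n)) : csign π * csign π = 1 := by
  rcases Int.units_eq_one_or (Perm.sign π) with h | h <;> simp [csign, h]

/-- The signed sum over the column stabiliser of `t`, as an operator on tabloids. -/
def colAntisymm (t : Tableau n μ) : Module.End ℂ ((Fin n → ℕ) →₀ ℂ) :=
  ∑ π ∈ colStab t, csign π • tabloidRep n π

theorem colAntisymm_apply (t : Tableau n μ) (v : (Fin n → ℕ) →₀ ℂ) :
    colAntisymm t v = ∑ π ∈ colStab t, csign π • tabloidRep n π v := by
  simp [colAntisymm, LinearMap.sum_apply]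

theorem polytabloid_eq (t : Tableau n μ) :
    polytabloid t = colAntisymm t (Finsupp.single (tabloid t) 1) := by
  rw [colAntisymm_apply]
  refine sum_congr rfl fun π _ => ?_
  rw [tabloidRep_single]
  rfl

theorem colAntisymm_tabloidRep (t : Tableau n μ) {τ : Perm (Fin n)} (hτ : τ ∈ colStab t)
    (v : (Fin n → ℕ) →₀ ℂ) :
    colAntisymm t (tabloidRep n τ v) = csign τ • colAntisymm t v := by
  rw [colAntisymm_apply, colAntisymm_apply, smul_sum]
  refine Finset.sum_bij (fun π _ => π * τ) (fun π hπ => mul_mem_colStab hπ hτ)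
    (fun _ _ _ _ h => mul_right_cancel h)
    (fun π hπ => ⟨π * τ⁻¹, mul_mem_colStab hπ (inv_mem_colStab hτ), by group⟩) fun π _ => ?_
  rw [map_mul, csign_mul, smul_smul, ← mul_assoc, mul_comm (csign τ), mul_assoc, csign_mul_self,
    mul_one]
  rfl

theorem colAntisymm_colAntisymm (t : Tableau n μ) (v : (Fin n → ℕ) →₀ ℂ) :
    colAntisymm t (colAntisymm t v) = (#(colStab t) : ℂ) • colAntisymm t v := by
  conv_lhs => rw [colAntisymm_apply t v]
  rw [map_sum]
  have : ∀ π ∈ colStab t, colAntisymm t (csign π • tabloidRep n π v) = colAntisymm t v := by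
    intro π hπ
    rw [map_smul, colAntisymm_tabloidRep t hπ, smul_smul, csign_mul_self, one_smul]
  rw [sum_congr rfl this, sum_const, ← Nat.cast_smul_eq_nsmul ℂ]

theorem card_colStab_ne_zero (t : Tableau n μ) : (#(colStab t) : ℂ) ≠ 0 :=
  Nat.cast_ne_zero.2 (card_ne_zero_of_mem (one_mem_colStab t))

/-- The transposition of `a` and `b` fixes `s` and is an odd column permutation, so the value equals
its own negative. -/
theorem colAntisymm_single_eq_zero (t : Tableau n μ) {s : Fin n → ℕ} {a b : Fin n} (hab : a ≠ b)
    (hs : s a = s b) (hcol : (t a).1.2 = (t b).1.2) :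
    colAntisymm t (Finsupp.single s 1) = 0 := by
  have h := colAntisymm_tabloidRep t (swap_mem_colStab hcol) (Finsupp.single s 1)
  have hfix : (fun k => s ((swap a b)⁻¹ k)) = s := by
    funext k
    rw [swap_inv]
    rcases eq_or_ne k a with rfl | ha
    · rw [swap_apply_left, hs]
    · rcases eq_or_ne k b with rfl | hb
      · rw [swap_apply_right, hs]
      · rw [swap_apply_of_ne_of_ne ha hb]
  have hsg : csign (swap a b) = -1 := by simp [csign, Perm.sign_swap hab]
  rw [tabloidRep_single, hfix, hsg, neg_one_smul] at h
  exact self_eq_neg.1 h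

/-- A column permutation keeps the column of every entry, so knowing the rows as well gives all
positions. -/
theorem tabloid_act_injective (t : Tableau n μ) {π τ : Perm (Fin n)} (hπ : π ∈ colStab t)
    (hτ : τ ∈ colStab t) (h : tabloid (act π t) = tabloid (act τ t)) : π = τ := by
  have key : π⁻¹ = τ⁻¹ := by
    ext1 k
    apply t.injective
    apply Subtype.ext
    refine Prod.ext (congrFun h k) ?_
    rw [mem_colStab.1 (inv_mem_colStab hπ), mem_colStab.1 (inv_mem_colStab hτ)]
  exact inv_injective key

theorem polytabloid_apply_tabloid (t : Tableau n μ) : polytabloid t (tabloid t) = 1 := by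
  have h1 : tabloid (act 1 t) = tabloid t := rfl
  rw [polytabloid, Finsupp.finsetSum_apply, sum_eq_single_of_mem 1 (one_mem_colStab t)]
  · simp [h1]
  · intro π hπ hne
    rw [Finsupp.smul_apply, Finsupp.single_apply, if_neg, smul_zero]
    intro h
    exact hne (tabloid_act_injective t hπ (one_mem_colStab t) h)

theorem polytabloid_ne_zero (t : Tableau n μ) : polytabloid t ≠ 0 := fun h => by
  have := polytabloid_apply_tabloid t
  simp [h] at this

/-- The sum of the row indices of the nodes. -/
def rowWeight (μ : YoungDiagram) : ℕ := ∑ c ∈ μ.cells, c.1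

theorem sum_tabloid (t : Tableau n μ) : ∑ k, tabloid t k = rowWeight μ := by
  rw [rowWeight, ← sum_coe_sort μ.cells]
  exact Equiv.sum_comp t (fun c : {c // c ∈ μ.cells} => c.1.1)

theorem card_tabloid_eq (t : Tableau n μ) (i : ℕ) :
    #(univ.filter fun k => tabloid t k = i) = μ.rowLen i := by
  rw [YoungDiagram.rowLen_eq_card]
  refine card_bij (fun k _ => (t k).1) ?_ ?_ ?_
  · intro k hk
    rw [YoungDiagram.mem_row_iff]
    exact ⟨(t k).2, (mem_filter.1 hk).2⟩
  · intro a _ b _ h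
    exact t.injective (Subtype.ext h)
  · intro c hc
    rw [YoungDiagram.mem_row_iff] at hc
    exact ⟨t.symm ⟨c, hc.1⟩, mem_filter.2 ⟨mem_univ _, by simpa [tabloid] using hc.2⟩,
      by simp⟩

theorem YoungDiagram_ext_rowLen (h : ∀ i, μ.rowLen i = ν.rowLen i) : μ = ν := by
  ext ⟨i, j⟩
  rw [YoungDiagram.mem_cells, YoungDiagram.mem_cells, YoungDiagram.mem_iff_lt_rowLen,
    YoungDiagram.mem_iff_lt_rowLen, h]

theorem sum_range_card_le (S : Finset ℕ) : ∑ i ∈ range #S, i ≤ ∑ i ∈ S, i := by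
  induction S using Finset.induction_on_max with
  | empty => simp
  | insert a S ha ih =>
    have hn : a ∉ S := fun h => lt_irrefl _ (ha a h)
    have hle : #S ≤ a := by
      calc #S ≤ #(range a) := card_le_card fun x hx => mem_range.2 (ha x hx)
        _ = a := card_range a
    rw [card_insert_of_notMem hn, sum_range_succ, sum_insert hn]
    omega

/-- This is the equality case of `sum_range_card_le`: a set of minimal sum is an initial segment. It
will force the row values in a column to fill the column from the top. -/
theorem lt_card_of_sum_le (S : Finset ℕ) (h : ∑ i ∈ S, i ≤ ∑ i ∈ range #S, i) :
    ∀ i ∈ S, i < #S := by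
  induction S using Finset.induction_on_max with
  | empty => simp
  | insert a S ha ih =>
    have hn : a ∉ S := fun h => lt_irrefl _ (ha a h)
    have hle : #S ≤ a := by
      calc #S ≤ #(range a) := card_le_card fun x hx => mem_range.2 (ha x hx)
        _ = a := card_range a
    have h2 := sum_range_card_le S
    rw [card_insert_of_notMem hn, sum_range_succ, sum_insert hn] at h
    rw [card_insert_of_notMem hn]
    intro i hi
    rcases mem_insert.1 hi with rfl | hi
    · omega
    · have := ih (by omega) i hi
      omega

theorem card_col_eq (t : Tableau n μ) (j : ℕ) :
    #(univ.filter fun k => (t k).1.2 = j) = μ.colLen j := by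
  rw [YoungDiagram.colLen_eq_card]
  refine card_bij (fun k _ => (t k).1) ?_ ?_ ?_
  · intro k hk
    rw [YoungDiagram.mem_col_iff]
    exact ⟨(t k).2, (mem_filter.1 hk).2⟩
  · intro a _ b _ h
    exact t.injective (Subtype.ext h)
  · intro c hc
    rw [YoungDiagram.mem_col_iff] at hc
    exact ⟨t.symm ⟨c, hc.1⟩, by simpa using hc.2, by simp⟩

/-- A row function that is injective on the columns of `t` and of minimal weight is the tabloid of
a column permutation of `t`. -/
theorem exists_colStab_of_injective (t : Tableau n μ) {s : Fin n → ℕ}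
    (hs : ∀ a b, a ≠ b → (t a).1.2 = (t b).1.2 → s a ≠ s b)
    (hw : ∑ k, s k ≤ rowWeight μ) : ∃ π ∈ colStab t, s = tabloid (act π t) := by
  have hinj : ∀ f : Fin n → ℕ, (∀ a b, a ≠ b → (t a).1.2 = (t b).1.2 → f a ≠ f b) → ∀ j,
      Set.InjOn f (univ.filter fun k => (t k).1.2 = j : Finset (Fin n)) := by
    intro f hf j a ha b hb hab
    by_contra hne
    simp only [coe_filter, mem_univ, true_and, Set.mem_ofPred_eq] at ha hb
    exact hf a b hne (ha.trans hb.symm) hab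
  have ht : ∀ a b, a ≠ b → (t a).1.2 = (t b).1.2 → tabloid t a ≠ tabloid t b := by
    intro a b hab hc h
    exact hab (t.injective (Subtype.ext (Prod.ext h hc)))
  set J : Finset ℕ := univ.image fun k => (t k).1.2 with hJ
  have hfib : ∀ f : Fin n → ℕ,
      ∑ k, f k = ∑ j ∈ J, ∑ k ∈ univ.filter (fun k => (t k).1.2 = j), f k := by
    intro f
    exact (sum_fiberwise_of_maps_to (fun k _ => mem_image_of_mem _ (mem_univ k)) f).symm
  set S : ℕ → Finset ℕ := fun j => (univ.filter fun k => (t k).1.2 = j).image s with hS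
  have hcard : ∀ j, #(S j) = μ.colLen j := by
    intro j
    rw [hS, card_image_of_injOn (hinj s hs j), card_col_eq]
  have hsum : ∀ j, ∑ k ∈ univ.filter (fun k => (t k).1.2 = j), s k = ∑ i ∈ S j, i := by
    intro j
    rw [hS, sum_image (hinj s hs j)]
  have hsumt : ∀ j, ∑ k ∈ univ.filter (fun k => (t k).1.2 = j), tabloid t k
      = ∑ i ∈ range (μ.colLen j), i := by
    intro j
    rw [← sum_image (f := fun i => i) (hinj (tabloid t) ht j)]
    congr 1
    apply eq_of_subset_of_card_le
    · intro i hi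
      obtain ⟨k, hk, rfl⟩ := mem_image.1 hi
      rw [mem_range, ← YoungDiagram.mem_iff_lt_colLen, ← (mem_filter.1 hk).2]
      exact (t k).2
    · rw [card_range, card_image_of_injOn (hinj _ ht j), card_col_eq]
  -- In each column `s` takes distinct values, so its weight there is at least that of `t`. The
  -- bound on the total weight makes every one of these inequalities an equality.
  have hle : ∀ j ∈ J, ∑ k ∈ univ.filter (fun k => (t k).1.2 = j), tabloid t k
      ≤ ∑ k ∈ univ.filter (fun k => (t k).1.2 = j), s k := by
    intro j _
    rw [hsumt, hsum, ← hcard]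
    exact sum_range_card_le _
  have heq := (sum_eq_sum_iff_of_le hle).1 (le_antisymm (sum_le_sum hle) (by
    rw [← hfib, ← hfib, sum_tabloid]; exact hw))
  have hmem : ∀ k, (s k, (t k).1.2) ∈ μ.cells := by
    intro k
    rw [YoungDiagram.mem_cells, YoungDiagram.mem_iff_lt_colLen, ← hcard]
    apply lt_card_of_sum_le
    · rw [← hsum, ← heq _ (mem_image_of_mem _ (mem_univ k)), hsumt, hcard]
    · exact mem_image_of_mem _ (by simp)
  -- `p k` is the entry of `t` at row `s k` in the column of `k`, so the permutation sought is the
  -- inverse of `p`.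
  let p : Fin n → Fin n := fun k => t.symm ⟨_, hmem k⟩
  have hp : Function.Bijective p := by
    rw [← Finite.injective_iff_bijective]
    intro a b hab
    have := Subtype.ext_iff.1 (t.symm.injective hab)
    by_contra hne
    exact hs a b hne (Prod.ext_iff.1 this).2 (Prod.ext_iff.1 this).1
  refine ⟨(Equiv.ofBijective p hp)⁻¹, inv_mem_colStab ?_, ?_⟩
  · rw [mem_colStab]
    intro k
    simp [p]
  · funext k
    change s k = (t (p k)).1.1
    simp [p]

theorem colAntisymm_single_mem (t : Tableau n μ) {s : Fin n → ℕ} (hw : ∑ k, s k ≤ rowWeight μ) :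
    colAntisymm t (Finsupp.single s 1) = 0 ∨ ∃ π ∈ colStab t, s = tabloid (act π t) ∧
      colAntisymm t (Finsupp.single s 1) = csign π • polytabloid t := by
  by_cases h : ∃ a b, a ≠ b ∧ (t a).1.2 = (t b).1.2 ∧ s a = s b
  · obtain ⟨a, b, hab, hc, hs⟩ := h
    exact Or.inl (colAntisymm_single_eq_zero t hab hs hc)
  · push Not at h
    obtain ⟨π, hπ, rfl⟩ := exists_colStab_of_injective t h hw
    refine Or.inr ⟨π, hπ, rfl, ?_⟩
    rw [polytabloid_eq, ← colAntisymm_tabloidRep t hπ, tabloidRep_single]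
    rfl

theorem eq_of_tabloid_eq (t : Tableau n μ) (u : Tableau n ν) (h : tabloid t = tabloid u) :
    μ = ν := by
  apply YoungDiagram_ext_rowLen
  intro i
  rw [← card_tabloid_eq t, ← card_tabloid_eq u, h]

/-! ### Homomorphisms between Specht modules -/

theorem specht_le_span_tabloid (n : ℕ) (μ : YoungDiagram) :
    (specht n μ).toSubmodule ≤
      Submodule.span ℂ (Set.range fun t : Tableau n μ => Finsupp.single (tabloid t) (1 : ℂ)) := by
  refine Submodule.span_le.2 ?_
  rintro _ ⟨t, rfl⟩
  exact Submodule.sum_mem _ fun π _ => Submodule.smul_mem _ _ (Submodule.subset_span ⟨act π t, rfl⟩)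

theorem polytabloid_mem (t : Tableau n μ) : polytabloid t ∈ (specht n μ).toSubmodule :=
  Submodule.subset_span ⟨t, rfl⟩

/-- The polytabloid of `t` as an element of the Specht module. -/
def spechtVec (t : Tableau n μ) : (specht n μ).toSubmodule := ⟨polytabloid t, polytabloid_mem t⟩

/-- The row weight takes the place of the dominance order: tabloids of shape `ν` have weight
`rowWeight ν`, so the dichotomy of `colAntisymm_single_mem` applies to each of them. -/
theorem colAntisymm_mem_of_specht (t : Tableau n μ) (hw : rowWeight ν ≤ rowWeight μ)
    {v : (Fin n → ℕ) →₀ ℂ} (hv : v ∈ (specht n ν).toSubmodule) :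
    colAntisymm t v ∈ Submodule.span ℂ {polytabloid t} := by
  have hv' := specht_le_span_tabloid n ν hv
  refine Submodule.span_induction (p := fun v _ => colAntisymm t v ∈
    Submodule.span ℂ {polytabloid t}) ?_ ?_ ?_ ?_ hv'
  · rintro _ ⟨u, rfl⟩
    rcases colAntisymm_single_mem t (s := tabloid u) (by rwa [sum_tabloid]) with h | ⟨π, _, _, h⟩
    · simp [h]
    · simp only [h]
      exact Submodule.smul_mem _ _ (Submodule.subset_span rfl)
  · simp
  · intro x y _ _ hx hy
    rw [map_add]
    exact Submodule.add_mem _ hx hy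
  · intro c x _ hx
    rw [map_smul]
    exact Submodule.smul_mem _ c hx

/-- A tabloid determines the row lengths of its shape, so for `μ ≠ ν` the second alternative of
`colAntisymm_single_mem` cannot occur. -/
theorem colAntisymm_eq_zero_of_specht (t : Tableau n μ) (hw : rowWeight ν ≤ rowWeight μ)
    (hne : μ ≠ ν) {v : (Fin n → ℕ) →₀ ℂ} (hv : v ∈ (specht n ν).toSubmodule) :
    colAntisymm t v = 0 := by
  have hv' := specht_le_span_tabloid n ν hv
  refine Submodule.span_induction (p := fun v _ => colAntisymm t v = 0) ?_ ?_ ?_ ?_ hv'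
  · rintro _ ⟨u, rfl⟩
    rcases colAntisymm_single_mem t (s := tabloid u) (by rwa [sum_tabloid]) with h | ⟨π, _, h, _⟩
    · exact h
    · exact absurd (eq_of_tabloid_eq _ _ h.symm) hne
  · simp
  · intro x y _ _ hx hy
    rw [map_add, hx, hy, add_zero]
  · intro c x _ hx
    rw [map_smul, hx, smul_zero]

/-- The representation of the symmetric group on the Specht module. -/
abbrev spechtRep (n : ℕ) (μ : YoungDiagram) :
    Representation ℂ (Perm (Fin n)) (specht n μ).toSubmodule :=
  (specht n μ).toRepresentation

theorem spechtRep_spechtVec (σ : Perm (Fin n)) (t : Tableau n μ) :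
    spechtRep n μ σ (spechtVec t) = spechtVec (act σ t) :=
  Subtype.ext (tabloidRep_polytabloid σ t)

/-- An intertwining map commutes with the antisymmetriser, and a polytabloid is an eigenvector of
it. As the eigenvalue is non-zero, the image of a polytabloid is confined to what the
antisymmetriser can produce. -/
theorem colAntisymm_coe_intertwining
    (φ : Representation.IntertwiningMap (spechtRep n μ) (spechtRep n ν)) (t : Tableau n μ) :
    colAntisymm t (φ (spechtVec t) : (Fin n → ℕ) →₀ ℂ) =
      (#(colStab t) : ℂ) • (φ (spechtVec t) : (Fin n → ℕ) →₀ ℂ) := by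
  have h1 : ∀ v : (specht n μ).toSubmodule, colAntisymm t (φ v : (Fin n → ℕ) →₀ ℂ) =
      φ (∑ π ∈ colStab t, csign π • spechtRep n μ π v) := by
    intro v
    rw [colAntisymm_apply, map_sum, Submodule.coe_sum]
    refine sum_congr rfl fun π _ => ?_
    rw [map_smul, φ.isIntertwining]
    rfl
  have h2 : ∑ π ∈ colStab t, csign π • spechtRep n μ π (spechtVec t) =
      (#(colStab t) : ℂ) • spechtVec t := by
    apply Subtype.ext
    rw [Submodule.coe_sum, Submodule.coe_smul]
    have := colAntisymm_colAntisymm t (Finsupp.single (tabloid t) 1)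
    rw [← polytabloid_eq, colAntisymm_apply] at this
    exact this
  rw [h1, h2, map_smul]
  rfl

theorem specht_induction {p : (specht n μ).toSubmodule → Prop} (hvec : ∀ t, p (spechtVec t))
    (h0 : p 0) (hadd : ∀ x y, p x → p y → p (x + y)) (hsmul : ∀ (c : ℂ) x, p x → p (c • x))
    (x : (specht n μ).toSubmodule) : p x := by
  obtain ⟨x, hx⟩ := x
  refine Submodule.span_induction (p := fun x hx => p ⟨x, hx⟩) ?_ h0 ?_ ?_ hx
  · rintro _ ⟨t, rfl⟩
    exact hvec t
  · intro x y hx hy h1 h2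
    exact hadd _ _ h1 h2
  · intro c x hx h1
    exact hsmul c _ h1

theorem intertwiningMap_eq_zero (hw : rowWeight ν ≤ rowWeight μ) (hne : μ ≠ ν)
    (φ : Representation.IntertwiningMap (spechtRep n μ) (spechtRep n ν)) : φ = 0 := by
  apply Representation.IntertwiningMap.ext
  ext1 x
  refine specht_induction (p := fun x => φ x = 0) ?_ (map_zero _) ?_ ?_ x
  · intro t
    have h1 := colAntisymm_coe_intertwining φ t
    rw [colAntisymm_eq_zero_of_specht t hw hne (φ (spechtVec t)).2] at h1
    exact Subtype.ext ((smul_eq_zero.1 h1.symm).resolve_left (card_colStab_ne_zero t))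
  · intro x y hx hy
    rw [map_add, hx, hy, add_zero]
  · intro c x hx
    rw [map_smul, hx, smul_zero]

/-- One polytabloid is sent to a multiple of itself, and its translates span the module. -/
theorem intertwiningMap_eq_smul (t : Tableau n μ)
    (φ : Representation.IntertwiningMap (spechtRep n μ) (spechtRep n μ)) :
    ∃ c : ℂ, ∀ x, c • x = φ x := by
  have h1 := colAntisymm_coe_intertwining φ t
  have h2 := colAntisymm_mem_of_specht t le_rfl (φ (spechtVec t)).2
  rw [h1] at h2
  rw [Submodule.smul_mem_iff _ (card_colStab_ne_zero t)] at h2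
  obtain ⟨c, hc⟩ := Submodule.mem_span_singleton.1 h2
  have hc' : φ (spechtVec t) = c • spechtVec t := Subtype.ext hc.symm
  refine ⟨c, fun x => ?_⟩
  refine specht_induction (p := fun x => c • x = φ x) ?_ (by simp) ?_ ?_ x
  · intro u
    have hu : u = act (t.trans u.symm) t := by
      ext1 k
      simp [act]
    rw [hu, ← spechtRep_spechtVec, φ.isIntertwining, hc', map_smul]
  · intro x y hx hy
    rw [map_add, smul_add, hx, hy]
  · intro a x hx
    rw [map_smul, ← hx, smul_comm]

/-! ### Orthonormality of the Specht characters -/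

theorem exists_tableau (h : μ.card = n) : Nonempty (Tableau n μ) := by
  refine ⟨Fintype.equivOfCardEq ?_⟩
  simp only [Fintype.card_fin, Fintype.card_coe]
  exact h.symm

theorem charInner_comm {G : Type*} [Group G] [Fintype G] (χ ψ : G → ℂ) :
    charInner χ ψ = charInner ψ χ := by
  unfold charInner
  congr 1
  rw [← Equiv.sum_comp (Equiv.inv G)]
  exact sum_congr rfl fun g _ => by simp [mul_comm]

theorem charInner_character {G V W : Type*} [Group G] [Fintype G] [AddCommGroup V] [Module ℂ V]
    [FiniteDimensional ℂ V] [AddCommGroup W] [Module ℂ W] [FiniteDimensional ℂ W]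
    (ρ : Representation ℂ G V) (σ : Representation ℂ G W) :
    charInner σ.character ρ.character =
      Module.finrank ℂ (Representation.IntertwiningMap ρ σ) := by
  have : Invertible (Nat.card G : ℂ) := invertibleOfNonzero (by simp)
  rw [← Representation.card_inv_mul_sum_char_mul_char_eq_finrank, charInner,
    Fintype.card_eq_nat_card]

theorem charInner_character_self {G V : Type*} [Group G] [Fintype G] [AddCommGroup V] [Module ℂ V]
    [FiniteDimensional ℂ V] (ρ : Representation ℂ G V) {x : V} (hx : x ≠ 0)
    (h : ∀ φ : Representation.IntertwiningMap ρ ρ,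
      ∃ c : ℂ, ∀ x, c • x = φ x) :
    charInner ρ.character ρ.character = 1 := by
  rw [charInner_character, Nat.cast_eq_one]
  refine finrank_eq_one (Representation.IntertwiningMap.id ρ) ?_ fun φ => ?_
  swap
  · obtain ⟨c, hc⟩ := h φ
    exact ⟨c, Representation.IntertwiningMap.ext (LinearMap.ext hc)⟩
  intro h0
  exact hx (congrArg (fun φ : Representation.IntertwiningMap ρ ρ => φ x) h0)

/-- Row weights are totally ordered and the inner product is symmetric, so vanishing of maps in one
direction is enough. -/
theorem charInner_spechtChar_of_ne (hne : μ ≠ ν) :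
    charInner (spechtChar n μ) (spechtChar n ν) = 0 := by
  wlog hw : rowWeight ν ≤ rowWeight μ generalizing μ ν
  · rw [charInner_comm]
    exact this hne.symm (by omega)
  rw [charInner_comm, spechtChar, spechtChar, charInner_character, Nat.cast_eq_zero]
  have : Subsingleton (Representation.IntertwiningMap (spechtRep n μ) (spechtRep n ν)) :=
    ⟨fun a b => by rw [intertwiningMap_eq_zero hw hne a, intertwiningMap_eq_zero hw hne b]⟩
  exact Module.finrank_zero_of_subsingleton

theorem charInner_spechtChar_self_of_tableau (t : Tableau n μ) :
    charInner (spechtChar n μ) (spechtChar n μ) = 1 := by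
  have h1 : spechtVec t ≠ 0 := fun h => polytabloid_ne_zero t (congrArg Subtype.val h)
  have h2 := charInner_character_self (V := (specht n μ).toSubmodule) (spechtRep n μ) h1
    (intertwiningMap_eq_smul t)
  exact h2

theorem charInner_spechtChar_self (h : μ.card = n) :
    charInner (spechtChar n μ) (spechtChar n μ) = 1 :=
  (exists_tableau h).elim charInner_spechtChar_self_of_tableau

theorem spechtChar_one_ne_zero (h : μ.card = n) : spechtChar n μ 1 ≠ 0 := by
  obtain ⟨t⟩ := exists_tableau h
  rw [spechtChar, Representation.char_one, Nat.cast_ne_zero]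
  have : Nontrivial (specht n μ).toSubmodule :=
    ⟨spechtVec t, 0, fun h => polytabloid_ne_zero t (congrArg Subtype.val h)⟩
  exact (Module.finrank_pos (R := ℂ) (M := (specht n μ).toSubmodule)).ne'

end

section

/-! ### The class sum of the transpositions -/

variable {n : ℕ} {μ ν : YoungDiagram}

/-- The sum of `column - row` over the nodes. -/
def contentSum (μ : YoungDiagram) : ℤ := ∑ c ∈ μ.cells, ((c.2 : ℤ) - c.1)

theorem card_left_in_row (t : Tableau n μ) (b : Fin n) :
    #(univ.filter fun a => (t a).1.1 = (t b).1.1 ∧ (t a).1.2 < (t b).1.2) = (t b).1.2 := by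
  conv_rhs => rw [← card_range (t b).1.2]
  refine card_bij (fun a _ => (t a).1.2) ?_ ?_ ?_
  · intro a ha
    exact mem_range.2 (mem_filter.1 ha).2.2
  · intro a ha a' ha' h
    refine t.injective (Subtype.ext (Prod.ext ?_ h))
    rw [(mem_filter.1 ha).2.1, (mem_filter.1 ha').2.1]
  · intro j hj
    have hm : ((t b).1.1, j) ∈ μ.cells :=
      μ.up_left_mem le_rfl (mem_range.1 hj).le (t b).2
    exact ⟨t.symm ⟨_, hm⟩, by simpa using hj, by simp⟩

theorem card_above_in_col (t : Tableau n μ) (b : Fin n) :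
    #(univ.filter fun a => (t a).1.2 = (t b).1.2 ∧ (t a).1.1 < (t b).1.1) = (t b).1.1 := by
  conv_rhs => rw [← card_range (t b).1.1]
  refine card_bij (fun a _ => (t a).1.1) ?_ ?_ ?_
  · intro a ha
    exact mem_range.2 (mem_filter.1 ha).2.2
  · intro a ha a' ha' h
    refine t.injective (Subtype.ext (Prod.ext h ?_))
    rw [(mem_filter.1 ha).2.1, (mem_filter.1 ha').2.1]
  · intro j hj
    have hm : (j, (t b).1.2) ∈ μ.cells :=
      μ.up_left_mem (mem_range.1 hj).le le_rfl (t b).2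
    exact ⟨t.symm ⟨_, hm⟩, by simpa using hj, by simp⟩

theorem isSwap_conj {σ π : Perm (Fin n)} (h : σ.IsSwap) : (π * σ * π⁻¹).IsSwap := by
  obtain ⟨x, y, hxy, rfl⟩ := h
  exact ⟨π x, π y, fun h => hxy (π.injective h), by
    rw [Equiv.swap_apply_apply]⟩

open Classical in
/-- The set of transpositions. -/
def transpositions (n : ℕ) : Finset (Perm (Fin n)) := univ.filter fun σ => σ.IsSwap

theorem mem_transpositions {σ : Perm (Fin n)} : σ ∈ transpositions n ↔ σ.IsSwap := by
  simp [transpositions]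

theorem sum_transpositions_comm (π : Perm (Fin n)) (v : (Fin n → ℕ) →₀ ℂ) :
    ∑ σ ∈ transpositions n, tabloidRep n σ (tabloidRep n π v) =
      tabloidRep n π (∑ σ ∈ transpositions n, tabloidRep n σ v) := by
  rw [map_sum]
  refine Finset.sum_bij (fun σ _ => π⁻¹ * σ * π) ?_ ?_ ?_ ?_
  · intro σ hσ
    rw [mem_transpositions] at *
    simpa using isSwap_conj (π := π⁻¹) hσ
  · intro σ _ τ _ h
    simpa using h
  · intro σ hσ
    refine ⟨π * σ * π⁻¹, ?_, by group⟩
    rw [mem_transpositions] at *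
    exact isSwap_conj hσ
  · intro σ _
    rw [← Module.End.mul_apply, ← Module.End.mul_apply, ← map_mul, ← map_mul]
    congr 2
    group

/-- Every transposition is written exactly once, with the entry at the lexicographically smaller
node first. -/
theorem sum_transpositions_eq {M : Type*} [AddCommMonoid M] (t : Tableau n μ)
    (F : Perm (Fin n) → M) : ∑ σ ∈ transpositions n, F σ =
      ∑ p ∈ univ.filter (fun p : Fin n × Fin n => toLex (t p.1).1 < toLex (t p.2).1),
        F (swap p.1 p.2) := by
  symm
  refine Finset.sum_bij (fun p _ => swap p.1 p.2) ?_ ?_ ?_ ?_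
  · rintro ⟨a, b⟩ h
    rw [mem_transpositions]
    refine ⟨a, b, ?_, rfl⟩
    rintro rfl
    simp at h
  · rintro ⟨a, b⟩ h ⟨c, d⟩ h' heq
    simp only [mem_filter, mem_univ, true_and] at h h' heq
    have hab : a ≠ b := by rintro rfl; exact lt_irrefl _ h
    have hcd : c ≠ d := by rintro rfl; exact lt_irrefl _ h'
    have h1 : swap c d a = b := by rw [← heq, swap_apply_left]
    rw [swap_apply_def] at h1
    split_ifs at h1 with h2 h3
    · rw [h2, h1]
    · rw [h3, ← h1] at h
      exact absurd h (lt_asymm h')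
    · exact absurd h1 hab
  · intro σ hσ
    rw [mem_transpositions] at hσ
    obtain ⟨x, y, hxy, rfl⟩ := hσ
    have hne : toLex (t x).1 ≠ toLex (t y).1 := fun h =>
      hxy (t.injective (Subtype.ext (toLex.injective h)))
    rcases lt_or_gt_of_ne hne with h | h
    · exact ⟨(x, y), by simpa using h, rfl⟩
    · exact ⟨(y, x), by simpa using h, swap_comm _ _⟩
  · intro _ _
    rfl

/-- Entries in one row leave the tabloid unchanged, entries in one column give the sign, and in
general position the result vanishes. -/
theorem colAntisymm_swap (t : Tableau n μ) {a b : Fin n} (h : toLex (t a).1 < toLex (t b).1) :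
    colAntisymm t (tabloidRep n (swap a b) (Finsupp.single (tabloid t) 1)) =
      ((if (t a).1.1 = (t b).1.1 then 1 else 0) - (if (t a).1.2 = (t b).1.2 then 1 else 0) : ℂ) •
        polytabloid t := by
  have hab : a ≠ b := by rintro rfl; exact lt_irrefl _ h
  rw [Prod.Lex.toLex_lt_toLex] at h
  by_cases hrow : (t a).1.1 = (t b).1.1
  · have hcol : (t a).1.2 ≠ (t b).1.2 := fun hc => hab (t.injective (Subtype.ext (Prod.ext hrow hc)))
    rw [if_pos hrow, if_neg hcol, sub_zero, one_smul, tabloidRep_single, polytabloid_eq]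
    congr 2
    funext k
    rw [swap_inv]
    rcases eq_or_ne k a with rfl | ha
    · rw [swap_apply_left]; exact hrow.symm
    · rcases eq_or_ne k b with rfl | hb
      · rw [swap_apply_right]; exact hrow
      · rw [swap_apply_of_ne_of_ne ha hb]
  · rw [if_neg hrow]
    by_cases hcol : (t a).1.2 = (t b).1.2
    · rw [if_pos hcol, colAntisymm_tabloidRep t (swap_mem_colStab hcol), polytabloid_eq]
      congr 1
      simp [csign, Perm.sign_swap hab]
    · rw [if_neg hcol, sub_zero, zero_smul, tabloidRep_single, swap_inv]
      have hlt : (t a).1.1 < (t b).1.1 := by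
        rcases h with h | h
        · exact h
        · exact absurd h.1 hrow
      -- The entry `k` in the row of `a` and the column of `b` is in the way: after the swap, `k`
      -- and `b` have the same row value while sharing a column of `t`.
      have hm : ((t a).1.1, (t b).1.2) ∈ μ.cells := μ.up_left_mem hlt.le le_rfl (t b).2
      obtain ⟨k, hk⟩ := t.surjective ⟨_, hm⟩
      have hka : k ≠ a := by
        rintro rfl
        rw [hk] at hcol
        exact hcol rfl
      have hkb : k ≠ b := by
        rintro rfl
        rw [hk] at hlt
        exact lt_irrefl _ hlt
      refine colAntisymm_single_eq_zero t hkb ?_ ?_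
      · rw [swap_apply_of_ne_of_ne hka hkb, swap_apply_right, tabloid, hk]
        rfl
      · rw [hk]

/-- The sum of the transpositions is central, so it can be applied before antisymmetrising. Each
entry `b` then contributes the number of entries to its left minus the number above it, which is
column minus row. -/
theorem sum_transpositions_polytabloid (t : Tableau n μ) :
    ∑ σ ∈ transpositions n, tabloidRep n σ (polytabloid t) =
      (contentSum μ : ℂ) • polytabloid t := by
  have h1 : ∑ σ ∈ transpositions n, tabloidRep n σ (polytabloid t) =
      ∑ σ ∈ transpositions n, colAntisymm t (tabloidRep n σ (Finsupp.single (tabloid t) 1)) := by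
    rw [← map_sum, colAntisymm_apply]
    simp_rw [polytabloid_eq, colAntisymm_apply, map_sum, map_smul]
    rw [sum_comm]
    refine sum_congr rfl fun π _ => ?_
    rw [← smul_sum, sum_transpositions_comm, map_sum]
  rw [h1, sum_transpositions_eq t]
  have h2 : ∀ p ∈ univ.filter (fun p : Fin n × Fin n => toLex (t p.1).1 < toLex (t p.2).1),
      colAntisymm t (tabloidRep n (swap p.1 p.2) (Finsupp.single (tabloid t) 1)) =
      ((if (t p.1).1.1 = (t p.2).1.1 then 1 else 0) -
        (if (t p.1).1.2 = (t p.2).1.2 then 1 else 0) : ℂ) • polytabloid t :=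
    fun p hp => colAntisymm_swap t (mem_filter.1 hp).2
  rw [sum_congr rfl h2, ← sum_smul]
  congr 1
  rw [sum_filter, Fintype.sum_prod_type_right]
  have h3 : ∀ b : Fin n, ∑ a, (if toLex (t a).1 < toLex (t b).1 then
      ((if (t a).1.1 = (t b).1.1 then 1 else 0) -
        (if (t a).1.2 = (t b).1.2 then 1 else 0) : ℂ) else 0) =
      ((t b).1.2 : ℂ) - (t b).1.1 := by
    intro b
    have h4 : ∀ a, (if toLex (t a).1 < toLex (t b).1 then
      ((if (t a).1.1 = (t b).1.1 then 1 else 0) -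
        (if (t a).1.2 = (t b).1.2 then 1 else 0) : ℂ) else 0) =
        (if (t a).1.1 = (t b).1.1 ∧ (t a).1.2 < (t b).1.2 then 1 else 0) -
        (if (t a).1.2 = (t b).1.2 ∧ (t a).1.1 < (t b).1.1 then 1 else 0) := by
      intro a
      have hlex := Prod.Lex.toLex_lt_toLex (x := (t a).1) (y := (t b).1)
      simp only [hlex]
      split_ifs <;> first | (exfalso; omega) | simp
    rw [sum_congr rfl fun a _ => h4 a, sum_sub_distrib, sum_boole, sum_boole, card_left_in_row,
      card_above_in_col]
  rw [sum_congr rfl fun b _ => h3 b, contentSum, Int.cast_sum, ← sum_coe_sort μ.cells,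
    ← Equiv.sum_comp t]
  simp

theorem sum_transpositions_spechtChar (n : ℕ) (μ : YoungDiagram) :
    ∑ σ ∈ transpositions n, spechtChar n μ σ = contentSum μ * spechtChar n μ 1 := by
  have h : ∑ σ ∈ transpositions n, spechtRep n μ σ = (contentSum μ : ℂ) • spechtRep n μ 1 := by
    ext1 x
    rw [LinearMap.sum_apply]
    refine specht_induction (p := fun x => ∑ σ ∈ transpositions n, spechtRep n μ σ x =
      ((contentSum μ : ℂ) • spechtRep n μ 1) x) ?_ (by simp) ?_ ?_ x
    · intro t
      apply Subtype.ext
      rw [Submodule.coe_sum, map_one]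
      exact sum_transpositions_polytabloid t
    · intro x y hx hy
      simp_rw [map_add, sum_add_distrib]
      rw [hx, hy]
    · intro c x hx
      simp_rw [map_smul, ← smul_sum]
      rw [hx]
  have h2 := congrArg (LinearMap.trace ℂ (specht n μ).toSubmodule) h
  rw [map_sum, map_smul] at h2
  exact h2

/-! ### Blocks -/

/-- Without such an ideal `SameTwoBlock` would hold vacuously. If `2` were a unit, `1 / 2` would be
a rational algebraic integer, hence an integer. -/
theorem exists_maximal_two :
    ∃ M : Ideal (integralClosure ℤ ℂ), M.IsMaximal ∧ (2 : integralClosure ℤ ℂ) ∈ M := by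
  have h : Ideal.span {(2 : integralClosure ℤ ℂ)} ≠ ⊤ := by
    rw [Ne, Ideal.span_singleton_eq_top]
    rintro ⟨u, hu⟩
    have h1 : (2 : ℂ) * ((u⁻¹ : (integralClosure ℤ ℂ)ˣ) : integralClosure ℤ ℂ) = 1 := by
      have := congrArg (fun x : integralClosure ℤ ℂ => (x : ℂ)) (u.mul_inv)
      rw [hu] at this
      exact this
    set x : integralClosure ℤ ℂ := ((u⁻¹ : (integralClosure ℤ ℂ)ˣ) : integralClosure ℤ ℂ)
    have h2 : (x : ℂ) = algebraMap ℚ ℂ (1 / 2) := by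
      simp only [map_div₀, map_one, map_ofNat]
      rw [eq_div_iff (by norm_num), mul_comm]
      exact h1
    have h3 : IsIntegral ℤ (1 / 2 : ℚ) := by
      have := x.2
      rw [mem_integralClosure_iff, h2] at this
      exact (isIntegral_algebraMap_iff (algebraMap ℚ ℂ).injective).1 this
    obtain ⟨y, hy⟩ := IsIntegrallyClosed.isIntegral_iff.1 h3
    have h4 : (y : ℚ) * 2 = 1 := by
      rw [show (y : ℚ) = 1 / 2 from hy]; norm_num
    have h5 : y * 2 = 1 := by exact_mod_cast h4
    omega
  obtain ⟨M, hM, hle⟩ := Ideal.exists_le_maximal _ h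
  exact ⟨M, hM, hle (Ideal.subset_span rfl)⟩

theorem centralChar_swap (hμ : μ.card = n) {a b : Fin n} (hab : a ≠ b) :
    centralChar (spechtChar n μ) (swap a b) = contentSum μ := by
  have hiff : ∀ h : Perm (Fin n), IsConj (swap a b) h ↔ h ∈ transpositions n := by
    intro h
    rw [mem_transpositions]
    constructor
    · intro hc
      obtain ⟨π, rfl⟩ := isConj_iff.1 hc
      exact isSwap_conj ⟨a, b, hab, rfl⟩
    · rintro ⟨c, d, hcd, rfl⟩
      exact Perm.isConj_swap hab hcd
  have hcard : Nat.card {h : Perm (Fin n) // IsConj (swap a b) h} = #(transpositions n) := by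
    rw [Nat.card_congr (Equiv.subtypeEquivRight hiff)]
    simp
  have hsum : ∑ σ ∈ transpositions n, spechtChar n μ σ =
      #(transpositions n) * spechtChar n μ (swap a b) := by
    rw [← nsmul_eq_mul, ← sum_const]
    refine sum_congr rfl fun σ hσ => ?_
    obtain ⟨π, rfl⟩ := isConj_iff.1 ((hiff σ).2 hσ)
    exact Representation.char_conj _ _ _
  rw [centralChar, hcard, ← hsum, sum_transpositions_spechtChar,
    mul_div_cancel_right₀ _ (spechtChar_one_ne_zero hμ)]

theorem contentSum_cast (μ : YoungDiagram) : (contentSum μ : ZMod 2) = (content μ).sum := by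
  simp [contentSum, content, residue]

theorem eq_of_card_le_one (hμ : μ.card = n) (hν : ν.card = n) (hn : n ≤ 1) : μ = ν := by
  have h0 : ∀ κ : YoungDiagram, κ.card ≤ 1 → ∀ c ∈ κ.cells, c = (0, 0) := by
    rintro κ hκ ⟨i, j⟩ hc
    have := card_le_one.1 hκ (0, 0) (κ.up_left_mem (Nat.zero_le _) (Nat.zero_le _) hc) _ hc
    exact this.symm
  have h1 : ∀ κ κ' : YoungDiagram, κ.card = n → κ'.card = n → κ ≤ κ' := by
    intro κ κ' h h' c hc
    have hn1 : n = 1 := by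
      have : 0 < #κ.cells := card_pos.2 ⟨c, hc⟩
      have h' : #κ.cells = n := h
      omega
    have hpos : 0 < #κ'.cells := by
      have : #κ'.cells = n := h'
      omega
    obtain ⟨d, hd⟩ := card_pos.1 hpos
    rw [h0 κ (by omega) c hc, ← h0 κ' (by omega) d hd]
    exact hd
  exact le_antisymm (h1 _ _ hμ hν) (h1 _ _ hν hμ)

/-- If the sums differed, the central characters at a transposition would differ by an odd integer;
this would lie in `M` together with `2`, putting `1` in `M`. For `n ≤ 1` there is no transposition,
but also only one partition. -/
theorem content_sum_eq_of_sameTwoBlock (hμ : μ.card = n) (hν : ν.card = n)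
    (h : SameTwoBlock (spechtChar n μ) (spechtChar n ν)) :
    (content μ).sum = (content ν).sum := by
  rcases Nat.lt_or_ge 1 n with hn | hn
  · obtain ⟨M, hM, h2⟩ := exists_maximal_two
    have hab : (⟨0, by omega⟩ : Fin n) ≠ ⟨1, hn⟩ := by simp [Fin.ext_iff]
    obtain ⟨x, hx, hxe⟩ := h M hM h2 (swap ⟨0, by omega⟩ ⟨1, hn⟩)
    rw [centralChar_swap hμ hab, centralChar_swap hν hab, ← Int.cast_sub] at hxe
    have hx' : x = ((contentSum μ - contentSum ν : ℤ) : integralClosure ℤ ℂ) := by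
      apply Subtype.ext
      rw [hxe]
      simp
    rw [← contentSum_cast, ← contentSum_cast, ← sub_eq_zero, ← Int.cast_sub,
      ZMod.intCast_zmod_eq_zero_iff_dvd]
    by_contra hodd
    obtain ⟨m, hm⟩ : Odd (contentSum μ - contentSum ν) := by
      rw [← Int.not_even_iff_odd, even_iff_two_dvd]
      exact hodd
    rw [hx', hm] at hx
    apply hM.ne_top
    rw [Ideal.eq_top_iff_one]
    have h3 : ((2 * m + 1 : ℤ) : integralClosure ℤ ℂ) - m * 2 = 1 := by push_cast; ring
    rw [← h3]
    exact M.sub_mem hx (M.mul_mem_left _ h2)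
  · rw [eq_of_card_le_one hμ hν hn]

theorem content_sum_eq_of_inBlock {C : Multiset (ZMod 2)} (hμ : μ.card = n)
    (h : InBlock n C μ) : (content μ).sum = C.sum := by
  obtain ⟨ν, hν, rfl, hb⟩ := h
  exact content_sum_eq_of_sameTwoBlock hμ hν hb

theorem inBlock_content (hμ : μ.card = n) : InBlock n (content μ) μ :=
  ⟨μ, hμ, rfl, fun M _ _ g => ⟨0, M.zero_mem, by simp⟩⟩

end

section

/-! ### Completeness of the Specht characters -/

variable {n : ℕ} {μ ν : YoungDiagram}

theorem mem_partitionsOf : μ ∈ partitionsOf n ↔ μ.card = n := by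
  simp [partitionsOf]

theorem card_ofRowLens (w : List ℕ) (hw : w.SortedGE) : (YoungDiagram.ofRowLens w hw).card = w.sum := by
  change #(YoungDiagram.cellsOfRowLens w) = w.sum
  clear hw
  induction w with
  | nil => simp [YoungDiagram.cellsOfRowLens]
  | cons a w ih =>
    rw [YoungDiagram.cellsOfRowLens, card_union_of_disjoint, card_map, ih, card_product]
    · simp
    · rw [disjoint_left]
      rintro ⟨i, j⟩ h1 h2
      rw [mem_map] at h2
      obtain ⟨⟨i', j'⟩, _, h⟩ := h2
      simp only [mem_product, mem_singleton] at h1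
      simp only [Function.Embedding.prodMap, Function.Embedding.coeFn_mk, Prod.map,
        Prod.mk.injEq] at h
      omega

/-- The partition of `n` given by the cycle type of a permutation. -/
def cycleDiagram (σ : Perm (Fin n)) : YoungDiagram :=
  YoungDiagram.ofRowLens (σ.partition.parts.sort (· ≥ ·))
    (List.Pairwise.sortedGE (Multiset.pairwise_sort _ _))

theorem card_cycleDiagram (σ : Perm (Fin n)) : (cycleDiagram σ).card = n := by
  rw [cycleDiagram, card_ofRowLens, ← Multiset.sum_coe, Multiset.sort_eq, σ.partition.parts_sum,
    Fintype.card_fin]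

theorem cycleDiagram_eq_iff {σ τ : Perm (Fin n)} :
    cycleDiagram σ = cycleDiagram τ ↔ IsConj σ τ := by
  rw [Perm.partition_eq_of_isConj]
  constructor
  · intro h
    have hpos : ∀ σ : Perm (Fin n), ∀ x ∈ σ.partition.parts.sort (· ≥ ·), 0 < x :=
      fun σ x hx => σ.partition.parts_pos ((Multiset.mem_sort _).1 hx)
    have h1 := congrArg YoungDiagram.rowLens h
    rw [cycleDiagram, cycleDiagram, YoungDiagram.rowLens_ofRowLens_eq_self (hpos σ),
      YoungDiagram.rowLens_ofRowLens_eq_self (hpos τ)] at h1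
    have h2 := congrArg (fun l : List ℕ => (l : Multiset ℕ)) h1
    simp only [Multiset.sort_eq] at h2
    exact Nat.Partition.ext h2
  · intro h
    unfold cycleDiagram
    congr 2
    rw [h]

/-- Cycle types inject the classes into the partitions. This inequality is enough, since the
orthonormal Specht characters are independent class functions. -/
theorem card_conjClasses_le (n : ℕ) :
    Nat.card (ConjClasses (Perm (Fin n))) ≤ #(partitionsOf n) := by
  have h : Nat.card (partitionsOf n) = #(partitionsOf n) := by simp
  rw [← h]
  refine Nat.card_le_card_of_injective
    (fun C : ConjClasses (Perm (Fin n)) => (⟨cycleDiagram C.out,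
      mem_partitionsOf.2 (card_cycleDiagram _)⟩ : partitionsOf n)) ?_
  intro C D hCD
  have h1 := cycleDiagram_eq_iff.1 (Subtype.ext_iff.1 hCD)
  rw [← ConjClasses.mk_eq_mk_iff_isConj] at h1
  rw [← Quotient.out_eq C, ← Quotient.out_eq D]
  exact h1

/-- A function on a group that is constant on conjugacy classes. -/
def IsClassFun {G : Type*} [Group G] (χ : G → ℂ) : Prop := ∀ g h, χ (h * g * h⁻¹) = χ g

theorem isClassFun_spechtChar (n : ℕ) (μ : YoungDiagram) : IsClassFun (spechtChar n μ) :=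
  fun g h => Representation.char_conj _ g h

/-- Functions on conjugacy classes as functions on the group. -/
def classFunMap (G : Type*) [Group G] : (ConjClasses G → ℂ) →ₗ[ℂ] (G → ℂ) :=
  LinearMap.funLeft ℂ ℂ ConjClasses.mk

theorem IsClassFun.mem_range {G : Type*} [Group G] {χ : G → ℂ} (h : IsClassFun χ) :
    χ ∈ LinearMap.range (classFunMap G) := by
  refine ⟨fun C => χ C.out, ?_⟩
  funext g
  have h1 : IsConj g (ConjClasses.mk g).out := by
    rw [← ConjClasses.mk_eq_mk_iff_isConj]
    exact (Quotient.out_eq (ConjClasses.mk g)).symm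
  obtain ⟨x, hx⟩ := isConj_iff.1 h1
  change χ (ConjClasses.mk g).out = χ g
  rw [← hx, h]

theorem charInner_sum {ι G : Type*} [Group G] [Fintype G] (s : Finset ι) (F : ι → G → ℂ)
    (ψ : G → ℂ) : charInner (∑ i ∈ s, F i) ψ = ∑ i ∈ s, charInner (F i) ψ := by
  classical
  induction s using Finset.induction_on with
  | empty => simp [charInner]
  | insert a s ha ih => rw [sum_insert ha, sum_insert ha, charInner_add, ih]

theorem charInner_sum_smul (c : partitionsOf n → ℂ) (κ : partitionsOf n) :
    charInner (∑ μ, c μ • spechtChar n μ) (spechtChar n κ) = c κ := by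
  rw [charInner_sum, sum_eq_single κ]
  · rw [charInner_smul, charInner_spechtChar_self (mem_partitionsOf.1 κ.2), mul_one]
  · intro b _ hb
    rw [charInner_smul, charInner_spechtChar_of_ne (fun h => hb (Subtype.ext h)), mul_zero]
  · intro h
    exact absurd (mem_univ _) h

/-- Orthonormality gives independence, and the dimension of the class functions is at most the
number of characters, so they span. -/
theorem IsClassFun.eq_sum {χ : Perm (Fin n) → ℂ} (h : IsClassFun χ) :
    χ = ∑ μ ∈ partitionsOf n, charInner χ (spechtChar n μ) • spechtChar n μ := by
  have hli : LinearIndependent ℂ fun μ : partitionsOf n => spechtChar n μ := by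
    rw [Fintype.linearIndependent_iff]
    intro c hc κ
    rw [← charInner_sum_smul c κ, hc]
    simp [charInner]
  have hle : Submodule.span ℂ (Set.range fun μ : partitionsOf n => spechtChar n μ) ≤
      LinearMap.range (classFunMap (Perm (Fin n))) := by
    rw [Submodule.span_le]
    rintro _ ⟨μ, rfl⟩
    exact (isClassFun_spechtChar n μ).mem_range
  have heq := Submodule.eq_of_le_of_finrank_le hle (by
    rw [finrank_span_eq_card hli]
    refine (LinearMap.finrank_range_le _).trans ?_
    rw [Module.finrank_fintype_fun_eq_card, ← Nat.card_eq_fintype_card, Fintype.card_coe]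
    exact card_conjClasses_le n)
  have hmem := h.mem_range
  rw [← heq, Submodule.mem_span_range_iff_exists_fun] at hmem
  obtain ⟨c, rfl⟩ := hmem
  conv_rhs => rw [← sum_coe_sort]
  exact sum_congr rfl fun κ _ => by rw [charInner_sum_smul]

/-! ### The embedding of `S_n` into `S_{n+1}` -/

theorem embed_castSucc (σ : Perm (Fin n)) (k : Fin n) :
    embed n σ k.castSucc = (σ k).castSucc := by
  rw [embed, Perm.viaEmbeddingHom_apply]
  exact Perm.viaEmbedding_apply σ Fin.castSuccEmb k

theorem embed_last (σ : Perm (Fin n)) : embed n σ (Fin.last n) = Fin.last n := by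
  rw [embed, Perm.viaEmbeddingHom_apply]
  apply Perm.viaEmbedding_apply_of_notMem
  rintro ⟨k, hk⟩
  exact (Fin.castSucc_lt_last k).ne hk

theorem embed_injective (n : ℕ) : Function.Injective (embed n) :=
  Perm.viaEmbeddingHom_injective _

theorem csign_embed (σ : Perm (Fin n)) : csign (embed n σ) = csign σ := by
  classical
  rw [csign, csign, embed, Perm.viaEmbeddingHom_apply, Perm.viaEmbedding]
  congr 2
  convert Perm.sign_extendDomain σ _

theorem exists_embed_eq {π : Perm (Fin (n + 1))} (h : π (Fin.last n) = Fin.last n) :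
    ∃ σ, embed n σ = π := by
  have hne : ∀ k : Fin n, π k.castSucc ≠ Fin.last n := by
    intro k hk
    rw [← h] at hk
    exact (Fin.castSucc_lt_last k).ne (π.injective hk)
  let p : Fin n → Fin n := fun k => (π k.castSucc).castPred (hne k)
  have hp : Function.Bijective p := by
    rw [← Finite.injective_iff_bijective]
    intro a b hab
    exact Fin.castSucc_injective n (π.injective (Fin.castPred_inj.1 hab))
  refine ⟨Equiv.ofBijective p hp, ?_⟩
  ext1 k
  refine Fin.lastCases ?_ (fun k => ?_) k
  · rw [embed_last, h]
  · rw [embed_castSucc]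
    simp [p]

theorem IsClassFun.res {χ : Perm (Fin (n + 1)) → ℂ} (h : IsClassFun χ) :
    IsClassFun (RunnerSwap.res χ) := by
  intro g x
  simp only [RunnerSwap.res, map_mul, map_inv]
  exact h _ _

/-- Frobenius reciprocity. -/
theorem charInner_ind (χ : Perm (Fin n) → ℂ) {ψ : Perm (Fin (n + 1)) → ℂ} (hψ : IsClassFun ψ) :
    charInner (ind χ) ψ = charInner χ (res ψ) := by
  classical
  -- For fixed `x` and `h` only `g = x h x⁻¹` contributes, and there the class function `ψ` does not
  -- see `x`.
  have h1 : ∀ (x : Perm (Fin (n + 1))) (h : Perm (Fin n)),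
      ∑ g, (if embed n h = x⁻¹ * g * x then χ h else 0) * ψ g⁻¹ = χ h * ψ (embed n h)⁻¹ := by
    intro x h
    rw [sum_eq_single (x * embed n h * x⁻¹)]
    · rw [if_pos (by group)]
      congr 1
      rw [← hψ (embed n h)⁻¹ x, mul_inv_rev, mul_inv_rev, inv_inv, mul_assoc]
    · intro g _ hg
      rw [if_neg, zero_mul]
      intro he
      apply hg
      rw [he]
      group
    · intro h
      exact absurd (mem_univ _) h
  have h2 : ∑ g, ind χ g * ψ g⁻¹ = (Fintype.card (Perm (Fin n)) : ℂ)⁻¹ *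
      ∑ x : Perm (Fin (n + 1)), ∑ h : Perm (Fin n), χ h * ψ (embed n h)⁻¹ := by
    have h3 : ∑ x : Perm (Fin (n + 1)), ∑ h : Perm (Fin n), χ h * ψ (embed n h)⁻¹ =
        ∑ x : Perm (Fin (n + 1)), ∑ h : Perm (Fin n),
          ∑ g, (if embed n h = x⁻¹ * g * x then χ h else 0) * ψ g⁻¹ :=
      sum_congr rfl fun x _ => sum_congr rfl fun h _ => (h1 x h).symm
    rw [h3]
    simp_rw [ind, mul_assoc, sum_mul, mul_sum]
    rw [sum_comm]
    refine sum_congr rfl fun x _ => ?_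
    rw [sum_comm]
  rw [charInner, h2, charInner, sum_const, card_univ, nsmul_eq_mul]
  have h3 : (Fintype.card (Perm (Fin (n + 1))) : ℂ) ≠ 0 := Nat.cast_ne_zero.2 Fintype.card_ne_zero
  simp_rw [res, map_inv]
  field_simp

end

section

/-! ### Multiplicities in restricted Specht modules -/

variable {n : ℕ} {μ ν lam : YoungDiagram}

theorem polytabloid_apply_act (t : Tableau n μ) {π : Perm (Fin n)} (hπ : π ∈ colStab t) :
    polytabloid t (tabloid (act π t)) = csign π := by
  rw [polytabloid, Finsupp.finsetSum_apply, sum_eq_single_of_mem π hπ]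
  · simp [csign]
  · intro τ hτ hne
    rw [Finsupp.smul_apply, Finsupp.single_apply, if_neg, smul_zero]
    intro h
    exact hne (tabloid_act_injective t hτ hπ h)

theorem tabloidRep_apply (σ : Perm (Fin n)) (v : (Fin n → ℕ) →₀ ℂ) (s : Fin n → ℕ) :
    tabloidRep n σ v s = v (fun k => s (σ k)) := by
  have hinj : Function.Injective fun (r : Fin n → ℕ) (k : Fin n) => r (σ⁻¹ k) := by
    intro r r' h
    funext k
    simpa using congrFun h (σ k)
  have hs : s = (fun (r : Fin n → ℕ) (k : Fin n) => r (σ⁻¹ k)) (fun k => s (σ k)) := by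
    funext k
    simp
  conv_lhs => rw [hs]
  exact Finsupp.mapDomain_apply hinj v (fun k => s (σ k))

/-- The tabloids with the last number in row `i`, with that number removed; other tabloids are
sent to `0`. -/
def removeLast (n i : ℕ) : ((Fin (n + 1) → ℕ) →₀ ℂ) →ₗ[ℂ] ((Fin n → ℕ) →₀ ℂ) :=
  Finsupp.linearCombination ℂ fun s =>
    if s (Fin.last n) = i then Finsupp.single (fun k => s k.castSucc) 1 else 0

theorem removeLast_single (i : ℕ) (s : Fin (n + 1) → ℕ) :
    removeLast n i (Finsupp.single s 1) =
      if s (Fin.last n) = i then Finsupp.single (fun k => s k.castSucc) 1 else 0 := by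
  simp [removeLast]

theorem removeLast_tabloidRep (i : ℕ) (σ : Perm (Fin n)) (v : (Fin (n + 1) → ℕ) →₀ ℂ) :
    removeLast n i (tabloidRep (n + 1) (embed n σ) v) = tabloidRep n σ (removeLast n i v) := by
  have h : removeLast n i ∘ₗ tabloidRep (n + 1) (embed n σ) = tabloidRep n σ ∘ₗ removeLast n i := by
    refine Finsupp.lhom_ext' fun s => LinearMap.ext_ring ?_
    simp only [LinearMap.comp_apply, Finsupp.lsingle_apply]
    rw [tabloidRep_single, removeLast_single, removeLast_single, ← map_inv, embed_last]
    split_ifs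
    · rw [tabloidRep_single]
      simp_rw [embed_castSucc]
    · rw [map_zero]
  exact LinearMap.congr_fun h v

/-- A column permutation whose term survives keeps the last number in its row as well as its column,
hence fixes it. What remains is the column stabiliser of `u`, with the same signs. -/
theorem removeLast_polytabloid {x : ℕ × ℕ} (t : Tableau (n + 1) lam) (u : Tableau n ν)
    (hlast : (t (Fin.last n)).1 = x) (hcast : ∀ k : Fin n, (t k.castSucc).1 = (u k).1) :
    removeLast n x.1 (polytabloid t) = polytabloid u := by
  classical
  have hsub : (colStab u).image (embed n) ⊆ colStab t := by
    intro π hπ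
    obtain ⟨σ, hσ, rfl⟩ := mem_image.1 hπ
    rw [mem_colStab] at *
    intro k
    refine Fin.lastCases ?_ (fun k => ?_) k
    · rw [embed_last]
    · rw [embed_castSucc, hcast, hcast, hσ]
  rw [polytabloid, map_sum, ← sum_subset hsub]
  · rw [sum_image fun a _ b _ h => embed_injective n h, polytabloid]
    refine sum_congr rfl fun σ hσ => ?_
    rw [map_smul, removeLast_single]
    have h1 : tabloid (act (embed n σ) t) (Fin.last n) = x.1 := by
      change (t ((embed n σ)⁻¹ (Fin.last n))).1.1 = x.1
      rw [← map_inv, embed_last, hlast]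
    have h2 : (fun k : Fin n => tabloid (act (embed n σ) t) k.castSucc) = tabloid (act σ u) := by
      funext k
      change (t ((embed n σ)⁻¹ k.castSucc)).1.1 = (u (σ⁻¹ k)).1.1
      rw [← map_inv, embed_castSucc, hcast]
    rw [if_pos h1, h2]
    congr 1
    exact csign_embed σ
  · intro π hπ hnot
    rw [map_smul, removeLast_single, if_neg, smul_zero]
    intro h
    change (t (π⁻¹ (Fin.last n))).1.1 = x.1 at h
    have h2 := mem_colStab.1 (inv_mem_colStab hπ) (Fin.last n)
    have h3 : π⁻¹ (Fin.last n) = Fin.last n :=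
      t.injective (Subtype.ext (Prod.ext (by rw [h, hlast]) h2))
    obtain ⟨σ, rfl⟩ := exists_embed_eq (Perm.inv_eq_iff_eq.1 h3).symm
    apply hnot
    refine mem_image_of_mem _ (mem_colStab.2 fun k => ?_)
    rw [← hcast, ← hcast, ← embed_castSucc]
    exact mem_colStab.1 hπ _

/-- The invariant bilinear pairing between a restricted Specht module and a smaller one. -/
def removePairing (n : ℕ) (lam ν : YoungDiagram) (i : ℕ) :
    (specht (n + 1) lam).toSubmodule →ₗ[ℂ] Module.Dual ℂ (specht n ν).toSubmodule :=
  LinearMap.mk₂ ℂ (fun x y => Finsupp.linearCombination ℂ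
      (fun s => (y : (Fin n → ℕ) →₀ ℂ) s) (removeLast n i (x : (Fin (n + 1) → ℕ) →₀ ℂ)))
    (fun x x' y => by simp) (fun c x y => by simp)
    (fun x y y' => by
      simp [Finsupp.linearCombination_apply, Finsupp.sum, mul_add, sum_add_distrib])
    (fun c x y => by
      simp only [Finsupp.linearCombination_apply, Finsupp.sum, Submodule.coe_smul,
        Finsupp.smul_apply, smul_eq_mul, mul_sum]
      exact sum_congr rfl fun _ _ => by ring)

theorem linearCombination_tabloidRep (σ : Perm (Fin n)) (v y : (Fin n → ℕ) →₀ ℂ) :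
    Finsupp.linearCombination ℂ (fun s => y s) (tabloidRep n σ v) =
      Finsupp.linearCombination ℂ (fun s => tabloidRep n σ⁻¹ y s) v := by
  have h : Finsupp.linearCombination ℂ (fun s => y s) ∘ₗ tabloidRep n σ =
      Finsupp.linearCombination ℂ (fun s => tabloidRep n σ⁻¹ y s) := by
    refine Finsupp.lhom_ext' fun s => LinearMap.ext_ring ?_
    simp only [LinearMap.comp_apply, Finsupp.lsingle_apply]
    rw [tabloidRep_single]
    simp [tabloidRep_apply]
  exact LinearMap.congr_fun h v

theorem linearCombination_polytabloid_self (u : Tableau n ν) :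
    Finsupp.linearCombination ℂ (fun s => polytabloid u s) (polytabloid u) = #(colStab u) := by
  conv_lhs => rw [polytabloid, map_sum]
  rw [card_eq_sum_ones, Nat.cast_sum]
  refine sum_congr rfl fun π hπ => ?_
  rw [map_smul, Finsupp.linearCombination_single, ← polytabloid, polytabloid_apply_act u hπ,
    one_smul, smul_eq_mul, Nat.cast_one]
  exact csign_mul_self π

theorem charInner_ne_zero_of_intertwining {G V W : Type*} [Group G] [Fintype G] [AddCommGroup V]
    [Module ℂ V] [FiniteDimensional ℂ V] [AddCommGroup W] [Module ℂ W] [FiniteDimensional ℂ W]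
    (ρ : Representation ℂ G V) (σ : Representation ℂ G W) (φ : V →ₗ[ℂ] W)
    (hφ : ∀ g v, φ (ρ g v) = σ g (φ v)) (hne : φ ≠ 0) :
    charInner σ.character ρ.character ≠ 0 := by
  rw [charInner_character, Nat.cast_ne_zero, ← (Representation.invariantsEquivIntertwiningMap ρ σ).finrank_eq]
  let ψ : Representation.IntertwiningMap ρ σ := ⟨φ, fun g => LinearMap.ext (hφ g)⟩
  have hψ : ψ ≠ 0 := fun h => hne (congrArg Representation.IntertwiningMap.toLinearMap h)
  have : Nontrivial (Representation.linHom ρ σ).invariants :=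
    ⟨(Representation.invariantsEquivIntertwiningMap ρ σ).symm ψ, 0, by simpa using hψ⟩
  exact Module.finrank_pos.ne'

/-- A non-zero invariant pairing is a non-zero intertwining map into the dual of `W`, whose
character is that of `W` by `hσ`. -/
theorem charInner_ne_zero_of_pairing {G V W : Type*} [Group G] [Fintype G] [AddCommGroup V]
    [Module ℂ V] [FiniteDimensional ℂ V] [AddCommGroup W] [Module ℂ W] [FiniteDimensional ℂ W]
    (ρ : Representation ℂ G V) (σ : Representation ℂ G W) (B : V →ₗ[ℂ] Module.Dual ℂ W)
    (hB : ∀ g v w, B (ρ g v) w = B v (σ g⁻¹ w)) (hne : B ≠ 0)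
    (hσ : ∀ g, σ.character g⁻¹ = σ.character g) :
    charInner ρ.character σ.character ≠ 0 := by
  have h := charInner_ne_zero_of_intertwining ρ σ.dual B
    (fun g v => LinearMap.ext fun w => hB g v w) hne
  have h1 : σ.dual.character = σ.character := by
    funext g
    rw [Representation.char_dual, hσ]
  rwa [h1, charInner_comm] at h

theorem spechtChar_inv (n : ℕ) (μ : YoungDiagram) (g : Perm (Fin n)) :
    spechtChar n μ g⁻¹ = spechtChar n μ g := by
  have h : IsConj g g⁻¹ := Perm.isConj_of_cycleType_eq (Perm.cycleType_inv g).symm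
  obtain ⟨x, hx⟩ := isConj_iff.1 h
  rw [← hx]
  exact isClassFun_spechtChar n μ g x

theorem exists_cells_eq_insert (hle : ν ≤ lam) (hcard : lam.card = ν.card + 1) :
    ∃ x, x ∉ ν.cells ∧ lam.cells = insert x ν.cells := by
  classical
  have h1 : ν.cells ⊆ lam.cells := YoungDiagram.cells_subset_iff.2 hle
  have h2 : #(lam.cells \ ν.cells) = 1 := by
    rw [card_sdiff_of_subset h1]
    change lam.card - ν.card = 1
    omega
  obtain ⟨x, hx⟩ := card_eq_one.1 h2
  refine ⟨x, fun h => ?_, ?_⟩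
  · have : x ∈ lam.cells \ ν.cells := by rw [hx]; exact mem_singleton_self x
    exact (mem_sdiff.1 this).2 h
  · rw [insert_eq, ← hx, sdiff_union_of_subset h1]

theorem exists_extend_tableau {x : ℕ × ℕ} (u : Tableau n ν) (hx : x ∉ ν.cells)
    (hlam : lam.cells = insert x ν.cells) : ∃ t : Tableau (n + 1) lam,
      (t (Fin.last n)).1 = x ∧ ∀ k : Fin n, (t k.castSucc).1 = (u k).1 := by
  let f : Fin (n + 1) → {c // c ∈ lam.cells} := Fin.lastCases ⟨x, by simp [hlam]⟩
    (fun k => ⟨(u k).1, by rw [hlam]; exact mem_insert_of_mem (u k).2⟩)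
  have hl : (f (Fin.last n)).1 = x := by simp [f]
  have hc : ∀ k : Fin n, (f k.castSucc).1 = (u k).1 := fun k => by simp [f]
  have hf : Function.Bijective f := by
    constructor
    · intro a b hab
      have hab' := congrArg Subtype.val hab
      induction a using Fin.lastCases with
      | last =>
        induction b using Fin.lastCases with
        | last => rfl
        | cast b =>
          rw [hl, hc] at hab'
          exact absurd (hab' ▸ (u b).2) hx
      | cast a =>
        induction b using Fin.lastCases with
        | last =>
          rw [hl, hc] at hab'
          exact absurd (hab' ▸ (u a).2) hx
        | cast b =>
          rw [hc, hc] at hab'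
          rw [u.injective (Subtype.ext hab')]
    · rintro ⟨c, hcm⟩
      have hcm' := hcm
      rw [hlam, mem_insert] at hcm'
      rcases hcm' with rfl | hcm'
      · exact ⟨Fin.last n, Subtype.ext hl⟩
      · obtain ⟨k, hk⟩ := u.surjective ⟨c, hcm'⟩
        exact ⟨k.castSucc, Subtype.ext (by rw [hc, hk])⟩
  exact ⟨Equiv.ofBijective f hf, hl, hc⟩

/-- With `t` extending `u` by the extra node, the pairing of their polytabloids is the order of the
column stabiliser of `u`, so it does not vanish. -/
theorem charInner_res_ne_zero (hν : ν.card = n) (hlam : lam.card = n + 1) (hle : ν ≤ lam) :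
    charInner (res (spechtChar (n + 1) lam)) (spechtChar n ν) ≠ 0 := by
  obtain ⟨x, hx, hcells⟩ := exists_cells_eq_insert hle (by omega)
  have u : Tableau n ν := (exists_tableau hν).some
  obtain ⟨t, ht, htu⟩ := exists_extend_tableau u hx hcells
  have h := charInner_ne_zero_of_pairing (V := (specht (n + 1) lam).toSubmodule)
    (W := (specht n ν).toSubmodule)
    (((spechtRep (n + 1) lam).comp (embed n) :
      Representation ℂ (Perm (Fin n)) (specht (n + 1) lam).toSubmodule))
    (spechtRep n ν) (removePairing n lam ν x.1) ?_ ?_ (spechtChar_inv n ν)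
  · exact h
  · intro g v y
    change Finsupp.linearCombination ℂ _ (removeLast n x.1 (tabloidRep (n + 1) (embed n g) _)) =
      Finsupp.linearCombination ℂ (fun s => tabloidRep n g⁻¹ _ s) _
    rw [removeLast_tabloidRep, linearCombination_tabloidRep]
    rfl
  · intro h0
    have h1 : removePairing n lam ν x.1 (spechtVec t) (spechtVec u) = 0 := by
      rw [h0]
      rfl
    change Finsupp.linearCombination ℂ (fun s => polytabloid u s)
      (removeLast n x.1 (polytabloid t)) = 0 at h1
    rw [removeLast_polytabloid t u ht htu, linearCombination_polytabloid_self] at h1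
    exact card_colStab_ne_zero u h1

theorem exists_charInner_res_eq_natCast (n : ℕ) (lam ν : YoungDiagram) :
    ∃ k : ℕ, charInner (res (spechtChar (n + 1) lam)) (spechtChar n ν) = k := by
  have h := charInner_character (V := (specht n ν).toSubmodule)
    (W := (specht (n + 1) lam).toSubmodule) (spechtRep n ν)
    (((spechtRep (n + 1) lam).comp (embed n) :
      Representation ℂ (Perm (Fin n)) (specht (n + 1) lam).toSubmodule))
  exact ⟨_, h⟩

end

section

/-! ### Adding and removing nodes -/

variable {n : ℕ} {μ ν lam : YoungDiagram}

instance : DecidableLE YoungDiagram := fun _ _ => decidable_of_iff _ YoungDiagram.cells_subset_iff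

instance : DecidableEq YoungDiagram := fun _ _ => decidable_of_iff _ YoungDiagram.ext_iff.symm

theorem fst_lt_card {c : ℕ × ℕ} (h : c ∈ μ.cells) : c.1 < μ.card := by
  have h1 : (c.1, 0) ∈ μ := μ.up_left_mem le_rfl (Nat.zero_le c.2) h
  rw [YoungDiagram.mem_iff_lt_colLen] at h1
  refine h1.trans_le ?_
  rw [YoungDiagram.colLen_eq_card]
  exact card_le_card (filter_subset _ _)

theorem rowLen_eq_of_insert {x : ℕ × ℕ} (hx : x ∉ ν.cells) (h : lam.cells = insert x ν.cells) :
    x.2 = ν.rowLen x.1 := by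
  have hx' : ¬ x.2 < ν.rowLen x.1 := fun hlt => hx (YoungDiagram.mem_iff_lt_rowLen.2 hlt)
  by_contra hne
  have hm : (x.1, ν.rowLen x.1) ∈ lam.cells :=
    lam.up_left_mem (i2 := x.1) (j2 := x.2) le_rfl (by omega)
      (show x ∈ lam.cells by rw [h]; exact mem_insert_self _ _)
  rw [h, mem_insert] at hm
  rcases hm with hm | hm
  · exact hne (Prod.ext_iff.1 hm).2.symm
  · exact lt_irrefl _ (YoungDiagram.mem_iff_lt_rowLen.1 hm)

theorem rowLen_of_insert {x : ℕ × ℕ} (hx : x ∉ ν.cells) (h : lam.cells = insert x ν.cells)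
    (i : ℕ) : lam.rowLen i = if i = x.1 then ν.rowLen i + 1 else ν.rowLen i := by
  have h2 := rowLen_eq_of_insert hx h
  have key : ∀ j, j < lam.rowLen i ↔ j < if i = x.1 then ν.rowLen i + 1 else ν.rowLen i := by
    intro j
    rw [← YoungDiagram.mem_iff_lt_rowLen, ← YoungDiagram.mem_cells, h, mem_insert,
      YoungDiagram.mem_cells, YoungDiagram.mem_iff_lt_rowLen, Prod.ext_iff]
    split_ifs with hi
    · subst hi
      simp only [true_and]
      omega
    · simp [hi]
  exact le_antisymm (le_of_forall_lt fun j hj => (key j).1 hj)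
    (le_of_forall_lt fun j hj => (key j).2 hj)

theorem card_of_insert {x : ℕ × ℕ} (hx : x ∉ ν.cells) (h : lam.cells = insert x ν.cells) :
    lam.card = ν.card + 1 := by
  change #lam.cells = #ν.cells + 1
  rw [h, card_insert_of_notMem hx]

theorem le_of_insert {x : ℕ × ℕ} (h : lam.cells = insert x ν.cells) : ν ≤ lam := by
  rw [← YoungDiagram.cells_subset_iff, h]
  exact subset_insert _ _

theorem exists_add_node {i : ℕ} (hi : i = 0 ∨ ν.rowLen i < ν.rowLen (i - 1)) :
    ∃ lam : YoungDiagram, lam.cells = insert (i, ν.rowLen i) ν.cells := by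
  refine ⟨⟨insert (i, ν.rowLen i) ν.cells, ?_⟩, rfl⟩
  rintro ⟨a, b⟩ ⟨c, d⟩ ⟨hca, hdb⟩ h
  simp only [coe_insert, Set.mem_insert_iff, mem_coe, Prod.mk.injEq, YoungDiagram.mem_cells,
    YoungDiagram.mem_iff_lt_rowLen] at h hca hdb ⊢
  rcases h with ⟨rfl, rfl⟩ | h
  · rcases Nat.lt_or_ge c a with hlt | hge
    · right
      have := ν.rowLen_anti c (a - 1) (by omega)
      omega
    · obtain rfl : c = a := by omega
      omega
  · right
    have := ν.rowLen_anti c a hca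
    omega

theorem exists_remove_node {i : ℕ} (hi : ν.rowLen (i + 1) < ν.rowLen i) :
    ∃ ρ : YoungDiagram, (i, ν.rowLen i - 1) ∉ ρ.cells ∧
      ν.cells = insert (i, ν.rowLen i - 1) ρ.cells := by
  have hmem : (i, ν.rowLen i - 1) ∈ ν.cells := by
    rw [YoungDiagram.mem_cells, YoungDiagram.mem_iff_lt_rowLen]
    omega
  refine ⟨⟨ν.cells.erase (i, ν.rowLen i - 1), ?_⟩, notMem_erase _ _, (insert_erase hmem).symm⟩
  rintro ⟨a, b⟩ ⟨c, d⟩ ⟨hca, hdb⟩ h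
  simp only [coe_erase, Set.mem_sdiff, mem_coe, Set.mem_singleton_iff, Prod.mk.injEq,
    YoungDiagram.mem_cells, YoungDiagram.mem_iff_lt_rowLen] at h hca hdb ⊢
  have h1 := ν.rowLen_anti c a hca
  refine ⟨by omega, ?_⟩
  rintro ⟨rfl, rfl⟩
  rcases Nat.lt_or_ge c a with hlt | hge
  · have := ν.rowLen_anti (c + 1) a hlt
    omega
  · omega

theorem card_upper_covers (hν : ν.card = n) :
    #((partitionsOf (n + 1)).filter (ν ≤ ·)) =
      #((range (n + 1)).filter fun i => i = 0 ∨ ν.rowLen i < ν.rowLen (i - 1)) := by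
  symm
  have hnot : ∀ i, (i, ν.rowLen i) ∉ ν.cells := fun i h =>
    lt_irrefl _ (YoungDiagram.mem_iff_lt_rowLen.1 h)
  refine card_bij (fun i hi => (exists_add_node (mem_filter.1 hi).2).choose) ?_ ?_ ?_
  · intro i hi
    have h := (exists_add_node (mem_filter.1 hi).2).choose_spec
    rw [mem_filter, mem_partitionsOf]
    exact ⟨by rw [card_of_insert (hnot i) h, hν], le_of_insert h⟩
  · intro i hi j hj hij
    have h := (exists_add_node (mem_filter.1 hi).2).choose_spec
    have h' := (exists_add_node (mem_filter.1 hj).2).choose_spec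
    rw [hij, h', Finset.ext_iff] at h
    have := h (i, ν.rowLen i)
    simp only [mem_insert, hnot i, iff_true, or_false, Prod.mk.injEq] at this
    exact this.1
  · intro lam hl
    rw [mem_filter, mem_partitionsOf] at hl
    obtain ⟨x, hx, h⟩ := exists_cells_eq_insert hl.2 (by omega)
    have h2 := rowLen_eq_of_insert hx h
    have hi : x.1 ∈ (range (n + 1)).filter fun i => i = 0 ∨ ν.rowLen i < ν.rowLen (i - 1) := by
      rw [mem_filter, mem_range]
      constructor
      · rw [← hl.1]
        exact fst_lt_card (by rw [h]; exact mem_insert_self _ _)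
      · rcases Nat.eq_zero_or_pos x.1 with h0 | h0
        · exact Or.inl h0
        · right
          have h3 := lam.rowLen_anti (x.1 - 1) x.1 (by omega)
          rw [rowLen_of_insert hx h, rowLen_of_insert hx h, if_pos rfl, if_neg (by omega)] at h3
          omega
    refine ⟨x.1, hi, YoungDiagram.ext ?_⟩
    rw [(exists_add_node (mem_filter.1 hi).2).choose_spec, h, ← h2]

theorem card_lower_covers (hν : ν.card = n + 1) :
    #((partitionsOf n).filter (· ≤ ν)) =
      #((range (n + 1)).filter fun i => ν.rowLen (i + 1) < ν.rowLen i) := by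
  symm
  refine card_bij (fun i hi => (exists_remove_node (mem_filter.1 hi).2).choose) ?_ ?_ ?_
  · intro i hi
    obtain ⟨h1, h2⟩ := (exists_remove_node (mem_filter.1 hi).2).choose_spec
    rw [mem_filter, mem_partitionsOf]
    have := card_of_insert h1 h2
    exact ⟨by omega, le_of_insert h2⟩
  · intro i hi j hj hij
    obtain ⟨h1, h2⟩ := (exists_remove_node (mem_filter.1 hi).2).choose_spec
    obtain ⟨h1', h2'⟩ := (exists_remove_node (mem_filter.1 hj).2).choose_spec
    rw [hij] at h1 h2
    have h3 : (i, ν.rowLen i - 1) ∈ ν.cells := by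
      rw [h2]
      exact mem_insert_self _ _
    rw [h2', mem_insert] at h3
    rcases h3 with h3 | h3
    · exact (Prod.ext_iff.1 h3).1
    · exact absurd h3 h1
  · intro ρ hρ
    rw [mem_filter, mem_partitionsOf] at hρ
    obtain ⟨x, hx, h⟩ := exists_cells_eq_insert hρ.2 (by omega)
    have h2 := rowLen_eq_of_insert hx h
    have hrow := rowLen_of_insert hx h
    have hi : x.1 ∈ (range (n + 1)).filter fun i => ν.rowLen (i + 1) < ν.rowLen i := by
      rw [mem_filter, mem_range]
      constructor
      · rw [← hν]
        exact fst_lt_card (by rw [h]; exact mem_insert_self _ _)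
      · have h3 := ρ.rowLen_anti x.1 (x.1 + 1) (by omega)
        rw [hrow, hrow, if_pos rfl, if_neg (by omega)]
        omega
    refine ⟨x.1, hi, YoungDiagram.ext ?_⟩
    obtain ⟨h4, h5⟩ := (exists_remove_node (mem_filter.1 hi).2).choose_spec
    have hxe : (x.1, ν.rowLen x.1 - 1) = x := by
      rw [hrow, if_pos rfl, Nat.add_sub_cancel, ← h2]
    rw [← erase_insert h4, ← h5, hxe, h, erase_insert hx]

/-- A node can be added in row `i + 1` exactly when one can be removed from row `i`, and row `0`
always accepts one more. -/
theorem card_upper_covers_succ (hν : ν.card = n + 1) :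
    #((partitionsOf (n + 2)).filter (ν ≤ ·)) = #((partitionsOf n).filter (· ≤ ν)) + 1 := by
  rw [card_upper_covers hν, card_lower_covers hν, card_filter, card_filter, sum_range_succ']
  simp

theorem card_upper_covers_zero (hν : ν.card = 0) :
    #((partitionsOf 1).filter (ν ≤ ·)) = 1 := by
  rw [card_upper_covers hν]
  simp [filter_singleton]

theorem card_sup_add_card_inf (μ ν : YoungDiagram) :
    (μ ⊔ ν).card + (μ ⊓ ν).card = μ.card + ν.card :=
  card_union_add_card_inter _ _

theorem eq_of_le_of_card_le (h : μ ≤ ν) (hc : ν.card ≤ μ.card) : μ = ν :=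
  YoungDiagram.ext (eq_of_subset_of_card_le (YoungDiagram.cells_subset_iff.2 h) hc)

/-- The only possible common upper cover is `ν ⊔ κ` and the only possible common lower cover is `ν ⊓
κ`. Their sizes add up to `2 * n + 2`, so either both are covers or neither is. -/
theorem card_common_covers {κ : YoungDiagram} (hν : ν.card = n + 1) (hκ : κ.card = n + 1)
    (hne : κ ≠ ν) : #((partitionsOf (n + 2)).filter fun lam => ν ≤ lam ∧ κ ≤ lam) =
      #((partitionsOf n).filter fun ρ => ρ ≤ ν ∧ ρ ≤ κ) := by
  have hsum := card_sup_add_card_inf ν κ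
  have hsup : n + 2 ≤ (ν ⊔ κ).card := by
    by_contra hlt
    have h1 := eq_of_le_of_card_le (le_sup_left : ν ≤ ν ⊔ κ) (by omega)
    have h2 := eq_of_le_of_card_le (le_sup_right : κ ≤ ν ⊔ κ) (by omega)
    exact hne (h2.trans h1.symm)
  by_cases hc : (ν ⊔ κ).card = n + 2
  · have h1 : (partitionsOf (n + 2)).filter (fun lam => ν ≤ lam ∧ κ ≤ lam) = {ν ⊔ κ} := by
      ext lam
      rw [mem_filter, mem_partitionsOf, mem_singleton, ← sup_le_iff]
      constructor
      · rintro ⟨h1, h2⟩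
        exact (eq_of_le_of_card_le h2 (by omega)).symm
      · rintro rfl
        exact ⟨hc, le_rfl⟩
    have h2 : (partitionsOf n).filter (fun ρ => ρ ≤ ν ∧ ρ ≤ κ) = {ν ⊓ κ} := by
      ext ρ
      rw [mem_filter, mem_partitionsOf, mem_singleton, ← le_inf_iff]
      constructor
      · rintro ⟨h1, h2⟩
        exact eq_of_le_of_card_le h2 (by omega)
      · rintro rfl
        exact ⟨by omega, le_rfl⟩
    rw [h1, h2]
    rfl
  · rw [filter_eq_empty_iff.2, filter_eq_empty_iff.2]
    · intro ρ hρ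
      rw [mem_partitionsOf] at hρ
      rw [← le_inf_iff]
      intro h
      have : ρ.card ≤ (ν ⊓ κ).card := card_le_card (YoungDiagram.cells_subset_iff.2 h)
      omega
    · intro lam hl
      rw [mem_partitionsOf] at hl
      rw [← sup_le_iff]
      intro h
      have : (ν ⊔ κ).card ≤ lam.card := card_le_card (YoungDiagram.cells_subset_iff.2 h)
      omega

/-! ### Counting standard tableaux -/

/-- The number of saturated chains of Young diagrams of length `n` below `lam`. -/
def chainCount : ℕ → YoungDiagram → ℕ
  | 0, _ => 1
  | n + 1, lam => ∑ ν ∈ (partitionsOf n).filter (· ≤ lam), chainCount n ν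

/-- This is the relation $DU=UD+1$ of Young's lattice: between `ν` and `κ` there are as many paths
up and then down as down and then up, with one extra when `κ = ν`. The induction hypothesis is
applied to the lower covers of `ν`. -/
theorem sum_chainCount_upper (n : ℕ) : ∀ ν : YoungDiagram, ν.card = n →
    ∑ lam ∈ (partitionsOf (n + 1)).filter (ν ≤ ·), chainCount (n + 1) lam =
      (n + 1) * chainCount n ν := by
  have hswap : ∀ (n : ℕ) (ν : YoungDiagram),
      ∑ lam ∈ (partitionsOf (n + 1)).filter (ν ≤ ·), chainCount (n + 1) lam =
      ∑ κ ∈ partitionsOf n, #((partitionsOf (n + 1)).filter fun lam => ν ≤ lam ∧ κ ≤ lam) *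
        chainCount n κ := by
    intro n ν
    simp_rw [chainCount, sum_filter]
    simp_rw [card_filter, sum_mul]
    rw [sum_comm]
    refine sum_congr rfl fun lam _ => ?_
    by_cases h : ν ≤ lam <;> simp [h]
  induction n with
  | zero =>
    intro ν hν
    have h1 : partitionsOf 0 = {ν} := by
      ext κ
      rw [mem_partitionsOf, mem_singleton]
      exact ⟨fun h => eq_of_card_le_one h hν (by omega), fun h => h ▸ hν⟩
    rw [hswap, h1, sum_singleton]
    simp only [and_self]
    rw [card_upper_covers_zero hν, zero_add]
  | succ n ih =>
    intro ν hν
    have hmem : ν ∈ partitionsOf (n + 1) := mem_partitionsOf.2 hν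
    have h1 : ∀ κ ∈ partitionsOf (n + 1),
        #((partitionsOf (n + 2)).filter fun lam => ν ≤ lam ∧ κ ≤ lam) * chainCount (n + 1) κ =
        (if κ = ν then chainCount (n + 1) κ else 0) +
        #((partitionsOf n).filter fun ρ => ρ ≤ ν ∧ ρ ≤ κ) * chainCount (n + 1) κ := by
      intro κ hκ
      split_ifs with h
      · subst h
        simp only [and_self]
        rw [card_upper_covers_succ hν]
        ring
      · rw [card_common_covers hν (mem_partitionsOf.1 hκ) h, zero_add]
    rw [hswap, sum_congr rfl h1, sum_add_distrib, sum_ite_eq' (partitionsOf (n + 1)) ν,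
      if_pos hmem]
    have h2 : ∑ κ ∈ partitionsOf (n + 1),
        #((partitionsOf n).filter fun ρ => ρ ≤ ν ∧ ρ ≤ κ) * chainCount (n + 1) κ =
        ∑ ρ ∈ (partitionsOf n).filter (· ≤ ν), (n + 1) * chainCount n ρ := by
      have h3 : ∀ ρ ∈ (partitionsOf n).filter (· ≤ ν), (n + 1) * chainCount n ρ =
          ∑ lam ∈ (partitionsOf (n + 1)).filter (ρ ≤ ·), chainCount (n + 1) lam :=
        fun ρ hρ => (ih ρ (mem_partitionsOf.1 (mem_filter.1 hρ).1)).symm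
      rw [sum_congr rfl h3]
      simp_rw [sum_filter, card_filter, sum_mul]
      rw [sum_comm]
      refine sum_congr rfl fun ρ _ => ?_
      by_cases h : ρ ≤ ν <;> simp [h]
    rw [h2, ← mul_sum]
    change _ + (n + 1) * chainCount (n + 1) ν = _
    ring

theorem sum_chainCount_sq (n : ℕ) :
    ∑ lam ∈ partitionsOf n, chainCount n lam * chainCount n lam = n.factorial := by
  induction n with
  | zero =>
    have h1 : partitionsOf 0 = {⊥} := by
      ext κ
      rw [mem_partitionsOf, mem_singleton]
      have hb : (⊥ : YoungDiagram).card = 0 := rfl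
      exact ⟨fun h => eq_of_card_le_one h hb (by omega), fun h => h ▸ hb⟩
    rw [h1]
    simp [chainCount]
  | succ n ih =>
    have h1 : ∀ lam ∈ partitionsOf (n + 1), chainCount (n + 1) lam * chainCount (n + 1) lam =
        ∑ ν ∈ partitionsOf n, if ν ≤ lam then chainCount n ν * chainCount (n + 1) lam else 0 := by
      intro lam _
      rw [← sum_filter, ← sum_mul]
      rfl
    have h2 : ∀ ν ∈ partitionsOf n, (∑ lam ∈ partitionsOf (n + 1),
        if ν ≤ lam then chainCount n ν * chainCount (n + 1) lam else 0) =
        (n + 1) * (chainCount n ν * chainCount n ν) := by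
      intro ν hν
      rw [← sum_filter, ← mul_sum, sum_chainCount_upper n ν (mem_partitionsOf.1 hν)]
      ring
    rw [sum_congr rfl h1, sum_comm, sum_congr rfl h2, ← mul_sum, ih, Nat.factorial_succ]

end

section

/-! ### The branching rule -/

variable {n : ℕ} {μ ν lam : YoungDiagram}

/-- The degree of a Specht character. -/
def spechtDim (n : ℕ) (μ : YoungDiagram) : ℕ := Module.finrank ℂ (specht n μ).toSubmodule

theorem spechtChar_one (n : ℕ) (μ : YoungDiagram) : spechtChar n μ 1 = spechtDim n μ := by
  rw [spechtChar, Representation.char_one, spechtDim]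

theorem spechtDim_pos (h : μ.card = n) : 0 < spechtDim n μ := by
  have := spechtChar_one_ne_zero h
  rw [spechtChar_one, Nat.cast_ne_zero] at this
  omega

/-- The multiplicity of a Specht character in a restricted Specht character. -/
def resMult (n : ℕ) (lam ν : YoungDiagram) : ℕ := (exists_charInner_res_eq_natCast n lam ν).choose

theorem charInner_res (n : ℕ) (lam ν : YoungDiagram) :
    charInner (res (spechtChar (n + 1) lam)) (spechtChar n ν) = resMult n lam ν :=
  (exists_charInner_res_eq_natCast n lam ν).choose_spec

theorem one_le_resMult (hν : ν.card = n) (hlam : lam.card = n + 1) (hle : ν ≤ lam) :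
    1 ≤ resMult n lam ν := by
  have := charInner_res_ne_zero hν hlam hle
  rw [charInner_res, Nat.cast_ne_zero] at this
  omega

theorem spechtDim_succ (n : ℕ) (lam : YoungDiagram) :
    spechtDim (n + 1) lam = ∑ ν ∈ partitionsOf n, resMult n lam ν * spechtDim n ν := by
  have h := congrFun (isClassFun_spechtChar (n + 1) lam).res.eq_sum 1
  simp only [charInner_res, Finset.sum_apply, Pi.smul_apply, smul_eq_mul, spechtChar_one] at h
  rw [res, map_one, spechtChar_one] at h
  exact_mod_cast h

/-- The regular character is expanded in Specht characters and evaluated at the identity. -/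
theorem sum_spechtDim_sq (n : ℕ) :
    ∑ μ ∈ partitionsOf n, spechtDim n μ * spechtDim n μ = n.factorial := by
  classical
  let δ : Perm (Fin n) → ℂ := fun g => if g = 1 then (n.factorial : ℂ) else 0
  have hδ : IsClassFun δ := by
    intro g h
    have : h * g * h⁻¹ = 1 ↔ g = 1 := by
      rw [conj_eq_one_iff]
    simp only [δ, this]
  have hin : ∀ μ, charInner δ (spechtChar n μ) = spechtDim n μ := by
    intro μ
    rw [charInner, sum_eq_single 1]
    · simp only [δ, if_pos, inv_one, spechtChar_one, Fintype.card_perm, Fintype.card_fin]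
      rw [← mul_assoc, inv_mul_cancel₀ (Nat.cast_ne_zero.2 n.factorial_ne_zero), one_mul]
    · intro g _ hg
      simp [δ, hg]
    · intro h
      exact absurd (mem_univ _) h
  have h := congrFun hδ.eq_sum 1
  simp only [hin, Finset.sum_apply, Pi.smul_apply, smul_eq_mul, spechtChar_one] at h
  simp only [δ, if_pos] at h
  exact_mod_cast h.symm

theorem sum_filter_le_sum_resMult {f : YoungDiagram → ℕ} (hlam : lam.card = n + 1) :
    ∑ ν ∈ (partitionsOf n).filter (· ≤ lam), f ν ≤
      ∑ ν ∈ partitionsOf n, resMult n lam ν * f ν := by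
  rw [sum_filter]
  refine sum_le_sum fun ν hν => ?_
  split_ifs with h
  · exact Nat.le_mul_of_pos_left _ (one_le_resMult (mem_partitionsOf.1 hν) hlam h)
  · exact Nat.zero_le _

theorem chainCount_le_spechtDim (n : ℕ) :
    ∀ lam : YoungDiagram, lam.card = n → chainCount n lam ≤ spechtDim n lam := by
  induction n with
  | zero =>
    intro lam h
    exact spechtDim_pos h
  | succ n ih =>
    intro lam h
    rw [spechtDim_succ, chainCount]
    refine le_trans (sum_le_sum fun ν hν => ?_) (sum_filter_le_sum_resMult h)
    exact ih ν (mem_partitionsOf.1 (mem_filter.1 hν).1)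

/-- The inequality `chainCount_le_spechtDim` holds termwise and both sums of squares are $n!$, so
every term is an equality. -/
theorem chainCount_eq_spechtDim (h : lam.card = n) : chainCount n lam = spechtDim n lam := by
  have hle : ∀ lam ∈ partitionsOf n, chainCount n lam * chainCount n lam ≤
      spechtDim n lam * spechtDim n lam := fun lam hl =>
    Nat.mul_self_le_mul_self (chainCount_le_spechtDim n lam (mem_partitionsOf.1 hl))
  have := (sum_eq_sum_iff_of_le hle).1 (by rw [sum_chainCount_sq, sum_spechtDim_sq]) lam
    (mem_partitionsOf.2 h)
  exact Nat.mul_self_inj.1 this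

/-- The branching rule. -/
theorem resMult_eq (hν : ν.card = n) (hlam : lam.card = n + 1) :
    resMult n lam ν = if ν ≤ lam then 1 else 0 := by
  have hle : ∀ κ ∈ partitionsOf n, (if κ ≤ lam then 1 else 0) * spechtDim n κ ≤
      resMult n lam κ * spechtDim n κ := by
    intro κ hκ
    refine Nat.mul_le_mul_right _ ?_
    split_ifs with h
    · exact one_le_resMult (mem_partitionsOf.1 hκ) hlam h
    · exact Nat.zero_le _
  -- Both sides are the degree of `lam`: the left one through the chain recursion, the right one by
  -- restriction. With `hle` and positive degrees this fixes each multiplicity.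
  have hsum : ∑ κ ∈ partitionsOf n, (if κ ≤ lam then 1 else 0) * spechtDim n κ =
      ∑ κ ∈ partitionsOf n, resMult n lam κ * spechtDim n κ := by
    rw [← spechtDim_succ, ← chainCount_eq_spechtDim hlam, chainCount, sum_filter]
    refine sum_congr rfl fun κ hκ => ?_
    rw [chainCount_eq_spechtDim (mem_partitionsOf.1 hκ)]
    split_ifs <;> simp
  have := (sum_eq_sum_iff_of_le hle).1 hsum ν (mem_partitionsOf.2 hν)
  exact (Nat.eq_of_mul_eq_mul_right (spechtDim_pos hν) this).symm

/-! ### Restriction and induction functors on Specht characters -/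

theorem charInner_res_eq (hν : ν.card = n) (hlam : lam.card = n + 1) :
    charInner (res (spechtChar (n + 1) lam)) (spechtChar n ν) = if ν ≤ lam then 1 else 0 := by
  rw [charInner_res, resMult_eq hν hlam]
  split_ifs <;> simp

theorem charInner_ind_eq (hν : ν.card = n) (hlam : lam.card = n + 1) :
    charInner (ind (spechtChar n ν)) (spechtChar (n + 1) lam) = if ν ≤ lam then 1 else 0 := by
  rw [charInner_ind _ (isClassFun_spechtChar _ _), charInner_comm, charInner_res_eq hν hlam]

theorem extendLinearly_spechtChar {V : Type*} [AddCommGroup V] [Module ℂ V]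
    (v : YoungDiagram → V) (hμ : μ.card = n) : extendLinearly n v (spechtChar n μ) = v μ := by
  change ∑ κ ∈ partitionsOf n, charInner (spechtChar n μ) (spechtChar n κ) • v κ = v μ
  rw [sum_eq_single_of_mem μ (mem_partitionsOf.2 hμ), charInner_spechtChar_self hμ, one_smul]
  intro κ _ hne
  rw [charInner_spechtChar_of_ne hne.symm, zero_smul]

theorem content_of_insert {x : ℕ × ℕ} (hx : x ∉ ν.cells) (h : lam.cells = insert x ν.cells) :
    content lam = residue x ::ₘ content ν := by
  rw [content, h, insert_val_of_notMem hx, Multiset.map_cons, content]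

/-- `lam` is obtained from `ν` by adding a node of residue `ε`. -/
def AddsNode (ε : ZMod 2) (ν lam : YoungDiagram) : Prop :=
  ν ≤ lam ∧ lam.card = ν.card + 1 ∧ content lam = ε ::ₘ content ν

/-- The contents of `ν` and `lam` differ by one residue, which the sum of the residues modulo `2`
already determines. Hence the weak block invariant suffices. -/
theorem inBlock_iff_of_erase {ε : ZMod 2} (hν : ν.card = n) (hlam : lam.card = n + 1)
    (hle : ν ≤ lam) (hε : ε ∈ content lam) :
    InBlock n ((content lam).erase ε) ν ↔ content lam = ε ::ₘ content ν := by
  obtain ⟨x, hx, h⟩ := exists_cells_eq_insert hle (by omega)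
  have hc := content_of_insert hx h
  constructor
  · intro hb
    have h1 := content_sum_eq_of_inBlock hν hb
    have h2 : (content lam).sum = ε + ((content lam).erase ε).sum := by
      rw [← Multiset.sum_cons, Multiset.cons_erase hε]
    rw [← h1, hc, Multiset.sum_cons, add_left_inj] at h2
    rw [hc, h2]
  · intro h1
    rw [h1, Multiset.erase_cons_head]
    exact inBlock_content hν

theorem inBlock_iff_of_cons {ε : ZMod 2} (hν : ν.card = n) (hlam : lam.card = n + 1)
    (hle : ν ≤ lam) :
    InBlock (n + 1) (ε ::ₘ content ν) lam ↔ content lam = ε ::ₘ content ν := by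
  obtain ⟨x, hx, h⟩ := exists_cells_eq_insert hle (by omega)
  have hc := content_of_insert hx h
  constructor
  · intro hb
    have h1 := content_sum_eq_of_inBlock hlam hb
    rw [hc, Multiset.sum_cons, Multiset.sum_cons, add_left_inj] at h1
    rw [hc, h1]
  · intro h1
    rw [← h1]
    exact inBlock_content hlam

open Classical in
theorem eStep_spechtChar (ε : ZMod 2) (hlam : lam.card = n + 1) :
    eStep ε n (spechtChar (n + 1) lam) =
      ∑ ν ∈ (partitionsOf n).filter (AddsNode ε · lam), spechtChar n ν := by
  rw [eStep, extendLinearly_spechtChar _ hlam]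
  split_ifs with hε
  · rw [blockComponent, sum_filter, sum_filter]
    refine sum_congr rfl fun ν hν => ?_
    have hν' := mem_partitionsOf.1 hν
    rw [charInner_res_eq hν' hlam]
    by_cases hle : ν ≤ lam
    · have hiff : InBlock n ((content lam).erase ε) ν ↔ AddsNode ε ν lam := by
        rw [inBlock_iff_of_erase hν' hlam hle hε]
        exact ⟨fun h => ⟨hle, by omega, h⟩, fun h => h.2.2⟩
      simp only [hiff, if_pos hle, one_smul]
    · have hnot : ¬ AddsNode ε ν lam := fun h => hle h.1
      simp [hle, hnot]
  · rw [filter_eq_empty_iff.2, sum_empty]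
    rintro ν _ ⟨_, _, h⟩
    apply hε
    rw [h]
    exact Multiset.mem_cons_self _ _

open Classical in
theorem fStep_spechtChar (ε : ZMod 2) (hν : ν.card = n) :
    fStep ε n (spechtChar n ν) =
      ∑ lam ∈ (partitionsOf (n + 1)).filter (AddsNode ε ν), spechtChar (n + 1) lam := by
  rw [fStep, extendLinearly_spechtChar _ hν, blockComponent, sum_filter, sum_filter]
  refine sum_congr rfl fun lam hl => ?_
  have hlam := mem_partitionsOf.1 hl
  rw [charInner_ind_eq hν hlam]
  by_cases hle : ν ≤ lam
  · have hiff : InBlock (n + 1) (ε ::ₘ content ν) lam ↔ AddsNode ε ν lam := by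
      rw [inBlock_iff_of_cons hν hlam hle]
      exact ⟨fun h => ⟨hle, by omega, h⟩, fun h => h.2.2⟩
    simp only [hiff, if_pos hle, one_smul]
  · have hnot : ¬ AddsNode ε ν lam := fun h => hle h.1
    simp [hle, hnot]

theorem spe_eq (h : μ.card = n) :
    spe μ = DirectSum.lof ℂ ℕ (fun n => Perm (Fin n) → ℂ) n (spechtChar n μ) := by
  subst h
  rfl

/-- `e_ε` removes a node of residue `ε` in all possible ways. -/
theorem eRes_spe (ε : ZMod 2) (lam : YoungDiagram) (s : Finset YoungDiagram)
    (hs : ∀ ν, ν ∈ s ↔ AddsNode ε ν lam) : eRes ε (spe lam) = ∑ ν ∈ s, spe ν := by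
  classical
  obtain ⟨n, hn⟩ : ∃ n, lam.card = n := ⟨_, rfl⟩
  rw [spe_eq hn, eRes, DirectSum.toModule_lof]
  cases n with
  | zero =>
    have hs0 : s = ∅ := by
      rw [eq_empty_iff_forall_notMem]
      intro ν hν
      have := ((hs ν).1 hν).2.1
      omega
    rw [hs0, sum_empty]
    rfl
  | succ n =>
    have hsf : s = (partitionsOf n).filter (AddsNode ε · lam) := by
      ext ν
      rw [hs, mem_filter, mem_partitionsOf]
      exact ⟨fun h => ⟨by have := h.2.1; omega, h⟩, fun h => h.2⟩
    rw [eComponent, LinearMap.comp_apply, eStep_spechtChar ε hn, map_sum, hsf]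
    refine sum_congr rfl fun ν hν => ?_
    rw [spe_eq (mem_partitionsOf.1 (mem_filter.1 hν).1)]

/-- `f_ε` adds a node of residue `ε` in all possible ways. -/
theorem fInd_spe (ε : ZMod 2) (ν : YoungDiagram) (s : Finset YoungDiagram)
    (hs : ∀ lam, lam ∈ s ↔ AddsNode ε ν lam) : fInd ε (spe ν) = ∑ lam ∈ s, spe lam := by
  classical
  obtain ⟨n, hn⟩ : ∃ n, ν.card = n := ⟨_, rfl⟩
  rw [spe_eq hn, fInd, DirectSum.toModule_lof]
  have hsf : s = (partitionsOf (n + 1)).filter (AddsNode ε ν) := by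
    ext lam
    rw [hs, mem_filter, mem_partitionsOf]
    exact ⟨fun h => ⟨by have := h.2.1; omega, h⟩, fun h => h.2⟩
  rw [LinearMap.comp_apply, fStep_spechtChar ε hn, map_sum, hsf]
  refine sum_congr rfl fun lam hl => ?_
  rw [spe_eq (mem_partitionsOf.1 (mem_filter.1 hl).1)]

end

section

/-! ### Beta-sets -/

variable {n r : ℕ} {μ ν lam : YoungDiagram}

theorem rowLen_eq_zero {i : ℕ} (h : μ.colLen 0 ≤ i) : μ.rowLen i = 0 := by
  by_contra h0
  have h1 : (i, 0) ∈ μ := YoungDiagram.mem_iff_lt_rowLen.2 (Nat.pos_of_ne_zero h0)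
  rw [YoungDiagram.mem_iff_lt_colLen] at h1
  omega

theorem beta_strictAnti (μ : YoungDiagram) {i j : ℕ} (hij : i < j) (hj : j < r) :
    μ.rowLen j + (r - 1 - j) < μ.rowLen i + (r - 1 - i) := by
  have := μ.rowLen_anti i j hij.le
  omega

theorem beta_injOn (μ : YoungDiagram) (r : ℕ) :
    Set.InjOn (fun i => μ.rowLen i + (r - 1 - i)) (range r : Finset ℕ) := by
  intro i hi j hj h
  simp only [coe_range, Set.mem_Iio] at hi hj
  simp only at h
  rcases lt_trichotomy i j with hlt | heq | hgt
  · have := beta_strictAnti μ hlt hj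
    omega
  · exact heq
  · have := beta_strictAnti μ hgt hi
    omega

theorem mem_betaSet {b : ℕ} :
    b ∈ betaSet μ r ↔ ∃ i < r, μ.rowLen i + (r - 1 - i) = b := by
  simp [betaSet]

theorem card_betaSet (μ : YoungDiagram) (r : ℕ) : #(betaSet μ r) = r := by
  rw [betaSet, card_image_of_injOn (beta_injOn μ r), card_range]

/-- The quantities $\mu_k-k$ strictly decrease, so the beads at or beyond position $j+r-i$ belong to
an initial run of rows, which includes row `i` exactly when $j<\mu_i$. The diagram is thus recovered
from the bead set by counting. -/
theorem mem_iff_lt_card_betaSet (h : μ.colLen 0 ≤ r) {i j : ℕ} :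
    (i, j) ∈ μ ↔ i < #((betaSet μ r).filter fun b => j + r ≤ b + i) := by
  have hc : #((betaSet μ r).filter fun b => j + r ≤ b + i) =
      #((range r).filter fun k => j + r ≤ μ.rowLen k + (r - 1 - k) + i) := by
    rw [betaSet, filter_image, card_image_of_injOn]
    exact (beta_injOn μ r).mono (coe_subset.2 (filter_subset _ _))
  rw [hc, YoungDiagram.mem_iff_lt_rowLen]
  constructor
  · intro hj
    have hi : i < r := by
      by_contra hge
      rw [rowLen_eq_zero (by omega)] at hj
      omega
    rw [← Nat.succ_le_iff, ← card_range i.succ]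
    refine card_le_card fun k hk => ?_
    rw [mem_range] at hk
    rw [mem_filter, mem_range]
    have := μ.rowLen_anti k i (by omega)
    omega
  · intro hlt
    by_contra hge
    refine absurd hlt (not_lt.2 ?_)
    conv_rhs => rw [← card_range i]
    refine card_le_card fun k hk => ?_
    rw [mem_filter, mem_range] at hk
    rw [mem_range]
    by_contra hik
    have := μ.rowLen_anti i k (by omega)
    omega

theorem betaSet_injective (hμ : μ.colLen 0 ≤ r) (hν : ν.colLen 0 ≤ r)
    (h : betaSet μ r = betaSet ν r) : μ = ν := by
  ext ⟨i, j⟩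
  rw [YoungDiagram.mem_cells, YoungDiagram.mem_cells, mem_iff_lt_card_betaSet hμ,
    mem_iff_lt_card_betaSet hν, h]

theorem emptyAbove_add (B : Finset ℕ) (b : ℕ) :
    emptyAbove B b + #(B.filter (· < b)) = b := by
  have h1 : B.filter (· < b) = (range b).filter (· ∈ B) := by
    ext x
    simp [and_comm]
  rw [h1, emptyAbove, add_comm, card_filter_add_card_filter_not, card_range]

theorem colLen_partitionOfBeads (B : Finset ℕ) : (partitionOfBeads B).colLen 0 ≤ #B := by
  by_contra h
  have h1 : (#B, 0) ∈ partitionOfBeads B := YoungDiagram.mem_iff_lt_colLen.2 (by omega)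
  rw [partitionOfBeads, YoungDiagram.mem_ofRowLens] at h1
  obtain ⟨h2, _⟩ := h1
  simp at h2

/-- The position of a bead is the number of empty positions before it plus the number of beads
before it; for the `i`th largest bead the latter is `#B - 1 - i`. -/
theorem betaSet_partitionOfBeads (B : Finset ℕ) : betaSet (partitionOfBeads B) #B = B := by
  have hlen : (B.sort (· ≥ ·)).length = #B := length_sort _
  have hlt : ∀ (i : ℕ) (hi : i < #B), ∀ (j : ℕ) (hj : j < #B), i < j →
      (B.sort (· ≥ ·))[j]'(hlen ▸ hj) < (B.sort (· ≥ ·))[i]'(hlen ▸ hi) := by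
    intro i hi j hj hij
    exact List.pairwise_iff_getElem.1 (B.sortedGT_sort).pairwise i j (hlen ▸ hi) (hlen ▸ hj) hij
  have hcard : ∀ (i : ℕ) (hi : i < #B),
      #(B.filter (· < (B.sort (· ≥ ·))[i]'(hlen ▸ hi))) = #B - 1 - i := by
    intro i hi
    have h1 : #((range #B).filter (i < ·)) = #B - 1 - i := by
      have : (range #B).filter (i < ·) = Ioo i #B := by
        ext x
        simp [and_comm]
      rw [this, Nat.card_Ioo]
      omega
    rw [← h1]
    symm
    refine card_bij (fun j hj => (B.sort (· ≥ ·))[j]'(hlen ▸ mem_range.1 (mem_filter.1 hj).1))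
      ?_ ?_ ?_
    · intro j hj
      rw [mem_filter, mem_range] at hj
      rw [mem_filter]
      exact ⟨(mem_sort _).1 (List.getElem_mem _), hlt i hi j hj.1 hj.2⟩
    · intro j hj k hk h
      rw [mem_filter, mem_range] at hj hk
      rcases lt_trichotomy j k with h1 | h1 | h1
      · have := hlt j hj.1 k hk.1 h1
        omega
      · exact h1
      · have := hlt k hk.1 j hj.1 h1
        omega
    · intro b hb
      rw [mem_filter] at hb
      obtain ⟨j, hj, rfl⟩ := List.getElem_of_mem ((mem_sort (· ≥ ·)).2 hb.1)
      refine ⟨j, ?_, rfl⟩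
      rw [mem_filter, mem_range]
      refine ⟨hlen ▸ hj, ?_⟩
      by_contra hle
      rcases Nat.lt_or_ge j i with h1 | h1
      · have := hlt j (hlen ▸ hj) i hi h1
        have := hb.2
        omega
      · obtain rfl : i = j := by omega
        exact lt_irrefl _ hb.2
  have hrow : ∀ (i : ℕ) (hi : i < #B), (partitionOfBeads B).rowLen i + (#B - 1 - i) =
      (B.sort (· ≥ ·))[i]'(hlen ▸ hi) := by
    intro i hi
    have h1 : (partitionOfBeads B).rowLen i = emptyAbove B ((B.sort (· ≥ ·))[i]'(hlen ▸ hi)) := by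
      have := YoungDiagram.rowLen_ofRowLens (hw := (List.Pairwise.sortedGE
        (List.pairwise_map.2 ((B.pairwise_sort (· ≥ ·)).imp fun h => emptyAbove_mono B h))))
        (⟨i, by simpa using hi⟩ : Fin ((B.sort (· ≥ ·)).map (emptyAbove B)).length)
      refine Eq.trans this ?_
      simp
    rw [h1, ← hcard i hi, emptyAbove_add]
  ext b
  rw [mem_betaSet]
  constructor
  · rintro ⟨i, hi, rfl⟩
    rw [hrow i hi]
    exact (mem_sort _).1 (List.getElem_mem _)
  · intro hb
    obtain ⟨j, hj, rfl⟩ := List.getElem_of_mem ((mem_sort (· ≥ ·)).2 hb)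
    exact ⟨j, hlen ▸ hj, hrow j (hlen ▸ hj)⟩

theorem partitionOfBeads_betaSet (h : μ.colLen 0 ≤ r) : partitionOfBeads (betaSet μ r) = μ := by
  have h1 := betaSet_partitionOfBeads (betaSet μ r)
  have h2 := colLen_partitionOfBeads (betaSet μ r)
  rw [card_betaSet] at h1 h2
  exact betaSet_injective h2 h h1

/-! ### Adding a node moves a bead -/

/-- The bead configuration with the bead at `b` moved to `b + 1`. -/
def moveBead (B : Finset ℕ) (b : ℕ) : Finset ℕ := insert (b + 1) (B.erase b)

theorem moveBead_of_insert {x : ℕ × ℕ} (hx : x ∉ ν.cells) (h : lam.cells = insert x ν.cells)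
    (hr : x.1 < r) : ∃ b ∈ betaSet ν r, b + 1 ∉ betaSet ν r ∧
      betaSet lam r = moveBead (betaSet ν r) b ∧ residue x = (b : ZMod 2) + r + 1 ∧
      b = ν.rowLen x.1 + (r - 1 - x.1) := by
  have h2 := rowLen_eq_of_insert hx h
  have hrow := rowLen_of_insert hx h
  set b := ν.rowLen x.1 + (r - 1 - x.1) with hb
  have hbm : b ∈ betaSet ν r := mem_betaSet.2 ⟨x.1, hr, rfl⟩
  have hset : betaSet lam r = moveBead (betaSet ν r) b := by
    ext c
    rw [moveBead, mem_insert, mem_erase, mem_betaSet, mem_betaSet]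
    constructor
    · rintro ⟨i, hi, rfl⟩
      rw [hrow]
      split_ifs with hix
      · left
        subst hix
        omega
      · right
        refine ⟨fun he => hix ?_, i, hi, rfl⟩
        exact beta_injOn ν r (by simpa using hi) (by simpa using hr) he
    · rintro (rfl | ⟨hne, i, hi, rfl⟩)
      · refine ⟨x.1, hr, ?_⟩
        rw [hrow, if_pos rfl]
        omega
      · refine ⟨i, hi, ?_⟩
        rw [hrow, if_neg]
        rintro rfl
        exact hne rfl
  refine ⟨b, hbm, ?_, hset, ?_, rfl⟩
  -- If `b + 1` were occupied, the beta-set of `lam` would have only `r - 1` elements.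
  · intro hmem
    have h3 := card_betaSet lam r
    rw [hset, moveBead, insert_eq_of_mem (mem_erase.2 ⟨by omega, hmem⟩),
      card_erase_of_mem hbm, card_betaSet] at h3
    omega
  · rw [residue, h2]
    have h3 : b + x.1 + 1 = ν.rowLen x.1 + r := by omega
    have h4 : (b : ZMod 2) + (x.1 : ZMod 2) + 1 = (ν.rowLen x.1 : ZMod 2) + r := by
      exact_mod_cast congrArg (Nat.cast : ℕ → ZMod 2) h3
    have h5 : ∀ y : ZMod 2, y + y = 0 := fun y => CharTwo.add_self_eq_zero y
    linear_combination (-1 : ZMod 2) * h4 - h5 (r : ZMod 2)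

theorem colLen_of_insert {x : ℕ × ℕ} (h : lam.cells = insert x ν.cells)
    (hν : ν.colLen 0 ≤ r) (hr : x.1 < r) : lam.colLen 0 ≤ r := by
  by_contra hlt
  have h1 : (r, 0) ∈ lam.cells := YoungDiagram.mem_iff_lt_colLen.2 (by omega)
  rw [h, mem_insert] at h1
  rcases h1 with h1 | h1
  · rw [← h1] at hr
    exact lt_irrefl _ hr
  · have := YoungDiagram.mem_iff_lt_colLen.1 h1
    omega

theorem insert_of_moveBead {b : ℕ} (hν : ν.colLen 0 ≤ r) (hlam : lam.colLen 0 ≤ r)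
    (hb : b ∈ betaSet ν r) (hb1 : b + 1 ∉ betaSet ν r)
    (h : betaSet lam r = moveBead (betaSet ν r) b) :
    ∃ x, x ∉ ν.cells ∧ lam.cells = insert x ν.cells ∧ residue x = (b : ZMod 2) + r + 1 := by
  obtain ⟨i, hi, rfl⟩ := mem_betaSet.1 hb
  have hadd : i = 0 ∨ ν.rowLen i < ν.rowLen (i - 1) := by
    by_contra hcon
    push Not at hcon
    apply hb1
    have := ν.rowLen_anti (i - 1) i (by omega)
    exact mem_betaSet.2 ⟨i - 1, by omega, by omega⟩
  obtain ⟨κ, hκ⟩ := exists_add_node hadd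
  have hnot : (i, ν.rowLen i) ∉ ν.cells := fun hm =>
    lt_irrefl _ (YoungDiagram.mem_iff_lt_rowLen.1 hm)
  obtain ⟨b', -, -, hset, hres, rfl⟩ := moveBead_of_insert hnot hκ hi
  have hκl := colLen_of_insert hκ hν hi
  obtain rfl : lam = κ := betaSet_injective hlam hκl (h.trans hset.symm)
  exact ⟨_, hnot, hκ, hres⟩

theorem addsNode_iff {ε : ZMod 2} :
    AddsNode ε ν lam ↔ ∃ x, x ∉ ν.cells ∧ lam.cells = insert x ν.cells ∧ residue x = ε := by
  constructor
  · rintro ⟨hle, hc, hcont⟩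
    obtain ⟨x, hx, h⟩ := exists_cells_eq_insert hle hc
    refine ⟨x, hx, h, ?_⟩
    rw [content_of_insert hx h] at hcont
    exact Multiset.cons_inj_left _ |>.1 hcont
  · rintro ⟨x, hx, h, rfl⟩
    exact ⟨le_of_insert h, card_of_insert hx h, content_of_insert hx h⟩

theorem even_of_cast_add {b : ℕ} (h : (b : ZMod 2) + r + 1 = r + 1) : Even b := by
  rw [add_assoc, add_eq_right] at h
  exact (ZMod.natCast_eq_zero_iff_even).1 h

theorem cast_add_of_even (r k : ℕ) : ((2 * k : ℕ) : ZMod 2) + r + 1 = r + 1 := by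
  rw [Nat.cast_mul, show ((2 : ℕ) : ZMod 2) = 0 from rfl]
  ring

/-- The nodes of residue `r + 1` that can be added to the partition with `r`-element beta-set `B`
correspond to the beads that can be moved from runner `0` to runner `1`. -/
theorem addsNode_iff_moveBead (B : Finset ℕ) (lam : YoungDiagram) :
    AddsNode ((#B : ZMod 2) + 1) (partitionOfBeads B) lam ↔
      ∃ k, 2 * k ∈ B ∧ 2 * k + 1 ∉ B ∧ lam = partitionOfBeads (moveBead B (2 * k)) := by
  have hB := betaSet_partitionOfBeads B
  have hl := colLen_partitionOfBeads B
  rw [addsNode_iff]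
  constructor
  · rintro ⟨x, hx, h, hres⟩
    -- The only addable node outside the rows of the display is the one in row `#B` and column `0`.
    -- Its residue is that of `#B`, not of `#B + 1`.
    have hr : x.1 < #B := by
      by_contra hge
      have h2 := rowLen_eq_of_insert hx h
      rw [rowLen_eq_zero (by omega)] at h2
      have hx1 : x.1 = #B := by
        by_contra hne
        have hm : (#B, 0) ∈ lam.cells := lam.up_left_mem (i2 := x.1) (j2 := x.2) (by omega)
          (by omega) (show x ∈ lam.cells by rw [h]; exact mem_insert_self _ _)
        rw [h, mem_insert] at hm
        rcases hm with hm | hm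
        · rw [← hm] at hne
          exact hne rfl
        · have := YoungDiagram.mem_iff_lt_colLen.1 hm
          omega
      rw [residue, h2, hx1, Nat.cast_zero, zero_sub, CharTwo.neg_eq] at hres
      simp at hres
    obtain ⟨b, hb, hb1, hset, hres', -⟩ := moveBead_of_insert hx h hr
    rw [hres] at hres'
    obtain ⟨k, rfl⟩ := even_iff_exists_two_mul.1 (even_of_cast_add hres'.symm)
    rw [hB] at hb hb1 hset
    refine ⟨k, hb, hb1, ?_⟩
    rw [← hset, partitionOfBeads_betaSet (colLen_of_insert h hl hr)]
  · rintro ⟨k, hk, hk1, rfl⟩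
    have hcard : #(moveBead B (2 * k)) = #B := by
      rw [moveBead, card_insert_of_notMem (fun h => hk1 (mem_erase.1 h).2),
        card_erase_add_one hk]
    have h1 := betaSet_partitionOfBeads (moveBead B (2 * k))
    have h2 := colLen_partitionOfBeads (moveBead B (2 * k))
    rw [hcard] at h1 h2
    obtain ⟨x, hx, h, hres⟩ := insert_of_moveBead hl h2 (by rwa [hB]) (by rwa [hB])
      (by rw [h1, hB])
    exact ⟨x, hx, h, hres.trans (cast_add_of_even _ _)⟩

/-- The nodes of residue `r + 1` that can be removed from the partition with `r`-element beta-set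
`B` correspond to the beads that can be moved from runner `1` to runner `0`. -/
theorem addsNode_iff_eq_moveBead (B : Finset ℕ) (ν : YoungDiagram) :
    AddsNode ((#B : ZMod 2) + 1) ν (partitionOfBeads B) ↔
      ∃ k A, 2 * k ∈ A ∧ 2 * k + 1 ∉ A ∧ B = moveBead A (2 * k) ∧ ν = partitionOfBeads A := by
  constructor
  · intro h
    have hν : ν.colLen 0 ≤ #B := by
      by_contra hlt
      have h1 : (#B, 0) ∈ ν := YoungDiagram.mem_iff_lt_colLen.2 (by omega)
      have h2 := colLen_partitionOfBeads B
      have := YoungDiagram.mem_iff_lt_colLen.1 (h.1 h1)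
      omega
    have hc := card_betaSet ν #B
    have hν' := partitionOfBeads_betaSet hν
    have h' : AddsNode ((#(betaSet ν #B) : ZMod 2) + 1) (partitionOfBeads (betaSet ν #B))
        (partitionOfBeads B) := by
      rw [hν', hc]
      exact h
    obtain ⟨k, hk, hk1, hlam⟩ := (addsNode_iff_moveBead _ _).1 h'
    refine ⟨k, _, hk, hk1, ?_, hν'.symm⟩
    have hcard : #(moveBead (betaSet ν #B) (2 * k)) = #B := by
      rw [moveBead, card_insert_of_notMem (fun h => hk1 (mem_erase.1 h).2),
        card_erase_add_one hk, hc]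
    have h1 := betaSet_partitionOfBeads (moveBead (betaSet ν #B) (2 * k))
    rw [hcard, ← hlam, betaSet_partitionOfBeads] at h1
    exact h1
  · rintro ⟨k, A, hk, hk1, rfl, rfl⟩
    have hcard : #(moveBead A (2 * k)) = #A := by
      rw [moveBead, card_insert_of_notMem (fun h => hk1 (mem_erase.1 h).2),
        card_erase_add_one hk]
    rw [hcard, addsNode_iff_moveBead]
    exact ⟨k, hk, hk1, rfl⟩

end

section

/-! ### Divided powers on a family indexed by subsets -/

section Subsets

variable {α V : Type*} [DecidableEq α] [AddCommGroup V]

/-- Each `(k + 1)`-subset arises once for every choice of its last inserted element; iterating this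
produces the factorials that the divided powers cancel. -/
theorem sum_powersetCard_insert (Q : Finset α) (F : Finset α → V) (k : ℕ) :
    ∑ A ∈ powersetCard k Q, ∑ j ∈ Q \ A, F (insert j A) =
      (k + 1) • ∑ A ∈ powersetCard (k + 1) Q, F A := by
  have h : (k + 1) • ∑ A ∈ powersetCard (k + 1) Q, F A =
      ∑ A ∈ powersetCard (k + 1) Q, ∑ _j ∈ A, F A := by
    rw [smul_sum]
    refine sum_congr rfl fun A hA => ?_
    rw [sum_const, (mem_powersetCard.1 hA).2]
  rw [h, sum_sigma', sum_sigma']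
  refine Finset.sum_bij' (fun p _ => ⟨insert p.2 p.1, p.2⟩) (fun p _ => ⟨p.1.erase p.2, p.2⟩)
    ?_ ?_ ?_ ?_ ?_
  · rintro ⟨A, j⟩ hp
    simp only [mem_sigma, mem_powersetCard, mem_sdiff] at hp ⊢
    exact ⟨⟨insert_subset hp.2.1 hp.1.1, by rw [card_insert_of_notMem hp.2.2, hp.1.2]⟩,
      mem_insert_self _ _⟩
  · rintro ⟨A, j⟩ hp
    simp only [mem_sigma, mem_powersetCard, mem_sdiff] at hp ⊢
    exact ⟨⟨(erase_subset _ _).trans hp.1.1, by rw [card_erase_of_mem hp.2, hp.1.2]; rfl⟩,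
      hp.1.1 hp.2, notMem_erase _ _⟩
  · rintro ⟨A, j⟩ hp
    simp only [mem_sigma, mem_powersetCard, mem_sdiff] at hp
    simp [erase_insert hp.2.2]
  · rintro ⟨A, j⟩ hp
    simp only [mem_sigma, mem_powersetCard] at hp
    simp [insert_erase hp.2]
  · rintro ⟨A, j⟩ _
    rfl

theorem sum_union_eq {O : Finset α} {w : Finset α → V} {p : ℕ} {R : Finset α} (hR : R ⊆ O) (hp : #R ≤ p) :
    ∑ B ∈ powersetCard (p - #R) (O \ R), w (R ∪ B) =
      ∑ Q' ∈ powersetCard p O, if R ⊆ Q' then w Q' else 0 := by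
  rw [← sum_filter]
  refine Finset.sum_bij' (fun B _ => R ∪ B) (fun Q' _ => Q' \ R) ?_ ?_ ?_ ?_ ?_
  · intro B hB
    rw [mem_powersetCard] at hB
    rw [mem_filter, mem_powersetCard]
    refine ⟨⟨union_subset hR (hB.1.trans sdiff_subset), ?_⟩, subset_union_left⟩
    rw [card_union_of_disjoint (disjoint_of_subset_right hB.1 disjoint_sdiff), hB.2]
    omega
  · intro Q' hQ'
    rw [mem_filter, mem_powersetCard] at hQ'
    rw [mem_powersetCard, card_sdiff_of_subset hQ'.2, hQ'.1.2]
    exact ⟨sdiff_subset_sdiff hQ'.1.1 le_rfl, rfl⟩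
  · intro B hB
    rw [mem_powersetCard] at hB
    rw [union_sdiff_cancel_left (disjoint_of_subset_right hB.1 disjoint_sdiff)]
  · intro Q' hQ'
    rw [mem_filter] at hQ'
    exact union_sdiff_of_subset hQ'.2
  · intro _ _
    rfl

variable [Module ℂ V] {O : Finset α} {w : Finset α → V} {e f : Module.End ℂ V}

theorem pow_lower (he : ∀ Q ⊆ O, e (w Q) = ∑ k ∈ Q, w (Q.erase k)) {Q : Finset α} (hQ : Q ⊆ O)
    (k : ℕ) : (e ^ k) (w Q) = (k.factorial : ℂ) • ∑ A ∈ powersetCard k Q, w (Q \ A) := by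
  induction k with
  | zero => simp
  | succ k ih =>
    have h : ∀ A ∈ powersetCard k Q, e (w (Q \ A)) = ∑ j ∈ Q \ A, w (Q \ insert j A) := by
      intro A _
      rw [he _ (sdiff_subset.trans hQ)]
      exact sum_congr rfl fun j _ => by rw [sdiff_insert]
    rw [pow_succ', Module.End.mul_apply, ih, map_smul, map_sum, sum_congr rfl h,
      sum_powersetCard_insert Q (fun A => w (Q \ A)), ← Nat.cast_smul_eq_nsmul ℂ, smul_smul,
      Nat.factorial_succ, Nat.cast_mul, mul_comm]

theorem pow_raise (hf : ∀ Q ⊆ O, f (w Q) = ∑ k ∈ O \ Q, w (insert k Q)) {R : Finset α}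
    (hR : R ⊆ O) (k : ℕ) :
    (f ^ k) (w R) = (k.factorial : ℂ) • ∑ B ∈ powersetCard k (O \ R), w (R ∪ B) := by
  induction k with
  | zero => simp
  | succ k ih =>
    have h : ∀ B ∈ powersetCard k (O \ R), f (w (R ∪ B)) =
        ∑ j ∈ (O \ R) \ B, w (R ∪ insert j B) := by
      intro B hB
      rw [hf _ (union_subset hR ((mem_powersetCard.1 hB).1.trans sdiff_subset)),
        show O \ (R ∪ B) = (O \ R) \ B by
          ext x; simp only [mem_sdiff, mem_union]; tauto]
      exact sum_congr rfl fun j _ => by rw [union_insert]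
    rw [pow_succ', Module.End.mul_apply, ih, map_smul, map_sum, sum_congr rfl h,
      sum_powersetCard_insert (O \ R) (fun B => w (R ∪ B)), ← Nat.cast_smul_eq_nsmul ℂ, smul_smul,
      Nat.factorial_succ, Nat.cast_mul, mul_comm]

/-- After exchanging the sums, `Q'` has as coefficient a sign times the alternating sum over the
subsets of `Q ∩ Q'`, which is zero unless that set is empty. The size of `Q'` then leaves only `O \
Q`. -/
theorem sum_powerset_alternating (O Q : Finset α) (w : Finset α → V) :
    ∑ R ∈ Q.powerset, ∑ Q' ∈ powersetCard #(O \ Q) O,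
      (if R ⊆ Q' then (-1 : ℂ) ^ (#(O \ Q) + #R) • w Q' else 0) =
      (-1 : ℂ) ^ #(O \ Q) • w (O \ Q) := by
  rw [sum_comm]
  have h : ∀ Q' ∈ powersetCard #(O \ Q) O,
      (∑ R ∈ Q.powerset, if R ⊆ Q' then (-1 : ℂ) ^ (#(O \ Q) + #R) • w Q' else 0) =
      if Q' = O \ Q then (-1 : ℂ) ^ #(O \ Q) • w Q' else 0 := by
    intro Q' hQ'
    rw [mem_powersetCard] at hQ'
    have h1 : Q.powerset.filter (· ⊆ Q') = (Q ∩ Q').powerset := by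
      ext R
      rw [mem_filter, mem_powerset, mem_powerset, subset_inter_iff]
    have h2 : ∑ R ∈ (Q ∩ Q').powerset, (-1 : ℂ) ^ #R = if Q ∩ Q' = ∅ then 1 else 0 := by
      exact_mod_cast congrArg (Int.cast : ℤ → ℂ) (sum_powerset_neg_one_pow_card (x := Q ∩ Q'))
    have h3 : Q ∩ Q' = ∅ ↔ Q' = O \ Q := by
      constructor
      · intro h
        refine eq_of_subset_of_card_le ?_ hQ'.2.ge
        intro x hx
        refine mem_sdiff.2 ⟨hQ'.1 hx, fun hxQ => ?_⟩
        have : x ∈ Q ∩ Q' := mem_inter.2 ⟨hxQ, hx⟩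
        rw [h] at this
        exact notMem_empty _ this
      · rintro rfl
        exact inter_sdiff_self _ _
    rw [← sum_filter, h1]
    simp_rw [pow_add, mul_smul]
    rw [← smul_sum, ← sum_smul, h2]
    simp only [h3]
    split_ifs <;> simp
  rw [sum_congr rfl h, sum_ite_eq', if_pos]
  rw [mem_powersetCard]
  exact ⟨sdiff_subset, rfl⟩

end Subsets

/-- The runner-swapping function on a family on which `e_ε` and `f_ε` act by removing and adding
elements. -/
theorem runnerSwap_family {α : Type*} [DecidableEq α] {ε : ZMod 2} {O : Finset α}
    {w : Finset α → CharSpace} (he : ∀ Q ⊆ O, eRes ε (w Q) = ∑ k ∈ Q, w (Q.erase k))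
    (hf : ∀ Q ⊆ O, fInd ε (w Q) = ∑ k ∈ O \ Q, w (insert k Q)) {Q : Finset α} (hQ : Q ⊆ O)
    {c : ℤ} (hc : c = (#(O \ Q) : ℤ) - #Q) :
    runnerSwap ε c (w Q) = (-1 : ℂ) ^ #(O \ Q) • w (O \ Q) := by
  have hE : ∀ k, divPow (eRes ε) k (w Q) = ∑ A ∈ powersetCard k Q, w (Q \ A) := by
    intro k
    rw [divPow, LinearMap.smul_apply, pow_lower he hQ, smul_smul,
      inv_mul_cancel₀ (Nat.cast_ne_zero.2 k.factorial_ne_zero), one_smul]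
  have hF : ∀ k, ∀ R ⊆ O, divPow (fInd ε) k (w R) =
      ∑ B ∈ powersetCard k (O \ R), w (R ∪ B) := by
    intro k R hR
    rw [divPow, LinearMap.smul_apply, pow_raise hf hR, smul_smul,
      inv_mul_cancel₀ (Nat.cast_ne_zero.2 k.factorial_ne_zero), one_smul]
  have hterm : ∀ a : ℕ, (∑ᶠ (_ : 0 ≤ (a : ℤ) + c), (-1 : ℂ) ^ ((a : ℤ) + c).toNat •
      divPow (fInd ε) ((a : ℤ) + c).toNat (divPow (eRes ε) a (w Q))) =
      ∑ A ∈ powersetCard a Q, ∑ Q' ∈ powersetCard #(O \ Q) O,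
        (if Q \ A ⊆ Q' then (-1 : ℂ) ^ (#(O \ Q) + #(Q \ A)) • w Q' else 0) := by
    intro a
    rw [finsum_eq_if]
    have hcardA : ∀ A ∈ powersetCard a Q, #(Q \ A) + a = #Q := by
      intro A hA
      rw [mem_powersetCard] at hA
      rw [card_sdiff_of_subset hA.1, ← hA.2]
      exact Nat.sub_add_cancel (card_le_card hA.1)
    split_ifs with h0
    · rw [hE, map_sum, smul_sum]
      refine sum_congr rfl fun A hA => ?_
      have h1 := hcardA A hA
      -- Removing `A` and adding `a + c` elements always ends at a set of size `#(O \ Q)`, by the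
      -- choice of `c`. The sign depends only on the size of `Q \ A`.
      have h2 : ((a : ℤ) + c).toNat = #(O \ Q) - #(Q \ A) := by omega
      have h3 : (-1 : ℂ) ^ (#(O \ Q) + #(Q \ A)) = (-1 : ℂ) ^ (#(O \ Q) - #(Q \ A)) := by
        rw [show #(O \ Q) + #(Q \ A) = (#(O \ Q) - #(Q \ A)) + 2 * #(Q \ A) by omega, pow_add,
          pow_mul, neg_one_sq, one_pow, mul_one]
      rw [hF _ _ (sdiff_subset.trans hQ), h2, sum_union_eq (sdiff_subset.trans hQ) (by omega),
        smul_sum]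
      refine sum_congr rfl fun Q' _ => ?_
      rw [h3]
      split_ifs <;> simp
    -- When `a + c` is negative, `Q \ A` is larger than `#(O \ Q)` and fits into no `Q'`. The terms
    -- excluded from the runner-swapping function may therefore be included as zeros.
    · symm
      refine sum_eq_zero fun A hA => sum_eq_zero fun Q' hQ' => if_neg fun hsub => h0 ?_
      have h1 := hcardA A hA
      have h2 := card_le_card hsub
      rw [(mem_powersetCard.1 hQ').2] at h2
      omega
  -- Summing over all sizes `a` is summing over all subsets `A` of `Q`, and complementation replaces
  -- `A` by `R = Q \ A`.
  rw [runnerSwap, finsum_congr hterm, finsum_eq_sum_of_support_subset (s := range (#Q + 1)),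
    ← sum_powerset Q, ← sum_powerset_alternating O Q w]
  · refine Finset.sum_bij' (fun A _ => Q \ A) (fun A _ => Q \ A) ?_ ?_ ?_ ?_ ?_
    · exact fun A _ => mem_powerset.2 sdiff_subset
    · exact fun A _ => mem_powerset.2 sdiff_subset
    · exact fun A hA => Finset.sdiff_sdiff_eq_self (mem_powerset.1 hA)
    · exact fun A hA => Finset.sdiff_sdiff_eq_self (mem_powerset.1 hA)
    · exact fun A _ => rfl
  · intro a ha
    rw [coe_range, Set.mem_Iio]
    by_contra hlt
    apply ha
    have hempty : powersetCard a Q = ∅ := powersetCard_eq_empty.2 (by omega)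
    simp only [hempty, sum_empty]

/-! ### Runners -/

/-- The bead configuration with given runners. -/
def ofRunners (X Y : Finset ℕ) : Finset ℕ := X.image (2 * ·) ∪ Y.image (2 * · + 1)

theorem even_mem_ofRunners {X Y : Finset ℕ} {k : ℕ} : 2 * k ∈ ofRunners X Y ↔ k ∈ X := by
  simp only [ofRunners, mem_union, mem_image]
  constructor
  · rintro (⟨j, hj, h⟩ | ⟨j, _, h⟩)
    · rwa [show k = j by omega]
    · omega
  · exact fun h => Or.inl ⟨k, h, rfl⟩

theorem odd_mem_ofRunners {X Y : Finset ℕ} {k : ℕ} : 2 * k + 1 ∈ ofRunners X Y ↔ k ∈ Y := by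
  simp only [ofRunners, mem_union, mem_image]
  constructor
  · rintro (⟨j, _, h⟩ | ⟨j, hj, h⟩)
    · omega
    · rwa [show k = j by omega]
  · exact fun h => Or.inr ⟨k, h, rfl⟩

theorem ext_even_odd {A B : Finset ℕ} (h0 : ∀ k, 2 * k ∈ A ↔ 2 * k ∈ B)
    (h1 : ∀ k, 2 * k + 1 ∈ A ↔ 2 * k + 1 ∈ B) : A = B := by
  ext b
  rcases Nat.even_or_odd' b with ⟨k, rfl | rfl⟩
  · exact h0 k
  · exact h1 k

theorem mem_runner_zero {B : Finset ℕ} {k : ℕ} : k ∈ runner 0 B ↔ 2 * k ∈ B := by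
  simp only [runner, mem_image, mem_filter]
  constructor
  · rintro ⟨b, ⟨hb, h⟩, rfl⟩
    rwa [show 2 * (b / 2) = b by omega]
  · exact fun h => ⟨2 * k, ⟨h, by omega⟩, by omega⟩

theorem mem_runner_one {B : Finset ℕ} {k : ℕ} : k ∈ runner 1 B ↔ 2 * k + 1 ∈ B := by
  simp only [runner, mem_image, mem_filter]
  constructor
  · rintro ⟨b, ⟨hb, h⟩, rfl⟩
    rwa [show 2 * (b / 2) + 1 = b by omega]
  · exact fun h => ⟨2 * k + 1, ⟨h, by omega⟩, by omega⟩

theorem runner_zero_ofRunners (X Y : Finset ℕ) : runner 0 (ofRunners X Y) = X := by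
  ext k
  rw [mem_runner_zero, even_mem_ofRunners]

theorem runner_one_ofRunners (X Y : Finset ℕ) : runner 1 (ofRunners X Y) = Y := by
  ext k
  rw [mem_runner_one, odd_mem_ofRunners]

theorem ofRunners_runner (B : Finset ℕ) : ofRunners (runner 0 B) (runner 1 B) = B :=
  ext_even_odd (fun k => by rw [even_mem_ofRunners, mem_runner_zero])
    (fun k => by rw [odd_mem_ofRunners, mem_runner_one])

theorem card_ofRunners (X Y : Finset ℕ) : #(ofRunners X Y) = #X + #Y := by
  rw [ofRunners, card_union_of_disjoint, card_image_of_injective, card_image_of_injective]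
  · intro a b h
    simp only at h
    omega
  · intro a b h
    simp only at h
    omega
  · rw [disjoint_left]
    intro b h1 h2
    obtain ⟨i, _, rfl⟩ := mem_image.1 h1
    obtain ⟨j, _, h⟩ := mem_image.1 h2
    omega

theorem swapRunners_eq (B : Finset ℕ) : swapRunners B = ofRunners (runner 1 B) (runner 0 B) := by
  refine ext_even_odd (fun k => ?_) (fun k => ?_)
  · rw [even_mem_ofRunners, mem_runner_one, swapRunners, mem_image]
    constructor
    · rintro ⟨b, hb, h⟩
      split_ifs at h with h2
      · omega
      · rwa [show 2 * k + 1 = b by omega]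
    · intro h
      refine ⟨_, h, ?_⟩
      rw [if_neg (by omega)]
      omega
  · rw [odd_mem_ofRunners, mem_runner_zero, swapRunners, mem_image]
    constructor
    · rintro ⟨b, hb, h⟩
      split_ifs at h with h2
      · rwa [show 2 * k = b by omega]
      · omega
    · intro h
      refine ⟨_, h, ?_⟩
      rw [if_pos (by omega)]

theorem moveBead_ofRunners (X Y : Finset ℕ) (k : ℕ) :
    moveBead (ofRunners X Y) (2 * k) = ofRunners (X.erase k) (insert k Y) := by
  refine ext_even_odd (fun j => ?_) (fun j => ?_)
  · rw [even_mem_ofRunners, moveBead, mem_insert, mem_erase, mem_erase, even_mem_ofRunners]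
    constructor
    · rintro (h | h)
      · omega
      · exact ⟨fun hj => h.1 (by rw [hj]), h.2⟩
    · rintro ⟨h1, h2⟩
      exact Or.inr ⟨by omega, h2⟩
  · rw [odd_mem_ofRunners, moveBead, mem_insert, mem_erase, mem_insert, odd_mem_ofRunners]
    constructor
    · rintro (h | h)
      · exact Or.inl (by omega)
      · exact Or.inr h.2
    · rintro (h | h)
      · exact Or.inl (by omega)
      · exact Or.inr ⟨by omega, h⟩

theorem partitionOfBeads_inj {A B : Finset ℕ} (hc : #A = #B)
    (h : partitionOfBeads A = partitionOfBeads B) : A = B := by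
  rw [← betaSet_partitionOfBeads A, ← betaSet_partitionOfBeads B, h, hc]

/-- The configuration with beads on both runners in the rows of `D`, a single bead on runner `1` in
the rows of `Q`, and a single bead on runner `0` in the rows of `O \ Q`. -/
def config (D O Q : Finset ℕ) : Finset ℕ := ofRunners (D ∪ (O \ Q)) (D ∪ Q)

variable {D O Q : Finset ℕ}

theorem card_config (hDO : Disjoint D O) (hQ : Q ⊆ O) : #(config D O Q) = 2 * #D + #O := by
  rw [config, card_ofRunners, card_union_of_disjoint (hDO.mono_right sdiff_subset),
    card_union_of_disjoint (hDO.mono_right hQ)]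
  have := card_sdiff_add_card_eq_card hQ
  omega

theorem even_mem_config {k : ℕ} : 2 * k ∈ config D O Q ↔ k ∈ D ∨ k ∈ O ∧ k ∉ Q := by
  rw [config, even_mem_ofRunners, mem_union, mem_sdiff]

theorem odd_mem_config {k : ℕ} : 2 * k + 1 ∈ config D O Q ↔ k ∈ D ∨ k ∈ Q := by
  rw [config, odd_mem_ofRunners, mem_union]

theorem moveBead_config {k : ℕ} (hDO : Disjoint D O) (hk : k ∈ O) (hkQ : k ∉ Q) :
    moveBead (config D O Q) (2 * k) = config D O (insert k Q) := by
  have hkD : k ∉ D := fun h => disjoint_left.1 hDO h hk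
  rw [config, moveBead_ofRunners, config]
  congr 1
  · ext j
    by_cases hj : j = k
    · subst hj; simp [hkD]
    · simp [hj]
  · ext j
    by_cases hj : j = k
    · subst hj; simp
    · simp [hj]

/-- A bead can move across only in a row whose single bead is on runner `0`, that is, in a row of `O
\ Q`. The number of beads `2 * #D + #O` does not depend on `Q`, so one residue serves the whole
family. -/
theorem fInd_config (hDO : Disjoint D O) (hQ : Q ⊆ O) :
    fInd ((2 * #D + #O : ℕ) + 1 : ZMod 2) (spe (partitionOfBeads (config D O Q))) =
      ∑ k ∈ O \ Q, spe (partitionOfBeads (config D O (insert k Q))) := by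
  rw [fInd_spe _ _ ((O \ Q).image fun k => partitionOfBeads (config D O (insert k Q))), sum_image]
  · intro k hk j hj h
    simp only [coe_sdiff, Set.mem_sdiff, mem_coe] at hk hj
    have h1 := partitionOfBeads_inj (by
      rw [card_config hDO (insert_subset hk.1 hQ), card_config hDO (insert_subset hj.1 hQ)]) h
    have h2 : 2 * k + 1 ∈ config D O (insert k Q) :=
      odd_mem_config.2 (Or.inr (mem_insert_self _ _))
    rw [h1, odd_mem_config, mem_insert] at h2
    rcases h2 with h2 | h2 | h2
    · exact absurd hk.1 (disjoint_left.1 hDO h2)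
    · exact h2
    · exact absurd h2 hk.2
  · intro lam
    rw [← card_config hDO hQ, addsNode_iff_moveBead, mem_image]
    constructor
    · rintro ⟨k, hk, rfl⟩
      rw [mem_sdiff] at hk
      have hkD : k ∉ D := fun h => disjoint_left.1 hDO h hk.1
      refine ⟨k, even_mem_config.2 (Or.inr hk), ?_, by rw [moveBead_config hDO hk.1 hk.2]⟩
      rw [odd_mem_config]
      tauto
    · rintro ⟨k, hk, hk1, rfl⟩
      rw [even_mem_config] at hk
      rw [odd_mem_config] at hk1
      have hk' : k ∈ O ∧ k ∉ Q := by tauto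
      exact ⟨k, mem_sdiff.2 hk', by rw [moveBead_config hDO hk'.1 hk'.2]⟩

theorem eRes_config (hDO : Disjoint D O) (hQ : Q ⊆ O) :
    eRes ((2 * #D + #O : ℕ) + 1 : ZMod 2) (spe (partitionOfBeads (config D O Q))) =
      ∑ k ∈ Q, spe (partitionOfBeads (config D O (Q.erase k))) := by
  have hsub : ∀ k, Q.erase k ⊆ O := fun k => (erase_subset _ _).trans hQ
  rw [eRes_spe _ _ (Q.image fun k => partitionOfBeads (config D O (Q.erase k))), sum_image]
  · intro k hk j hj h
    have h1 := partitionOfBeads_inj (by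
      rw [card_config hDO (hsub k), card_config hDO (hsub j)]) h
    by_contra hne
    have h2 : 2 * k + 1 ∈ config D O (Q.erase j) :=
      odd_mem_config.2 (Or.inr (mem_erase.2 ⟨hne, hk⟩))
    rw [← h1, odd_mem_config] at h2
    rcases h2 with h2 | h2
    · exact disjoint_left.1 hDO h2 (hQ hk)
    · exact notMem_erase _ _ h2
  · intro ν
    rw [← card_config hDO hQ, addsNode_iff_eq_moveBead, mem_image]
    constructor
    · rintro ⟨k, hk, rfl⟩
      have hkD : k ∉ D := fun h => disjoint_left.1 hDO h (hQ hk)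
      refine ⟨k, _, even_mem_config.2 (Or.inr ⟨hQ hk, notMem_erase _ _⟩), ?_, ?_, rfl⟩
      · rw [odd_mem_config]
        rintro (h | h)
        · exact hkD h
        · exact notMem_erase _ _ h
      · rw [moveBead_config hDO (hQ hk) (notMem_erase _ _), insert_erase hk]
    · rintro ⟨k, A, hk, hk1, hA, rfl⟩
      have h1 : 2 * k + 1 ∈ config D O Q := by
        rw [hA, moveBead]
        exact mem_insert_self _ _
      have h2 : 2 * k ∉ config D O Q := by
        rw [hA, moveBead, mem_insert, mem_erase]
        omega
      rw [odd_mem_config] at h1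
      rw [even_mem_config] at h2
      have hkQ : k ∈ Q := by tauto
      refine ⟨k, hkQ, ?_⟩
      have h3 := moveBead_config (Q := Q.erase k) hDO (hQ hkQ) (notMem_erase _ _)
      rw [insert_erase hkQ, hA] at h3
      have h4 : 2 * k ∈ config D O (Q.erase k) :=
        even_mem_config.2 (Or.inr ⟨hQ hkQ, notMem_erase _ _⟩)
      have h5 : 2 * k + 1 ∉ config D O (Q.erase k) := by
        rw [odd_mem_config]
        rintro (h | h)
        · exact disjoint_left.1 hDO h (hQ hkQ)
        · exact notMem_erase _ _ h
      congr 1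
      rw [moveBead, moveBead] at h3
      have h6 := congrArg (fun s => Finset.erase s (2 * k + 1)) h3
      rw [erase_insert (fun h => h5 (mem_erase.1 h).2),
        erase_insert (fun h => hk1 (mem_erase.1 h).2)] at h6
      rw [← insert_erase h4, h6, insert_erase hk]

/-- Swapping the runners fixes the rows with two beads or none and replaces `Q` by `O \ Q`, so
`runnerSwap_family` applies with `c` the difference of the runners. -/
theorem runnerSwap_beads (B : Finset ℕ) :
    runnerSwap ((#B : ZMod 2) + 1) (runnerDiff B) (spe (partitionOfBeads B)) =
        spe (partitionOfBeads (swapRunners B)) ∨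
      runnerSwap ((#B : ZMod 2) + 1) (runnerDiff B) (spe (partitionOfBeads B)) =
        -spe (partitionOfBeads (swapRunners B)) := by
  set X := runner 0 B with hX
  set Y := runner 1 B with hY
  set D := X ∩ Y with hD
  set O := X \ Y ∪ Y \ X with hO
  set Q := Y \ X with hQ
  have hQO : Q ⊆ O := subset_union_right
  have hDO : Disjoint D O := by
    rw [disjoint_left]
    intro k h1 h2
    simp only [hD, hO, hQ, mem_inter, mem_union, mem_sdiff] at h1 h2
    tauto
  have hsd : O \ Q = X \ Y := by
    ext k
    simp only [hO, hQ, mem_union, mem_sdiff]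
    tauto
  have hB : config D O Q = B := by
    rw [config, hsd, ← ofRunners_runner B]
    congr 1
    · ext k
      simp only [hD, mem_union, mem_sdiff, mem_inter]
      tauto
    · ext k
      simp only [hD, hQ, mem_union, mem_sdiff, mem_inter]
      tauto
  have hB' : config D O (O \ Q) = swapRunners B := by
    rw [config, Finset.sdiff_sdiff_eq_self hQO, hsd, swapRunners_eq]
    congr 1
    · ext k
      simp only [hD, hQ, mem_union, mem_sdiff, mem_inter]
      tauto
    · ext k
      simp only [hD, mem_union, mem_sdiff, mem_inter]
      tauto
  have hd : runnerDiff B = (#(O \ Q) : ℤ) - #Q := by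
    have h1 := card_sdiff_add_card_inter X Y
    have h2 := card_sdiff_add_card_inter Y X
    rw [inter_comm] at h2
    rw [runnerDiff, ← hX, ← hY, hsd, hQ]
    omega
  have hcard : #B = 2 * #D + #O := by rw [← hB, card_config hDO hQO]
  have h := runnerSwap_family (ε := ((2 * #D + #O : ℕ) + 1 : ZMod 2)) (O := O)
    (w := fun Q => spe (partitionOfBeads (config D O Q)))
    (fun Q hQ => eRes_config hDO hQ) (fun Q hQ => fInd_config hDO hQ) hQO hd
  rw [hB, hB', ← hcard] at h
  rw [h]
  rcases neg_one_pow_eq_or ℂ #(O \ Q) with h1 | h1 <;> rw [h1]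
  · left
    rw [one_smul]
  · right
    exact neg_one_smul ℂ (spe (partitionOfBeads (swapRunners B)))

theorem runnerDiff_swapRunners (B : Finset ℕ) : runnerDiff (swapRunners B) = -runnerDiff B := by
  rw [runnerDiff, runnerDiff, swapRunners_eq, runner_zero_ofRunners, runner_one_ofRunners]
  ring

theorem swapRunners_swapRunners (B : Finset ℕ) : swapRunners (swapRunners B) = B := by
  rw [swapRunners_eq (swapRunners B), swapRunners_eq, runner_zero_ofRunners, runner_one_ofRunners,
    ofRunners_runner]

theorem card_eq_runners (B : Finset ℕ) : #B = #(runner 0 B) + #(runner 1 B) := by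
  rw [← card_ofRunners, ofRunners_runner]

theorem card_swapRunners (B : Finset ℕ) : #(swapRunners B) = #B := by
  rw [swapRunners_eq, card_ofRunners, card_eq_runners B, add_comm]

/-- The sum and the difference of the two bead counts have the same parity, so $d+1$ is the residue
governing moves between the runners. -/
theorem cast_runnerDiff_add_one (B : Finset ℕ) :
    ((runnerDiff B + 1 : ℤ) : ZMod 2) = (#B : ZMod 2) + 1 := by
  rw [card_eq_runners B, runnerDiff]
  push_cast
  rw [CharTwo.sub_eq_add]

end

section

/-! ### Removing dominoes on the abacus -/

variable {r : ℕ} {μ ν lam : YoungDiagram}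

theorem runnerDiff_eq_sum (B : Finset ℕ) : runnerDiff B = ∑ b ∈ B, (-1 : ℤ) ^ b := by
  conv_rhs => rw [← ofRunners_runner B]
  rw [ofRunners, sum_union, sum_image, sum_image, runnerDiff]
  · simp [pow_mul, pow_succ, sub_eq_add_neg]
  · intro a _ b _ h
    simp only at h
    omega
  · intro a _ b _ h
    simp only at h
    omega
  · rw [disjoint_left]
    intro b h1 h2
    obtain ⟨i, _, rfl⟩ := mem_image.1 h1
    obtain ⟨j, _, h⟩ := mem_image.1 h2
    omega

theorem runnerDiff_moveBead {B : Finset ℕ} {b : ℕ} (hb : b ∈ B) (hb1 : b + 1 ∉ B) :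
    runnerDiff (moveBead B b) = runnerDiff B - 2 * (-1) ^ b := by
  rw [runnerDiff_eq_sum, runnerDiff_eq_sum, moveBead,
    sum_insert (fun h => hb1 (mem_erase.1 h).2), ← add_sum_erase B _ hb, pow_succ]
  ring

theorem runnerDiff_of_insert {x : ℕ × ℕ} (hx : x ∉ ν.cells) (h : lam.cells = insert x ν.cells)
    (hr : x.1 < r) : ∃ b : ℕ, residue x = (b : ZMod 2) + r + 1 ∧
      runnerDiff (betaSet lam r) = runnerDiff (betaSet ν r) - 2 * (-1) ^ b := by
  obtain ⟨b, hb, hb1, hset, hres, -⟩ := moveBead_of_insert hx h hr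
  exact ⟨b, hres, by rw [hset, runnerDiff_moveBead hb hb1]⟩

theorem le_of_removesDomino (h : RemovesDomino lam ν) : ν ≤ lam := by
  obtain ⟨x, y, -, -, -, hc⟩ := h
  rw [← YoungDiagram.cells_subset_iff, hc]
  exact subset_union_left

theorem colLen_mono (h : ν ≤ lam) : ν.colLen 0 ≤ lam.colLen 0 := by
  by_contra hlt
  have h1 : (lam.colLen 0, 0) ∈ ν := YoungDiagram.mem_iff_lt_colLen.2 (by omega)
  exact lt_irrefl _ (YoungDiagram.mem_iff_lt_colLen.1 (h h1))

/-- The two nodes of a domino have different residues, so the two bead moves that add them change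
the difference by opposite amounts. -/
theorem runnerDiff_of_removesDomino (h : RemovesDomino lam ν) (hr : lam.colLen 0 ≤ r) :
    runnerDiff (betaSet lam r) = runnerDiff (betaSet ν r) := by
  obtain ⟨x, y, hxy, hx, hy, hc⟩ := h
  have hyx : ¬ y ≤ x := by
    rintro ⟨h1, h2⟩
    rcases hxy with rfl | rfl
    · simp at h2
    · simp at h1
  have hne : y ≠ x := fun h => hyx h.le
  have hrow : ∀ c ∈ lam.cells, c.1 < r := by
    intro c hcm
    have h1 : (c.1, 0) ∈ lam := lam.up_left_mem le_rfl (Nat.zero_le c.2) hcm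
    have := YoungDiagram.mem_iff_lt_colLen.1 h1
    omega
  have hxl : x ∈ lam.cells := by rw [hc]; simp
  have hyl : y ∈ lam.cells := by rw [hc]; simp
  -- The domino is added one node at a time. Adding `x` first gives a diagram because `y` is not
  -- weakly above and to the left of `x`.
  obtain ⟨κ, hκ⟩ : ∃ κ : YoungDiagram, κ.cells = insert x ν.cells := by
    refine ⟨⟨insert x ν.cells, ?_⟩, rfl⟩
    intro c d hdc hcm
    rw [mem_coe, mem_insert] at hcm ⊢
    rcases hcm with rfl | hcm
    · have hd : d ∈ lam.cells := lam.isLowerSet hdc hxl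
      rw [hc] at hd
      simp only [mem_union, mem_insert, mem_singleton] at hd
      rcases hd with hd | hd | hd
      · exact Or.inr hd
      · exact Or.inl hd
      · exact absurd (hd ▸ hdc) hyx
    · exact Or.inr (ν.isLowerSet hdc hcm)
  have hyκ : y ∉ κ.cells := by
    rw [hκ, mem_insert]
    rintro (h | h)
    · exact hne h
    · exact hy h
  have hlam : lam.cells = insert y κ.cells := by
    rw [hκ, hc]
    ext c
    simp only [mem_union, mem_insert, mem_singleton]
    tauto
  obtain ⟨b, hb, h1⟩ := runnerDiff_of_insert hx hκ (hrow x hxl)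
  obtain ⟨c, hc', h2⟩ := runnerDiff_of_insert hyκ hlam (hrow y hyl)
  have hres : residue y = residue x + 1 := by
    rcases hxy with rfl | rfl
    · simp only [residue]
      push_cast
      ring
    · simp only [residue]
      push_cast
      rw [sub_add_eq_sub_sub, CharTwo.sub_eq_add (_ - _) (1 : ZMod 2)]
  have hpar : ((c : ℕ) : ZMod 2) = ((b + 1 : ℕ) : ZMod 2) := by
    rw [hb, hc'] at hres
    push_cast
    linear_combination hres
  have hpow : (-1 : ℤ) ^ c = -(-1) ^ b := by
    rw [ZMod.natCast_eq_natCast_iff'] at hpar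
    rw [neg_one_pow_eq_pow_mod_two, hpar, ← neg_one_pow_eq_pow_mod_two, pow_succ]
    ring
  rw [h2, h1, hpow]
  ring

theorem runnerDiff_of_reflTransGen (h : Relation.ReflTransGen RemovesDomino lam ν)
    (hr : lam.colLen 0 ≤ r) :
    runnerDiff (betaSet lam r) = runnerDiff (betaSet ν r) ∧ ν.colLen 0 ≤ r := by
  induction h with
  | refl => exact ⟨rfl, hr⟩
  | tail _ hd ih =>
    exact ⟨ih.1.trans (runnerDiff_of_removesDomino hd ih.2),
      (colLen_mono (le_of_removesDomino hd)).trans ih.2⟩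

/-! ### Existence of cores -/

theorem mem_staircase {a i j : ℕ} : (i, j) ∈ (staircase a).cells ↔ i + j < a := by
  simp only [staircase, mem_filter, mem_product, mem_range]
  omega

/-- The node below the first node of a horizontal domino, or to the right of that of a vertical one,
still lies in the staircase and would remain without it. -/
theorem not_removesDomino_staircase (a : ℕ) (ν : YoungDiagram) :
    ¬ RemovesDomino (staircase a) ν := by
  rintro ⟨⟨i, j⟩, y, hxy, hx, hy, hc⟩
  have hin : ∀ z : ℕ × ℕ, z ∈ (staircase a).cells → z ≠ (i, j) → z ≠ y → z ∈ ν.cells := by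
    intro z hz h1 h2
    rw [hc] at hz
    simp only [mem_union, mem_insert, mem_singleton] at hz
    tauto
  have hym : y ∈ (staircase a).cells := by rw [hc]; simp
  rcases hxy with rfl | rfl
  · rw [mem_staircase] at hym
    simp only at hym
    have h1 := hin (i + 1, j) (mem_staircase.2 (by omega)) (by simp) (by simp)
    exact hx (ν.up_left_mem (by omega) le_rfl h1)
  · rw [mem_staircase] at hym
    simp only at hym
    have h1 := hin (i, j + 1) (mem_staircase.2 (by omega)) (by simp) (by simp)
    exact hx (ν.up_left_mem le_rfl (by omega) h1)

theorem exists_removesDomino_of_row {i : ℕ} (h : μ.rowLen (i + 1) + 2 ≤ μ.rowLen i) :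
    ∃ ν, RemovesDomino μ ν := by
  obtain ⟨ρ, h1, h2⟩ := exists_remove_node (ν := μ) (i := i) (by omega)
  have hrow := rowLen_of_insert h1 h2
  have hri := hrow i
  have hri' := hrow (i + 1)
  rw [if_pos rfl] at hri
  rw [if_neg (by simp)] at hri'
  obtain ⟨σ, h3, h4⟩ := exists_remove_node (ν := ρ) (i := i) (by omega)
  refine ⟨σ, (i, ρ.rowLen i - 1), (i, μ.rowLen i - 1), Or.inl ?_, h3, ?_, ?_⟩
  · exact Prod.ext rfl (by simp only; omega)
  · exact fun h => h1 (by rw [h4]; exact mem_insert_of_mem h)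
  · rw [h2, h4]
    ext c
    simp only [mem_union, mem_insert, mem_singleton]
    tauto

theorem exists_removesDomino_of_col {i : ℕ} (h : μ.rowLen i ≤ μ.rowLen (i + 1))
    (hpos : 0 < μ.rowLen i) : ∃ ν, RemovesDomino μ ν := by
  have hex : ∃ m, μ.rowLen m < μ.rowLen i :=
    ⟨μ.colLen 0, by rwa [rowLen_eq_zero le_rfl]⟩
  -- Rows `i` to `m - 1` have equal length, so the last nodes of rows `m - 2` and `m - 1` form a
  -- removable vertical domino.
  set m := Nat.find hex with hm
  have hlt : μ.rowLen m < μ.rowLen i := Nat.find_spec hex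
  have hge : ∀ k < m, μ.rowLen i ≤ μ.rowLen k := fun k hk => not_lt.1 (Nat.find_min hex hk)
  have him : i + 2 ≤ m := by
    by_contra hcon
    have := μ.rowLen_anti m (i + 1) (by omega)
    omega
  obtain ⟨p, hp⟩ : ∃ p, m = p + 2 := ⟨m - 2, by omega⟩
  rw [hp] at hlt hge
  have e0 := hge p (by omega)
  have e1 := hge (p + 1) (by omega)
  have e2 := μ.rowLen_anti i p (by omega)
  have e3 := μ.rowLen_anti i (p + 1) (by omega)
  obtain ⟨ρ, h1, h2⟩ := exists_remove_node (ν := μ) (i := p + 1)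
    (show μ.rowLen (p + 2) < μ.rowLen (p + 1) by omega)
  have hrow := rowLen_of_insert h1 h2
  have hr0 := hrow p
  have hr1 := hrow (p + 1)
  rw [if_neg (by simp)] at hr0
  rw [if_pos rfl] at hr1
  obtain ⟨σ, h3, h4⟩ := exists_remove_node (ν := ρ) (i := p) (by omega)
  refine ⟨σ, (p, ρ.rowLen p - 1), (p + 1, μ.rowLen (p + 1) - 1), Or.inr ?_, h3, ?_, ?_⟩
  · exact Prod.ext rfl (by simp only; omega)
  · exact fun h => h1 (by rw [h4]; exact mem_insert_of_mem h)
  · rw [h2, h4]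
    ext c
    simp only [mem_union, mem_insert, mem_singleton]
    tauto

/-- With no horizontal domino to remove, consecutive rows differ by at most one; with no vertical
one, non-zero rows strictly decrease. -/
theorem eq_staircase (h : ∀ ν, ¬ RemovesDomino μ ν) : μ = staircase (μ.rowLen 0) := by
  have hrow : ∀ i, μ.rowLen i = μ.rowLen 0 - i := by
    intro i
    induction i with
    | zero => rfl
    | succ i ih =>
      have h1 : ¬ μ.rowLen (i + 1) + 2 ≤ μ.rowLen i := fun hc =>
        (exists_removesDomino_of_row hc).elim h
      have h2 : ¬ (μ.rowLen i ≤ μ.rowLen (i + 1) ∧ 0 < μ.rowLen i) := fun hc =>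
        (exists_removesDomino_of_col hc.1 hc.2).elim h
      have h3 := μ.rowLen_anti i (i + 1) (by omega)
      omega
  ext ⟨i, j⟩
  rw [mem_staircase, YoungDiagram.mem_cells, YoungDiagram.mem_iff_lt_rowLen, hrow i]
  omega

theorem exists_isTwoCore (μ : YoungDiagram) : ∃ a, IsTwoCore μ (staircase a) := by
  induction hn : μ.card using Nat.strong_induction_on generalizing μ with
  | _ n ih =>
    by_cases h : ∃ ν, RemovesDomino μ ν
    · obtain ⟨ν, hν⟩ := h
      have hlt : ν.card < n := by
        rw [← hn]
        obtain ⟨x, y, -, hx, -, hc⟩ := hν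
        refine card_lt_card ⟨?_, fun hsub => hx (hsub ?_)⟩
        · rw [hc]
          exact subset_union_left
        · rw [hc]
          simp
      obtain ⟨a, ha⟩ := ih _ hlt ν rfl
      exact ⟨a, Relation.ReflTransGen.head hν ha.1, ha.2⟩
    · push Not at h
      refine ⟨μ.rowLen 0, ?_, not_removesDomino_staircase _⟩
      rw [← eq_staircase h]

/-! ### Changing the number of beads -/

/-- The configuration obtained by adding a bead at the beginning. -/
def shiftBeads (B : Finset ℕ) : Finset ℕ := insert 0 (B.image (· + 1))

theorem betaSet_succ (h : μ.colLen 0 ≤ r) : betaSet μ (r + 1) = shiftBeads (betaSet μ r) := by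
  ext b
  rw [shiftBeads, mem_insert, mem_image, mem_betaSet]
  constructor
  · rintro ⟨i, hi, rfl⟩
    rcases Nat.lt_or_ge i r with hlt | hge
    · exact Or.inr ⟨_, mem_betaSet.2 ⟨i, hlt, rfl⟩, by omega⟩
    · left
      rw [rowLen_eq_zero (by omega)]
      omega
  · rintro (rfl | ⟨c, hc, rfl⟩)
    · exact ⟨r, by omega, by rw [rowLen_eq_zero h]; omega⟩
    · obtain ⟨i, hi, rfl⟩ := mem_betaSet.1 hc
      exact ⟨i, by omega, by omega⟩

theorem partitionOfBeads_shiftBeads (B : Finset ℕ) :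
    partitionOfBeads (shiftBeads B) = partitionOfBeads B := by
  have h1 := colLen_partitionOfBeads B
  have h2 := betaSet_succ h1
  rw [betaSet_partitionOfBeads] at h2
  rw [← h2, partitionOfBeads_betaSet (by omega)]

/-- Shifting all positions by one turns runner `0` into runner `1`, and runner `1` into runner `0`
one row further down, with the new bead on top. -/
theorem runner_zero_shiftBeads (B : Finset ℕ) :
    runner 0 (shiftBeads B) = shiftBeads (runner 1 B) := by
  ext k
  rw [mem_runner_zero, shiftBeads, shiftBeads, mem_insert, mem_insert, mem_image, mem_image]
  constructor
  · rintro (h | ⟨b, hb, h⟩)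
    · exact Or.inl (by omega)
    · exact Or.inr ⟨k - 1, mem_runner_one.2 (by rwa [show 2 * (k - 1) + 1 = b by omega]), by omega⟩
  · rintro (rfl | ⟨b, hb, rfl⟩)
    · exact Or.inl rfl
    · exact Or.inr ⟨_, mem_runner_one.1 hb, by omega⟩

theorem runner_one_shiftBeads (B : Finset ℕ) : runner 1 (shiftBeads B) = runner 0 B := by
  ext k
  rw [mem_runner_one, shiftBeads, mem_insert, mem_image, mem_runner_zero]
  constructor
  · rintro (h | ⟨b, hb, h⟩)
    · omega
    · rwa [show 2 * k = b by omega]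
  · exact fun h => Or.inr ⟨_, h, rfl⟩

theorem card_shiftBeads (B : Finset ℕ) : #(shiftBeads B) = #B + 1 := by
  rw [shiftBeads, card_insert_of_notMem, card_image_of_injective _ (add_left_injective 1)]
  simp

theorem runnerDiff_betaSet_succ (h : μ.colLen 0 ≤ r) :
    runnerDiff (betaSet μ (r + 1)) = 1 - runnerDiff (betaSet μ r) := by
  rw [betaSet_succ h, runnerDiff, runnerDiff, runner_zero_shiftBeads, runner_one_shiftBeads,
    card_shiftBeads]
  push_cast
  ring

/-- The pair of partitions read off the runners of the `r`-bead display. -/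
def quotientAt (μ : YoungDiagram) (r : ℕ) : YoungDiagram × YoungDiagram :=
  (partitionOfBeads (runner 0 (betaSet μ r)), partitionOfBeads (runner 1 (betaSet μ r)))

theorem quotientAt_succ (h : μ.colLen 0 ≤ r) : quotientAt μ (r + 1) = (quotientAt μ r).swap := by
  rw [quotientAt, betaSet_succ h, runner_zero_shiftBeads, runner_one_shiftBeads,
    partitionOfBeads_shiftBeads, quotientAt, Prod.swap]

/-- Two extra beads restore both the difference and the order of the components. Of two consecutive
displays exactly one has non-positive difference, so all admissible displays give the same quotient.
-/
theorem twoQuotient_eq (hr : μ.colLen 0 ≤ r) (hd : runnerDiff (betaSet μ r) ≤ 0) :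
    twoQuotient μ = quotientAt μ r := by
  obtain ⟨m, rfl⟩ := Nat.exists_eq_add_of_le hr
  clear hr
  change quotientAt μ (quotientBeads μ) = _
  induction m using Nat.twoStepInduction with
  | zero =>
    rw [quotientBeads, if_pos, add_zero]
    rw [runnerDiff, add_zero] at hd
    omega
  | one =>
    rw [quotientBeads, if_neg]
    rw [runnerDiff_betaSet_succ le_rfl, runnerDiff] at hd
    omega
  | more m ih _ =>
    have h1 : μ.colLen 0 ≤ μ.colLen 0 + m := by omega
    have h2 : μ.colLen 0 ≤ μ.colLen 0 + m + 1 := by omega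
    rw [show μ.colLen 0 + (m + 2) = μ.colLen 0 + m + 1 + 1 by omega] at hd ⊢
    rw [runnerDiff_betaSet_succ h2, runnerDiff_betaSet_succ h1] at hd
    rw [quotientAt_succ h2, quotientAt_succ h1, Prod.swap_swap]
    exact ih (by omega)

/-! ### The abacus display of a partition with given core -/

theorem colLen_staircase (a : ℕ) : (staircase a).colLen 0 = a := by
  have key : ∀ i, i < (staircase a).colLen 0 ↔ i < a := by
    intro i
    rw [← YoungDiagram.mem_iff_lt_colLen, ← YoungDiagram.mem_cells, mem_staircase, add_zero]
  exact le_antisymm (le_of_forall_lt fun j hj => (key j).1 hj)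
    (le_of_forall_lt fun j hj => (key j).2 hj)

theorem rowLen_staircase (a i : ℕ) : (staircase a).rowLen i = a - i := by
  have key : ∀ j, j < (staircase a).rowLen i ↔ j < a - i := by
    intro j
    rw [← YoungDiagram.mem_iff_lt_rowLen, ← YoungDiagram.mem_cells, mem_staircase]
    omega
  exact le_antisymm (le_of_forall_lt fun j hj => (key j).1 hj)
    (le_of_forall_lt fun j hj => (key j).2 hj)

/-- The beads occupy the odd positions `2 * (a - i) - 1`, all on runner `1`. -/
theorem runnerDiff_staircase_self (a : ℕ) : runnerDiff (betaSet (staircase a) a) = -a := by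
  have h0 : runner 0 (betaSet (staircase a) a) = ∅ := by
    rw [eq_empty_iff_forall_notMem]
    intro k hk
    rw [mem_runner_zero, mem_betaSet] at hk
    obtain ⟨i, hi, h⟩ := hk
    rw [rowLen_staircase] at h
    omega
  have h1 := card_eq_runners (betaSet (staircase a) a)
  rw [h0, card_empty, card_betaSet, zero_add] at h1
  rw [runnerDiff, h0, ← h1, card_empty]
  simp

theorem runnerDiff_staircase {a : ℕ} (hr : a ≤ r) :
    runnerDiff (betaSet (staircase a) r) = -a ∨ runnerDiff (betaSet (staircase a) r) = a + 1 := by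
  induction r, hr using Nat.le_induction with
  | base => exact Or.inl (runnerDiff_staircase_self a)
  | succ r hr ih =>
    rw [runnerDiff_betaSet_succ (by rwa [colLen_staircase])]
    omega

theorem runnerDiff_of_isTwoCore {a : ℕ} (h : IsTwoCore μ (staircase a)) (hr : μ.colLen 0 ≤ r) :
    runnerDiff (betaSet μ r) = -a ∨ runnerDiff (betaSet μ r) = a + 1 := by
  obtain ⟨h1, h2⟩ := runnerDiff_of_reflTransGen h.1 hr
  rw [colLen_staircase] at h2
  rw [h1]
  exact runnerDiff_staircase h2

/-- A core exists and is a staircase; the pairs $\{-a,a+1\}$ for $a\ge0$ are disjoint, so the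
difference identifies it. -/
theorem isTwoCore_of_runnerDiff {a : ℕ} (hr : μ.colLen 0 ≤ r)
    (h : runnerDiff (betaSet μ r) = -a ∨ runnerDiff (betaSet μ r) = a + 1) :
    IsTwoCore μ (staircase a) := by
  obtain ⟨b, hb⟩ := exists_isTwoCore μ
  have := runnerDiff_of_isTwoCore hb hr
  obtain rfl : a = b := by omega
  exact hb

theorem exists_beads_neg {a : ℕ} (h : IsTwoCore μ (staircase a)) (hr : μ.colLen 0 ≤ r) :
    ∃ s, r ≤ s ∧ runnerDiff (betaSet μ s) = -a := by
  rcases runnerDiff_of_isTwoCore h hr with h1 | h1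
  · exact ⟨r, le_rfl, h1⟩
  · exact ⟨r + 1, by omega, by rw [runnerDiff_betaSet_succ hr]; omega⟩

theorem eq_of_isTwoCore_of_twoQuotient {a : ℕ} (hμ : IsTwoCore μ (staircase a))
    (hν : IsTwoCore ν (staircase a)) (hq : twoQuotient μ = twoQuotient ν) : μ = ν := by
  obtain ⟨s, hs, hd⟩ := exists_beads_neg (r := max (μ.colLen 0) (ν.colLen 0)) hμ (le_max_left _ _)
  have hμs : μ.colLen 0 ≤ s := (le_max_left _ _).trans hs
  have hνs : ν.colLen 0 ≤ s := (le_max_right _ _).trans hs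
  have cμ := card_eq_runners (betaSet μ s)
  have cν := card_eq_runners (betaSet ν s)
  rw [card_betaSet] at cμ cν
  -- The other possible value $a+1$ has the wrong parity for a display with `s` beads.
  have hd' : runnerDiff (betaSet ν s) = -a := by
    rcases runnerDiff_of_isTwoCore hν hνs with h | h
    · exact h
    · rw [runnerDiff] at h hd
      omega
  rw [twoQuotient_eq hμs (by omega), twoQuotient_eq hνs (by omega), quotientAt, quotientAt,
    Prod.mk.injEq] at hq
  rw [runnerDiff] at hd hd'
  have h0 := partitionOfBeads_inj (by omega) hq.1
  have h1 := partitionOfBeads_inj (by omega) hq.2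
  refine betaSet_injective hμs hνs ?_
  rw [← ofRunners_runner (betaSet μ s), ← ofRunners_runner (betaSet ν s), h0, h1]

theorem betaSet_swap (lam : YoungDiagram) (r : ℕ) :
    betaSet (partitionOfBeads (swapRunners (betaSet lam r))) r = swapRunners (betaSet lam r) ∧
      (partitionOfBeads (swapRunners (betaSet lam r))).colLen 0 ≤ r := by
  have h1 := betaSet_partitionOfBeads (swapRunners (betaSet lam r))
  have h2 := colLen_partitionOfBeads (swapRunners (betaSet lam r))
  rw [card_swapRunners, card_betaSet] at h1 h2
  exact ⟨h1, h2⟩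

theorem quotientAt_swap (lam : YoungDiagram) (r : ℕ) :
    quotientAt (partitionOfBeads (swapRunners (betaSet lam r))) r = (quotientAt lam r).swap := by
  rw [quotientAt, (betaSet_swap lam r).1, swapRunners_eq, runner_zero_ofRunners,
    runner_one_ofRunners]
  rfl

theorem runnerSwap_abacus (hr : lam.colLen 0 ≤ r) :
    runnerSwap ((runnerDiff (betaSet lam r) + 1 : ℤ) : ZMod 2) (runnerDiff (betaSet lam r))
        (spe lam) = spe (partitionOfBeads (swapRunners (betaSet lam r))) ∨
      runnerSwap ((runnerDiff (betaSet lam r) + 1 : ℤ) : ZMod 2) (runnerDiff (betaSet lam r))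
        (spe lam) = -spe (partitionOfBeads (swapRunners (betaSet lam r))) := by
  have h := runnerSwap_beads (betaSet lam r)
  rw [← cast_runnerDiff_add_one, partitionOfBeads_betaSet hr] at h
  exact h

theorem runnerSwap_abacus_inverse (hr : lam.colLen 0 ≤ r) :
    runnerSwap ((runnerDiff (betaSet lam r) + 1 : ℤ) : ZMod 2) (-runnerDiff (betaSet lam r))
        (spe (partitionOfBeads (swapRunners (betaSet lam r)))) = spe lam ∨
      runnerSwap ((runnerDiff (betaSet lam r) + 1 : ℤ) : ZMod 2) (-runnerDiff (betaSet lam r))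
        (spe (partitionOfBeads (swapRunners (betaSet lam r)))) = -spe lam := by
  have h := runnerSwap_beads (swapRunners (betaSet lam r))
  rw [card_swapRunners, ← cast_runnerDiff_add_one, swapRunners_swapRunners,
    partitionOfBeads_betaSet hr, runnerDiff_swapRunners] at h
  exact h

end

end RunnerSwap

end

/-! ### Cores and quotients after swapping the runners -/

theorem theorem6p1 (lam : YoungDiagram) :
    (∃ a : ℕ, IsTwoCore lam (staircase a)) ∧
    (∀ a : ℕ, IsTwoCore lam (staircase a) →
      (∃ μ : YoungDiagram,
        (∀ ν : YoungDiagram,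
          (IsTwoCore ν (staircase (a + 1)) ∧ twoQuotient ν = twoQuotient lam) ↔ ν = μ) ∧
        (runnerSwap (a : ZMod 2) ((a : ℤ) + 1) (spe lam) = spe μ ∨
          runnerSwap (a : ZMod 2) ((a : ℤ) + 1) (spe lam) = -spe μ)) ∧
      (1 ≤ a → ∃ μ : YoungDiagram,
        (∀ ν : YoungDiagram,
          (IsTwoCore ν (staircase (a - 1)) ∧ twoQuotient ν = twoQuotient lam) ↔ ν = μ) ∧
        (runnerSwap ((a + 1 : ℕ) : ZMod 2) (-(a : ℤ)) (spe lam) = spe μ ∨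
          runnerSwap ((a + 1 : ℕ) : ZMod 2) (-(a : ℤ)) (spe lam) = -spe μ))) ∧
    (∀ (r : ℕ) (d : ℤ) (μ : YoungDiagram), lam.colLen 0 ≤ r →
      d = runnerDiff (betaSet lam r) →
      μ = partitionOfBeads (swapRunners (betaSet lam r)) →
      (runnerSwap ((d + 1 : ℤ) : ZMod 2) d (spe lam) = spe μ ∨
        runnerSwap ((d + 1 : ℤ) : ZMod 2) d (spe lam) = -spe μ) ∧
      (runnerSwap ((d + 1 : ℤ) : ZMod 2) (-d) (spe μ) = spe lam ∨
        runnerSwap ((d + 1 : ℤ) : ZMod 2) (-d) (spe μ) = -spe lam)) := by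
  refine ⟨exists_isTwoCore lam, fun a h => ?_, ?_⟩
  · obtain ⟨s, hs, hd⟩ := exists_beads_neg h le_rfl
    refine ⟨?_, fun ha => ?_⟩
    -- One more bead turns the difference $-a$ into $a+1$. Swapping then gives $-(a+1)$, a display
    -- with core `staircase (a + 1)`; the exchange of quotient components caused by the extra bead
    -- cancels the one caused by the swap.
    · have hs' : lam.colLen 0 ≤ s + 1 := by omega
      have hd' : runnerDiff (betaSet lam (s + 1)) = a + 1 := by
        rw [runnerDiff_betaSet_succ hs, hd]
        ring
      obtain ⟨hβ, hlen⟩ := betaSet_swap lam (s + 1)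
      have hq := quotientAt_swap lam (s + 1)
      have hS := runnerSwap_abacus hs'
      rw [hd', show (((a : ℤ) + 1 + 1 : ℤ) : ZMod 2) = (a : ZMod 2) by
        push_cast; rw [add_assoc, CharTwo.add_self_eq_zero, add_zero]] at hS
      set μ := partitionOfBeads (swapRunners (betaSet lam (s + 1)))
      have hdμ : runnerDiff (betaSet μ (s + 1)) = -((a + 1 : ℕ) : ℤ) := by
        rw [hβ, runnerDiff_swapRunners, hd']
        push_cast
        ring
      have hcore : IsTwoCore μ (staircase (a + 1)) := isTwoCore_of_runnerDiff hlen (Or.inl hdμ)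
      have hquot : twoQuotient μ = twoQuotient lam := by
        rw [twoQuotient_eq hlen (by rw [hdμ]; omega), hq, quotientAt_succ hs, Prod.swap_swap,
          twoQuotient_eq hs (by rw [hd]; omega)]
      refine ⟨μ, fun ν => ⟨fun hν => ?_, ?_⟩, hS⟩
      · exact eq_of_isTwoCore_of_twoQuotient hν.1 hcore (hν.2.trans hquot.symm)
      · rintro rfl
        exact ⟨hcore, hquot⟩
    -- Here the display with difference $-a$ is swapped directly. The new difference $a=(a-1)+1$
    -- belongs to `staircase (a - 1)`.
    · obtain ⟨hβ, hlen⟩ := betaSet_swap lam s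
      have hq := quotientAt_swap lam s
      have hS := runnerSwap_abacus hs
      rw [hd, show ((-(a : ℤ) + 1 : ℤ) : ZMod 2) = ((a + 1 : ℕ) : ZMod 2) by
        push_cast; rw [CharTwo.neg_eq]] at hS
      set μ := partitionOfBeads (swapRunners (betaSet lam s))
      have hdμ : runnerDiff (betaSet μ s) = a := by
        rw [hβ, runnerDiff_swapRunners, hd, neg_neg]
      have hcore : IsTwoCore μ (staircase (a - 1)) :=
        isTwoCore_of_runnerDiff hlen (Or.inr (by rw [hdμ]; omega))
      -- The difference is now positive, so the quotient of `μ` has to be read off with one more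
      -- bead, which undoes the exchange of components.
      have hquot : twoQuotient μ = twoQuotient lam := by
        rw [twoQuotient_eq (r := s + 1) (by omega)
          (by rw [runnerDiff_betaSet_succ hlen, hdμ]; omega), quotientAt_succ hlen, hq,
          Prod.swap_swap, twoQuotient_eq hs (by rw [hd]; omega)]
      refine ⟨μ, fun ν => ⟨fun hν => ?_, ?_⟩, hS⟩
      · exact eq_of_isTwoCore_of_twoQuotient hν.1 hcore (hν.2.trans hquot.symm)
      · rintro rfl
        exact ⟨hcore, hquot⟩
  · rintro r d μ hr rfl rfl
    exact ⟨runnerSwap_abacus hr, runnerSwap_abacus_inverse hr⟩
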